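/- Let $K$ be an algebraically closed field, $m \ge 2$ an integer and $\lambda \in K \setminus \{0\}$. Paths in quivers are written from left to right, and the algebra given by a quiver and relations is the quotient of its path algebra over $K$ by the two-sided ideal generated by the relations. The higher spherical algebra $S(m,\lambda)$ is given by the quiver with vertices $1,\dots,6$ and arrows $\alpha\colon 1\to 2$, $\beta\colon 2\to 3$, $\gamma\colon 3\to 4$, $\sigma\colon 4\to 1$, $\delta\colon 5\to 1$, $\nu\colon 3\to 5$, $\varrho\colon 1\to 6$, $\omega\colon 6\to 3$, and the relations \begin{align*} \beta\nu\delta &= \beta\gamma\sigma+\lambda(\beta\gamma\sigma\alpha)^{m-1}\beta\gamma\sigma, & \alpha\beta\nu &= \varrho\omega\nu,\\ \nu\delta\alpha &= \gamma\sigma\alpha+\lambda(\gamma\sigma\alpha\beta)^{m-1}\gamma\sigma\alpha, & \delta\alpha\beta &= \delta\varrho\omega,\\ \sigma\varrho\omega &= \sigma\alpha\beta+\lambda(\sigma\alpha\beta\gamma)^{m-1}\sigma\alpha\beta, & \omega\gamma\sigma &= \omega\nu\delta,\\ \varrho\omega\gamma &= \alpha\beta\gamma+\lambda(\alpha\beta\gamma\sigma)^{m-1}\alpha\beta\gamma,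 & \gamma\sigma\varrho &= \nu\delta\varrho,\\ (\alpha\beta\gamma\sigma)^m\alpha &= 0, & (\gamma\sigma\alpha\beta)^m\gamma &= 0. \end{align*} The higher tetrahedral algebra $\Lambda=\Lambda(m,\lambda)$ is given by the quiver with vertices $1,\dots,6$ and arrows $\alpha\colon 3\to 1$, $\beta\colon 4\to 2$, $\gamma\colon 4\to 1$, $\delta\colon 1\to 5$, $\varepsilon\colon 2\to 5$, $\eta\colon 5\to 4$, $\mu\colon 6\to 3$, $\nu\colon 1\to 6$, $\xi\colon 5\to 3$, $\varrho\colon 2\to 6$, $\sigma\colon 3\to 2$, $\omega\colon 6\to 4$, and the relations \begin{align*} \gamma\delta &= \beta\varepsilon+\lambda(\beta\varrho\omega)^{m-1}\beta\varepsilon, & \delta\eta&=\nu\omega, & \eta\gamma&=\xi\alpha, & \nu\mu&=\delta\xi,\\ \varrho\omega &= \varepsilon\eta+\lambda(\varepsilon\xi\sigma)^{m-1}\varepsilon\eta, & \omega\beta&=\mu\sigma, & \beta\varrho&=\gamma\nu, & \mu\alpha&=\omega\gamma,\\ \xi\sigma &= \eta\beta+\lambda(\eta\gamma\delta)^{m-1}\eta\beta,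 & \sigma\varepsilon&=\alpha\delta, & \varepsilon\xi&=\varrho\mu, & \alpha\nu&=\sigma\varrho, \end{align*} together with $\big(\theta f(\theta)f^2(\theta)\big)^{m-1}\theta f(\theta)g(f(\theta))=0$ for every arrow $\theta$, where $f=(\gamma\,\delta\,\eta)(\beta\,\varrho\,\omega)(\varepsilon\,\xi\,\sigma)(\alpha\,\nu\,\mu)$ and $g=(\delta\,\xi\,\alpha)(\nu\,\omega\,\gamma)(\beta\,\varepsilon\,\eta)(\varrho\,\mu\,\sigma)$ as permutations of the arrows. Let $P_i=e_i\Lambda$ be the projective right $\Lambda$-module at the vertex $i$; an arrow $\theta\colon j\to k$ defines a homomorphism $\theta\colon P_k\to P_j$ by left multiplication. Let $K^b(P_\Lambda)$ be the homotopy category of bounded complexes of finitely generated projective right $\Lambda$-modules. Let $T_1,T_2,T_4,T_5,T_6$ be the complexes $P_1,P_5,P_3,P_4,P_6$ concentrated in degree $0$, let $T_3$ be the complex $$P_2\xrightarrow{\left[\begin{smallmatrix}-\sigma\\ \beta\end{smallmatrix}\right]}P_3\oplus P_4$$ concentrated in degrees $1$ and $0$ (the differential lowers the degree), and let $T=T_1\oplus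 T_2\oplus T_3\oplus T_4\oplus T_5\oplus T_6$. The product in $\operatorname{End}_{K^b(P_\Lambda)}(T)$ is the composition of maps. **Theorem.** The $K$-algebras $\operatorname{End}_{K^b(P_\Lambda)}(T)$ and $S(m,\lambda)$ are isomorphic. -/

import Mathlib

open CategoryTheory CategoryTheory.Limits

universe u

/-! ### Path algebras of finite quivers

A finite quiver is given by a type `V` of vertices, a type `A` of arrows, and the source and target
maps `s t : A → V`. -/

section PathAlgebra

variable (K : Type u) [Field K] {V A : Type} [Fintype V] (s t : A → V)

/-- The relations between the trivial paths `e i` and the arrows which present the path algebra `KQ`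
as a quotient of the free algebra on vertices and arrows. Paths are written from left to right:
an arrow `a : i → j` satisfies `a = e i * a * e j`. -/
inductive PathAlgebraRel :
    FreeAlgebra K (V ⊕ A) → FreeAlgebra K (V ⊕ A) → Prop
  | idem (i : V) : PathAlgebraRel
      (FreeAlgebra.ι K (Sum.inl i) * FreeAlgebra.ι K (Sum.inl i)) (FreeAlgebra.ι K (Sum.inl i))
  | orth (i j : V) (h : i ≠ j) : PathAlgebraRel
      (FreeAlgebra.ι K (Sum.inl i) * FreeAlgebra.ι K (Sum.inl j)) 0
  | sum_eq_one : PathAlgebraRel (∑ i : V, FreeAlgebra.ι K (Sum.inl i)) 1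
  | source (a : A) : PathAlgebraRel
      (FreeAlgebra.ι K (Sum.inl (s a)) * FreeAlgebra.ι K (Sum.inr a)) (FreeAlgebra.ι K (Sum.inr a))
  | target (a : A) : PathAlgebraRel
      (FreeAlgebra.ι K (Sum.inr a) * FreeAlgebra.ι K (Sum.inl (t a))) (FreeAlgebra.ι K (Sum.inr a))

/-- The path algebra `KQ` of the finite quiver `Q = (V, A, s, t)`. -/
def PathAlgebra : Type u := RingQuot (PathAlgebraRel K s t)

namespace PathAlgebra

noncomputable instance : Ring (PathAlgebra K s t) :=
  inferInstanceAs (Ring (RingQuot (PathAlgebraRel K s t)))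

noncomputable instance : Algebra K (PathAlgebra K s t) :=
  inferInstanceAs (Algebra K (RingQuot (PathAlgebraRel K s t)))

/-- The trivial path at the vertex `i`. -/
noncomputable def e (i : V) : PathAlgebra K s t :=
  RingQuot.mkAlgHom K (PathAlgebraRel K s t) (FreeAlgebra.ι K (Sum.inl i))

/-- An arrow as an element of the path algebra. -/
noncomputable def arrow (a : A) : PathAlgebra K s t :=
  RingQuot.mkAlgHom K (PathAlgebraRel K s t) (FreeAlgebra.ι K (Sum.inr a))

/-- The product (from left to right) of a list of arrows: a path, if the arrows are composable. -/
noncomputable def path (l : List A) : PathAlgebra K s t := (l.map (arrow K s t)).prod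

theorem e_mul_e (i : V) : e K s t i * e K s t i = e K s t i :=
  (map_mul _ _ _).symm.trans (RingQuot.mkAlgHom_rel K (PathAlgebraRel.idem i))

theorem e_mul_arrow (a : A) : e K s t (s a) * arrow K s t a = arrow K s t a :=
  (map_mul _ _ _).symm.trans (RingQuot.mkAlgHom_rel K (PathAlgebraRel.source a))

theorem arrow_mul_e (a : A) : arrow K s t a * e K s t (t a) = arrow K s t a :=
  (map_mul _ _ _).symm.trans (RingQuot.mkAlgHom_rel K (PathAlgebraRel.target a))

end PathAlgebra

end PathAlgebra

/-- The six vertices `1, …, 6`, used for both quivers below. -/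
inductive Vertex : Type
  | v1 | v2 | v3 | v4 | v5 | v6
  deriving DecidableEq

instance : Fintype Vertex where
  elems := {.v1, .v2, .v3, .v4, .v5, .v6}
  complete i := by cases i <;> decide

/-! ### The higher spherical algebra `S(m, λ)` -/

/-- The arrows of the quiver `Δ`. -/
inductive SArrow : Type
  | α | β | γ | δ | ν | ρ | σ | ω

namespace SArrow

def source : SArrow → Vertex
  | α => .v1
  | β => .v2
  | γ => .v3
  | δ => .v5
  | ν => .v3
  | ρ => .v1
  | σ => .v4
  | ω => .v6

def target : SArrow → Vertex
  | α => .v2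
  | β => .v3
  | γ => .v4
  | δ => .v1
  | ν => .v5
  | ρ => .v6
  | σ => .v1
  | ω => .v3

end SArrow

section Spherical

variable (K : Type u) [Field K]

/-- A product of arrows of `Δ` in the path algebra `KΔ`. -/
noncomputable abbrev sPath (l : List SArrow) : PathAlgebra K SArrow.source SArrow.target :=
  PathAlgebra.path K SArrow.source SArrow.target l

open SArrow in
/-- The defining relations of `S(m, λ)`. -/
inductive SphericalRel (m : ℕ) (lam : K) :
    PathAlgebra K SArrow.source SArrow.target → PathAlgebra K SArrow.source SArrow.target → Prop
  | r1 : SphericalRel m lam (sPath K [β, ν, δ])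
      (sPath K [β, γ, σ] + lam • (sPath K [β, γ, σ, α] ^ (m - 1) * sPath K [β, γ, σ]))
  | r2 : SphericalRel m lam (sPath K [α, β, ν]) (sPath K [ρ, ω, ν])
  | r3 : SphericalRel m lam (sPath K [ν, δ, α])
      (sPath K [γ, σ, α] + lam • (sPath K [γ, σ, α, β] ^ (m - 1) * sPath K [γ, σ, α]))
  | r4 : SphericalRel m lam (sPath K [δ, α, β]) (sPath K [δ, ρ, ω])
  | r5 : SphericalRel m lam (sPath K [σ, ρ, ω])
      (sPath K [σ, α, β] + lam • (sPath K [σ, α, β, γ] ^ (m - 1) * sPath K [σ, α, β]))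
  | r6 : SphericalRel m lam (sPath K [ω, γ, σ]) (sPath K [ω, ν, δ])
  | r7 : SphericalRel m lam (sPath K [ρ, ω, γ])
      (sPath K [α, β, γ] + lam • (sPath K [α, β, γ, σ] ^ (m - 1) * sPath K [α, β, γ]))
  | r8 : SphericalRel m lam (sPath K [γ, σ, ρ]) (sPath K [ν, δ, ρ])
  | r9 : SphericalRel m lam (sPath K [α, β, γ, σ] ^ m * sPath K [α]) 0
  | r10 : SphericalRel m lam (sPath K [γ, σ, α, β] ^ m * sPath K [γ]) 0

/-- The algebra `S(m, λ)`: the path algebra of `Δ` modulo the two-sided ideal generated by the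
relations. -/
def SphericalAlgebra (m : ℕ) (lam : K) : Type u := RingQuot (SphericalRel K m lam)

noncomputable instance (m : ℕ) (lam : K) : Ring (SphericalAlgebra K m lam) :=
  inferInstanceAs (Ring (RingQuot (SphericalRel K m lam)))

noncomputable instance (m : ℕ) (lam : K) : Algebra K (SphericalAlgebra K m lam) :=
  inferInstanceAs (Algebra K (RingQuot (SphericalRel K m lam)))

end Spherical

/-! ### The higher tetrahedral algebra `Λ(m, λ)` -/

/-- The arrows of the triangulation quiver `Q` of the tetrahedron. -/
inductive TArrow : Type
  | α | β | γ | δ | ε | η | μ | ν | ξ | ρ | σ | ω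

namespace TArrow

def source : TArrow → Vertex
  | α => .v3
  | β => .v4
  | γ => .v4
  | δ => .v1
  | ε => .v2
  | η => .v5
  | μ => .v6
  | ν => .v1
  | ξ => .v5
  | ρ => .v2
  | σ => .v3
  | ω => .v6

def target : TArrow → Vertex
  | α => .v1
  | β => .v2
  | γ => .v1
  | δ => .v5
  | ε => .v5
  | η => .v4
  | μ => .v3
  | ν => .v6
  | ξ => .v3
  | ρ => .v6
  | σ => .v2
  | ω => .v4

/-- The permutation `f` of arrows, with orbits `(γ δ η)`, `(β ρ ω)`, `(ε ξ σ)`, `(α ν μ)`. -/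
def f : TArrow → TArrow
  | γ => δ
  | δ => η
  | η => γ
  | β => ρ
  | ρ => ω
  | ω => β
  | ε => ξ
  | ξ => σ
  | σ => ε
  | α => ν
  | ν => μ
  | μ => α

/-- The permutation `g` of arrows, with orbits `(δ ξ α)`, `(ν ω γ)`, `(β ε η)`, `(ρ μ σ)`. -/
def g : TArrow → TArrow
  | δ => ξ
  | ξ => α
  | α => δ
  | ν => ω
  | ω => γ
  | γ => ν
  | β => ε
  | ε => η
  | η => β
  | ρ => μ
  | μ => σ
  | σ => ρ

end TArrow

section Tetrahedral

variable (K : Type u) [Field K]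

/-- A product of arrows of `Q` in the path algebra `KQ`. -/
noncomputable abbrev tPath (l : List TArrow) : PathAlgebra K TArrow.source TArrow.target :=
  PathAlgebra.path K TArrow.source TArrow.target l

open TArrow in
/-- The defining relations of `Λ(m, λ)`. -/
inductive TetrahedralRel (m : ℕ) (lam : K) :
    PathAlgebra K TArrow.source TArrow.target → PathAlgebra K TArrow.source TArrow.target → Prop
  | r1 : TetrahedralRel m lam (tPath K [γ, δ])
      (tPath K [β, ε] + lam • (tPath K [β, ρ, ω] ^ (m - 1) * tPath K [β, ε]))
  | r2 : TetrahedralRel m lam (tPath K [δ, η]) (tPath K [ν, ω])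
  | r3 : TetrahedralRel m lam (tPath K [η, γ]) (tPath K [ξ, α])
  | r4 : TetrahedralRel m lam (tPath K [ν, μ]) (tPath K [δ, ξ])
  | r5 : TetrahedralRel m lam (tPath K [ρ, ω])
      (tPath K [ε, η] + lam • (tPath K [ε, ξ, σ] ^ (m - 1) * tPath K [ε, η]))
  | r6 : TetrahedralRel m lam (tPath K [ω, β]) (tPath K [μ, σ])
  | r7 : TetrahedralRel m lam (tPath K [β, ρ]) (tPath K [γ, ν])
  | r8 : TetrahedralRel m lam (tPath K [μ, α]) (tPath K [ω, γ])
  | r9 : TetrahedralRel m lam (tPath K [ξ, σ])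
      (tPath K [η, β] + lam • (tPath K [η, γ, δ] ^ (m - 1) * tPath K [η, β]))
  | r10 : TetrahedralRel m lam (tPath K [σ, ε]) (tPath K [α, δ])
  | r11 : TetrahedralRel m lam (tPath K [ε, ξ]) (tPath K [ρ, μ])
  | r12 : TetrahedralRel m lam (tPath K [α, ν]) (tPath K [σ, ρ])
  | zero (θ : TArrow) : TetrahedralRel m lam
      (tPath K [θ, f θ, f (f θ)] ^ (m - 1) * tPath K [θ, f θ, g (f θ)]) 0

/-- The algebra `Λ(m, λ)`: the path algebra of `Q` modulo the two-sided ideal generated by the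
relations. -/
def TetrahedralAlgebra (m : ℕ) (lam : K) : Type u := RingQuot (TetrahedralRel K m lam)

variable (m : ℕ) (lam : K)

noncomputable instance : Ring (TetrahedralAlgebra K m lam) :=
  inferInstanceAs (Ring (RingQuot (TetrahedralRel K m lam)))

noncomputable instance : Algebra K (TetrahedralAlgebra K m lam) :=
  inferInstanceAs (Algebra K (RingQuot (TetrahedralRel K m lam)))

namespace TetrahedralAlgebra

/-- The quotient map `KQ → Λ(m, λ)`. -/
noncomputable def mk :
    PathAlgebra K TArrow.source TArrow.target →ₐ[K] TetrahedralAlgebra K m lam :=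
  RingQuot.mkAlgHom K (TetrahedralRel K m lam)

/-- The idempotent of `Λ(m, λ)` at the vertex `i`. -/
noncomputable def e (i : Vertex) : TetrahedralAlgebra K m lam :=
  mk K m lam (PathAlgebra.e K TArrow.source TArrow.target i)

/-- An arrow as an element of `Λ(m, λ)`. -/
noncomputable def arrow (θ : TArrow) : TetrahedralAlgebra K m lam :=
  mk K m lam (PathAlgebra.arrow K TArrow.source TArrow.target θ)

theorem e_mul_e (i : Vertex) : e K m lam i * e K m lam i = e K m lam i := by
  rw [e, ← map_mul, PathAlgebra.e_mul_e]

theorem e_mul_arrow (θ : TArrow) :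
    e K m lam θ.source * arrow K m lam θ = arrow K m lam θ := by
  rw [e, arrow, ← map_mul, PathAlgebra.e_mul_arrow]

theorem arrow_mul_e (θ : TArrow) :
    arrow K m lam θ * e K m lam θ.target = arrow K m lam θ := by
  rw [e, arrow, ← map_mul, PathAlgebra.arrow_mul_e]

/-- The right module `P i = e i Λ`. Right `Λ`-modules are modules over the opposite algebra
`Λᵐᵒᵖ`. -/
noncomputable def P (i : Vertex) :
    Submodule (TetrahedralAlgebra K m lam)ᵐᵒᵖ (TetrahedralAlgebra K m lam) :=
  LinearMap.range (LinearMap.mulLeft (TetrahedralAlgebra K m lam)ᵐᵒᵖ (e K m lam i))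

/-- For an arrow `θ : j → k`, the homomorphism `θ : P k → P j`, `x ↦ θ x`. -/
noncomputable def leftMul (θ : TArrow) :
    P K m lam θ.target →ₗ[(TetrahedralAlgebra K m lam)ᵐᵒᵖ] P K m lam θ.source :=
  (LinearMap.mulLeft (TetrahedralAlgebra K m lam)ᵐᵒᵖ (arrow K m lam θ)).restrict
    fun x _ => ⟨arrow K m lam θ * x, by
      rw [LinearMap.mulLeft_apply, ← mul_assoc, e_mul_arrow, LinearMap.mulLeft_apply]⟩

/-- The identification of the right regular module with `Λᵐᵒᵖ` as a left module over itself. -/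
def opEquiv (A : Type u) [Ring A] : A ≃ₗ[Aᵐᵒᵖ] Aᵐᵒᵖ where
  toFun := MulOpposite.op
  invFun := MulOpposite.unop
  map_add' _ _ := rfl
  map_smul' _ _ := rfl

instance finite_P (i : Vertex) :
    Module.Finite (TetrahedralAlgebra K m lam)ᵐᵒᵖ (P K m lam i) :=
  have := Module.Finite.equiv (opEquiv (TetrahedralAlgebra K m lam)).symm
  Module.Finite.range (LinearMap.mulLeft (TetrahedralAlgebra K m lam)ᵐᵒᵖ (e K m lam i))

instance projective_P (i : Vertex) :
    Module.Projective (TetrahedralAlgebra K m lam)ᵐᵒᵖ (P K m lam i) :=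
  have := Module.Projective.of_equiv (opEquiv (TetrahedralAlgebra K m lam)).symm
  Module.Projective.of_split (P K m lam i).subtype
    (LinearMap.mulLeft (TetrahedralAlgebra K m lam)ᵐᵒᵖ (e K m lam i)).rangeRestrict (by
      ext ⟨_, y, rfl⟩
      change e K m lam i * (e K m lam i * y) = e K m lam i * y
      rw [← mul_assoc, e_mul_e])

end TetrahedralAlgebra

end Tetrahedral

/-! ### The category `K^b(P_A)` -/

section Kb

variable (A : Type u) [Ring A]

/-- Bounded complexes of finitely generated projective right `A`-modules, as objects of the homotopy
category of complexes of right `A`-modules. The differentials lower the degree by one. -/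
def IsBoundedProjective :
    ObjectProperty (HomotopyCategory (ModuleCat.{u} Aᵐᵒᵖ) (ComplexShape.down ℤ)) := fun X =>
  (∃ a b : ℤ, ∀ n : ℤ, n < a ∨ b < n → IsZero (X.as.X n)) ∧
    ∀ n : ℤ, Module.Finite Aᵐᵒᵖ (X.as.X n) ∧ Module.Projective Aᵐᵒᵖ (X.as.X n)

/-- The category `K^b(P_A)`. -/
abbrev KbProj := (IsBoundedProjective A).FullSubcategory

end Kb

/-! ### The complex `T` -/

namespace TetrahedralAlgebra

variable (K : Type u) [Field K] (m : ℕ) (lam : K)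

/-- The category of right `Λ`-modules. -/
abbrev RightMod := ModuleCat.{u} (TetrahedralAlgebra K m lam)ᵐᵒᵖ

theorem rel_one_zero : (ComplexShape.down ℤ).Rel 1 0 := zero_add 1

/-- The homomorphism `P 2 → P 3 ⊕ P 4` with components `-σ` and `β`. -/
noncomputable def dT3 :
    ModuleCat.of (TetrahedralAlgebra K m lam)ᵐᵒᵖ (P K m lam .v2) ⟶
      ModuleCat.of (TetrahedralAlgebra K m lam)ᵐᵒᵖ (P K m lam .v3 × P K m lam .v4) :=
  ModuleCat.ofHom ((-leftMul K m lam .σ).prod (leftMul K m lam .β))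

/-- The module `P i` as a complex concentrated in degree `0`. -/
noncomputable def stalk (i : Vertex) :
    HomologicalComplex (RightMod K m lam) (ComplexShape.down ℤ) :=
  (HomologicalComplex.single (RightMod K m lam) (ComplexShape.down ℤ) 0).obj
    (ModuleCat.of (TetrahedralAlgebra K m lam)ᵐᵒᵖ (P K m lam i))

/-- The complexes `T 1, …, T 6`. All are concentrated in degree `0`, except `T 3`, which is the
complex `P 2 → P 3 ⊕ P 4` concentrated in degrees `1` and `0`. -/
noncomputable def TSummand :
    Vertex → HomologicalComplex (RightMod K m lam) (ComplexShape.down ℤ)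
  | .v1 => stalk K m lam .v1
  | .v2 => stalk K m lam .v5
  | .v3 => HomologicalComplex.double (dT3 K m lam) rel_one_zero
  | .v4 => stalk K m lam .v3
  | .v5 => stalk K m lam .v4
  | .v6 => stalk K m lam .v6

instance : HasFiniteBiproducts (HomologicalComplex (RightMod K m lam) (ComplexShape.down ℤ)) :=
  HasFiniteBiproducts.of_hasFiniteProducts

/-- The direct sum of `T 1, …, T 6`, as a complex. -/
noncomputable def TComplex : HomologicalComplex (RightMod K m lam) (ComplexShape.down ℤ) :=
  ⨁ TSummand K m lam

theorem TSummand_bounded (i : Vertex) (n : ℤ) (h : n < 0 ∨ 1 < n) :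
    IsZero ((TSummand K m lam i).X n) := by
  have h0 : n ≠ 0 := by omega
  have h1 : n ≠ 1 := by omega
  cases i
  case v3 => exact HomologicalComplex.isZero_double_X (dT3 K m lam) rel_one_zero n h1 h0
  all_goals exact HomologicalComplex.isZero_single_obj_X _ _ _ _ h0

/-- The modules that are finitely generated and projective. -/
def FGProj (M : RightMod K m lam) : Prop :=
  Module.Finite (TetrahedralAlgebra K m lam)ᵐᵒᵖ M ∧
    Module.Projective (TetrahedralAlgebra K m lam)ᵐᵒᵖ M

theorem FGProj.of_iso {M N : RightMod K m lam} (φ : M ≅ N) (h : FGProj K m lam M) :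
    FGProj K m lam N :=
  have := h.1
  have := h.2
  ⟨Module.Finite.equiv φ.toLinearEquiv, Module.Projective.of_equiv φ.toLinearEquiv⟩

theorem FGProj.of_isZero {M : RightMod K m lam} (h : IsZero M) : FGProj K m lam M :=
  have := ModuleCat.subsingleton_of_isZero h
  ⟨inferInstance, inferInstance⟩

theorem stalk_fgProj (i : Vertex) (n : ℤ) : FGProj K m lam ((stalk K m lam i).X n) := by
  by_cases h : n = 0
  · subst h
    exact FGProj.of_iso K m lam (HomologicalComplex.singleObjXSelf (ComplexShape.down ℤ) 0 _).symm
      ⟨finite_P K m lam i, projective_P K m lam i⟩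
  · exact FGProj.of_isZero K m lam (HomologicalComplex.isZero_single_obj_X _ _ _ _ h)

theorem TSummand_fgProj (i : Vertex) (n : ℤ) : FGProj K m lam ((TSummand K m lam i).X n) := by
  cases i
  case v3 =>
    by_cases h0 : n = 0
    · subst h0
      exact FGProj.of_iso K m lam (HomologicalComplex.doubleXIso₁ (dT3 K m lam)
        rel_one_zero one_ne_zero).symm
        ⟨inferInstanceAs (Module.Finite _ (P K m lam .v3 × P K m lam .v4)),
          inferInstanceAs (Module.Projective _ (P K m lam .v3 × P K m lam .v4))⟩
    · by_cases h1 : n = 1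
      · subst h1
        exact FGProj.of_iso K m lam (HomologicalComplex.doubleXIso₀ (dT3 K m lam)
          rel_one_zero).symm
          ⟨finite_P K m lam .v2, projective_P K m lam .v2⟩
      · exact FGProj.of_isZero K m lam (HomologicalComplex.isZero_double_X (dT3 K m lam) rel_one_zero n h1 h0)
  all_goals exact stalk_fgProj K m lam _ n

/-- The terms of `T` are the direct sums of the terms of its summands. -/
noncomputable def TComplexXIso (n : ℤ) :
    (TComplex K m lam).X n ≅ ⨁ fun i => (TSummand K m lam i).X n :=
  (HomologicalComplex.eval (RightMod K m lam) (ComplexShape.down ℤ) n).mapBiproduct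
    (TSummand K m lam)

theorem TComplex_isBoundedProjective :
    IsBoundedProjective (TetrahedralAlgebra K m lam)
      ((HomotopyCategory.quotient _ _).obj (TComplex K m lam)) := by
  have key (n : ℤ) : FGProj K m lam ((TComplex K m lam).X n) := by
    refine FGProj.of_iso K m lam (TComplexXIso K m lam n).symm ⟨?_, ?_⟩
    · have (i : Vertex) := (TSummand_fgProj K m lam i n).1
      exact Module.Finite.equiv
        (ModuleCat.biproductIsoPi fun i => (TSummand K m lam i).X n).symm.toLinearEquiv
    · have (i : Vertex) : Projective ((TSummand K m lam i).X n) :=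
        (IsProjective.iff_projective _).1 (TSummand_fgProj K m lam i n).2
      have hP : Projective (⨁ fun i => (TSummand K m lam i).X n) :=
        ⟨fun f p _ => ⟨biproduct.desc fun b => Projective.factorThru
          (biproduct.ι (fun i => (TSummand K m lam i).X n) b ≫ f) p,
          biproduct.hom_ext' _ _ fun b => by simp⟩⟩
      exact (IsProjective.iff_projective _).2 hP
  refine ⟨⟨0, 1, fun n hn => ?_⟩, key⟩
  refine IsZero.of_iso ?_ (TComplexXIso K m lam n)
  rw [IsZero.iff_id_eq_zero]
  refine biproduct.hom_ext' _ _ fun i => ?_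
  exact (TSummand_bounded K m lam i n hn).eq_of_src _ _

/-- The complex `T = T 1 ⊕ ⋯ ⊕ T 6` as an object of `K^b(P_Λ)`. -/
noncomputable def T : KbProj (TetrahedralAlgebra K m lam) where
  obj := (HomotopyCategory.quotient _ _).obj (TComplex K m lam)
  property := TComplex_isBoundedProjective K m lam

end TetrahedralAlgebra

/-! Both algebras become algebras over `K[X]`. In Λ the sum of the six 3-cycles `θ f(θ) f²(θ)` is
central; let `X` act by it. With `u = 1 + λX^(m-1)` the three relations that contain λ read `γδ =
uβε`, `ρω = uεη`, `ξσ = uηβ`, and `v = 1 - λX^(m-1)` inverts `u` wherever `X^m` acts as zero,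
because `2(m-1) ≥ m`. Each `e i Λ e j` is generated over `K[X]` by one path
(`exists_eq_smul_pathTo`), and an explicit representation on sums of modules `K[X]/X^n` shows `X^m e
j ≠ 0` (`X_pow_smul_e_ne_zero`). In `S = S(m, λ)` the sum of suitable 4-cycles plays the role of
`X`; `e i S e j` is again generated by one path, except at `(1,3)` and `(3,1)`, where two are used.

The homomorphism `S → End T` (`sphericalHom`) sends α, δ, ρ, σ to left multiplication by δ, γ, ν, α,
sends γ and ν to the inclusions of `P 3` and `P 4` into `T 3`, and sends β and ω to the maps out of
`T 3` given by `(vξ, η)` and `(μ, ω)`; these kill the differential because `vξσ = ηβ` and `μσ = ωβ`.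
The two inclusions satisfy one relation up to homotopy: after σ and β respectively they agree
(`J_σ_leg3`). The relations of `S` follow (`pathHom_eq_of_rel`).

Injectivity: a path `i → j` followed by a suitable path `j → i` is a power of `X` times a power of
`v` at `i`, and `X^m e i` has nonzero image for every `i`. This bounds the annihilator of the image
of each generator from above, and the relations of `S`, with `λ ≠ 0`, show that the generator itself
has the same annihilator. At `(1,3)` and `(3,1)` multiplication by two different arrows separates
the two generators up to multiples of `X`, where they agree.

Surjectivity: a map out of the summands in degree `0` is a matrix over Λ and is reached by
generators. A map `g` out of `T 3` is composed with the images of γ and ν; the results come from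
elements `x`, `y` of `S`, and by injectivity these inherit the relations between γ and ν. A
computation in `S` solves `wγ = x`, `wν = y` (`exists_mul_γ_eq_and_mul_ν_eq`), so `g` minus the
image of `w` vanishes on both inclusions. What is left is, up to homotopy, a multiple of a single
endomorphism of `T 3`, the image of `X^m e 3` (`exists_eq_of_THo_end`,
`sphericalHom_X_pow_smul_e_v3`). -/

section

open Polynomial

/-! ### Induction and universal property for path algebras -/

section PathAlgebraInduction

variable {K : Type u} [Field K] {V A : Type} [Fintype V] {s t : A → V}

namespace PathAlgebra

/-- A subspace of a quotient of a path algebra that contains `1` and is stable under right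
multiplication by the trivial paths and by the arrows is everything. -/
theorem mem_of_mul_mem {B : Type*} [Ring B] [Algebra K B] (φ : PathAlgebra K s t →ₐ[K] B)
    (hφ : Function.Surjective φ) (M : Submodule K B) (h1 : 1 ∈ M)
    (he : ∀ x ∈ M, ∀ i, x * φ (e K s t i) ∈ M)
    (ha : ∀ x ∈ M, ∀ a, x * φ (arrow K s t a) ∈ M) (x : B) : x ∈ M := by
  obtain ⟨y, rfl⟩ := hφ x
  obtain ⟨z, rfl⟩ := RingQuot.mkAlgHom_surjective K (PathAlgebraRel K s t) y
  suffices h : ∀ w ∈ M, w * φ (RingQuot.mkAlgHom K (PathAlgebraRel K s t) z) ∈ M by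
    simpa using h 1 h1
  induction z using FreeAlgebra.induction with
  | grade0 r =>
    intro w hw
    erw [AlgHom.commutes]
    erw [AlgHom.commutes]
    rw [← Algebra.commutes, ← Algebra.smul_def]
    exact M.smul_mem r hw
  | grade1 x =>
    intro w hw
    cases x with
    | inl i => exact he w hw i
    | inr a => exact ha w hw a
  | mul a b iha ihb =>
    intro w hw
    have : φ (RingQuot.mkAlgHom K (PathAlgebraRel K s t) (a * b)) =
        φ (RingQuot.mkAlgHom K (PathAlgebraRel K s t) a) *
          φ (RingQuot.mkAlgHom K (PathAlgebraRel K s t) b) := by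
      erw [map_mul]; erw [map_mul]
    rw [this, ← mul_assoc]
    exact ihb _ (iha w hw)
  | add a b iha ihb =>
    intro w hw
    have : φ (RingQuot.mkAlgHom K (PathAlgebraRel K s t) (a + b)) =
        φ (RingQuot.mkAlgHom K (PathAlgebraRel K s t) a) +
          φ (RingQuot.mkAlgHom K (PathAlgebraRel K s t) b) := by
      erw [map_add]; erw [map_add]
    rw [this, mul_add]
    exact M.add_mem (iha w hw) (ihb w hw)

theorem e_mul_e_of_ne {i j : V} (h : i ≠ j) : e K s t i * e K s t j = 0 :=
  ((map_mul _ _ _).symm.trans (RingQuot.mkAlgHom_rel K (PathAlgebraRel.orth i j h))).trans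
    (map_zero _)

theorem sum_e : ∑ i, e K s t i = 1 :=
  ((map_sum _ _ _).symm.trans (RingQuot.mkAlgHom_rel K PathAlgebraRel.sum_eq_one)).trans
    (map_one _)

/-- The algebra homomorphism from a path algebra given by the images of the trivial paths and of
the arrows. -/
noncomputable def lift {B : Type*} [Ring B] [Algebra K B] (ε : V → B) (x : A → B)
    (h : ∀ ⦃a b⦄, PathAlgebraRel K s t a b →
      FreeAlgebra.lift K (Sum.elim ε x) a = FreeAlgebra.lift K (Sum.elim ε x) b) :
    PathAlgebra K s t →ₐ[K] B :=
  RingQuot.liftAlgHom K ⟨FreeAlgebra.lift K (Sum.elim ε x), h⟩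

variable {B : Type*} [Ring B] [Algebra K B] (ε : V → B) (x : A → B)

theorem lift_e (h) (i : V) : lift (K := K) (s := s) (t := t) ε x h (e K s t i) = ε i :=
  (RingQuot.liftAlgHom_mkAlgHom_apply K _ _ _).trans (by simp)

theorem lift_arrow (h) (a : A) :
    lift (K := K) (s := s) (t := t) ε x h (arrow K s t a) = x a :=
  (RingQuot.liftAlgHom_mkAlgHom_apply K _ _ _).trans (by simp)

theorem lift_respects (idem : ∀ i, ε i * ε i = ε i) (orth : ∀ i j, i ≠ j → ε i * ε j = 0)
    (sum : ∑ i, ε i = 1) (hs : ∀ a, ε (s a) * x a = x a) (ht : ∀ a, x a * ε (t a) = x a)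
    ⦃a b : FreeAlgebra K (V ⊕ A)⦄ (h : PathAlgebraRel K s t a b) :
      FreeAlgebra.lift K (Sum.elim ε x) a = FreeAlgebra.lift K (Sum.elim ε x) b := by
  cases h with
  | idem i => simpa using idem i
  | orth i j h => simpa using orth i j h
  | sum_eq_one => simpa using sum
  | source a => simpa using hs a
  | target a => simpa using ht a

end PathAlgebra

end PathAlgebraInduction

/-! ### Annihilators that are powers of `X` -/

/-- Write `f = X^k g` with `k ≤ n` and `g` prime to `X`; then `g` is invertible modulo `X^(n+1)`. In
other words every nonzero ideal of `K[X]/X^(n+1)` contains the class of `X^n`. -/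
theorem exists_mul_eq_X_pow {K : Type*} [Field K] {n : ℕ} {f : K[X]} (hf : ¬ X ^ (n + 1) ∣ f) :
    ∃ g h : K[X], g * f = X ^ n - h * X ^ (n + 1) := by
  have hf0 : f ≠ 0 := by rintro rfl; simp at hf
  obtain ⟨g, hg, hd⟩ := exists_eq_pow_rootMultiplicity_mul_and_not_dvd f hf0 0
  set k := rootMultiplicity 0 f
  rw [map_zero, sub_zero] at hg hd
  have hk : k ≤ n := by
    by_contra! h
    exact hf (hg ▸ Dvd.dvd.mul_right (pow_dvd_pow _ h) g)
  obtain ⟨a, b, hab⟩ : IsCoprime g (X ^ (n + 1)) :=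
    IsCoprime.pow_right ((irreducible_X (R := K)).coprime_iff_not_dvd.2 hd).symm
  refine ⟨X ^ (n - k) * a, X ^ n * b, ?_⟩
  have : (X ^ n : K[X]) = X ^ (n - k) * X ^ k := by rw [← pow_add, Nat.sub_add_cancel hk]
  rw [hg, this]
  linear_combination X ^ (n - k) * X ^ k * hab

section SmulXPow

variable {K M : Type*} [Field K] [AddCommGroup M] [Module K[X] M] {w : M} {n : ℕ}

/-- Otherwise a multiple of `f` would act on `w` as `X^n`. This turns the nonvanishing of one vector
into the exact annihilator of `w`. -/
theorem X_pow_dvd_of_smul_eq_zero (hw : (X ^ (n + 1) : K[X]) • w = 0)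
    (hn : (X ^ n : K[X]) • w ≠ 0) {f : K[X]} (hf : f • w = 0) : X ^ (n + 1) ∣ f := by
  by_contra hd
  obtain ⟨g, h, hgh⟩ := exists_mul_eq_X_pow hd
  have := congrArg (· • w) hgh
  simp only [mul_smul, hf, sub_smul, hw, smul_zero, sub_zero] at this
  exact hn this.symm

end SmulXPow

end

/-! ### The central element of Λ and the structure of a `K[X]`-algebra -/

section

open Polynomial

namespace TetrahedralAlgebra

variable (K : Type u) [Field K] (m : ℕ) (lam : K)

local notation "tα" => arrow K m lam TArrow.α
local notation "tβ" => arrow K m lam TArrow.β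
local notation "tγ" => arrow K m lam TArrow.γ
local notation "tδ" => arrow K m lam TArrow.δ
local notation "tε" => arrow K m lam TArrow.ε
local notation "tη" => arrow K m lam TArrow.η
local notation "tμ" => arrow K m lam TArrow.μ
local notation "tν" => arrow K m lam TArrow.ν
local notation "tξ" => arrow K m lam TArrow.ξ
local notation "tρ" => arrow K m lam TArrow.ρ
local notation "tσ" => arrow K m lam TArrow.σ
local notation "tω" => arrow K m lam TArrow.ω

theorem mk_surjective : Function.Surjective (mk K m lam) :=
  RingQuot.mkAlgHom_surjective K _

theorem mk_rel {a b : PathAlgebra K TArrow.source TArrow.target}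
    (h : TetrahedralRel K m lam a b) : mk K m lam a = mk K m lam b :=
  RingQuot.mkAlgHom_rel K h

theorem mk_tPath (l : List TArrow) : mk K m lam (tPath K l) = (l.map (arrow K m lam)).prod := by
  rw [tPath, PathAlgebra.path, map_list_prod, List.map_map]; rfl

theorem e_mul_e_of_ne {i j : Vertex} (h : i ≠ j) : e K m lam i * e K m lam j = 0 := by
  rw [e, e, ← map_mul, PathAlgebra.e_mul_e_of_ne h, map_zero]

theorem sum_e : ∑ i, e K m lam i = 1 := by
  simp only [e, ← map_sum, PathAlgebra.sum_e, map_one]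

/-- The element `θ f(θ) f²(θ)`. -/
noncomputable def cyc (θ : TArrow) : TetrahedralAlgebra K m lam :=
  arrow K m lam θ * (arrow K m lam θ.f * arrow K m lam θ.f.f)

variable {K m lam}

theorem δη : tδ * tη = tν * tω := by
  simpa [mk_tPath] using mk_rel K m lam .r2

theorem ηγ : tη * tγ = tξ * tα := by
  simpa [mk_tPath] using mk_rel K m lam .r3

theorem νμ : tν * tμ = tδ * tξ := by
  simpa [mk_tPath] using mk_rel K m lam .r4

theorem ωβ : tω * tβ = tμ * tσ := by
  simpa [mk_tPath] using mk_rel K m lam .r6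

theorem βρ : tβ * tρ = tγ * tν := by
  simpa [mk_tPath] using mk_rel K m lam .r7

theorem μα : tμ * tα = tω * tγ := by
  simpa [mk_tPath] using mk_rel K m lam .r8

theorem σε : tσ * tε = tα * tδ := by
  simpa [mk_tPath] using mk_rel K m lam .r10

theorem εξ : tε * tξ = tρ * tμ := by
  simpa [mk_tPath] using mk_rel K m lam .r11

theorem αν : tα * tν = tσ * tρ := by
  simpa [mk_tPath] using mk_rel K m lam .r12

theorem γδ_aux : tγ * tδ = tβ * tε + lam • (cyc K m lam .β ^ (m - 1) * (tβ * tε)) := by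
  simpa [mk_tPath, cyc, TArrow.f] using mk_rel K m lam .r1

theorem ρω_aux : tρ * tω = tε * tη + lam • (cyc K m lam .ε ^ (m - 1) * (tε * tη)) := by
  simpa [mk_tPath, cyc, TArrow.f] using mk_rel K m lam .r5

theorem ξσ_aux : tξ * tσ = tη * tβ + lam • (cyc K m lam .η ^ (m - 1) * (tη * tβ)) := by
  simpa [mk_tPath, cyc, TArrow.f] using mk_rel K m lam .r9

theorem zero_aux (θ : TArrow) : cyc K m lam θ ^ (m - 1) *
    (arrow K m lam θ * (arrow K m lam θ.f * arrow K m lam θ.f.g)) = 0 := by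
  simpa [mk_tPath, cyc] using mk_rel K m lam (.zero θ)

theorem mul_mul_of_mul_eq {A : Type*} [Semigroup A] {a b c d : A} (h : a * b = c * d) (x : A) :
    a * (b * x) = c * (d * x) := by
  rw [← mul_assoc, h, mul_assoc]

theorem cyc_α : cyc K m lam .σ = cyc K m lam .α := by
  change tσ * (tε * tξ) = tα * (tν * tμ)
  rw [mul_mul_of_mul_eq σε, νμ]

theorem cyc_β : cyc K m lam .β = cyc K m lam .γ := by
  change tβ * (tρ * tω) = tγ * (tδ * tη)
  rw [mul_mul_of_mul_eq βρ, δη]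

theorem cyc_δ : cyc K m lam .ν = cyc K m lam .δ := by
  change tν * (tμ * tα) = tδ * (tη * tγ)
  rw [mul_mul_of_mul_eq νμ, ηγ]

theorem cyc_ε : cyc K m lam .ρ = cyc K m lam .ε := by
  change tρ * (tω * tβ) = tε * (tξ * tσ)
  rw [mul_mul_of_mul_eq εξ, ωβ]

theorem cyc_η : cyc K m lam .ξ = cyc K m lam .η := by
  change tξ * (tσ * tε) = tη * (tγ * tδ)
  rw [mul_mul_of_mul_eq ηγ, σε]

theorem cyc_μ : cyc K m lam .ω = cyc K m lam .μ := by
  change tω * (tβ * tρ) = tμ * (tα * tν)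
  rw [mul_mul_of_mul_eq μα, βρ]

variable (K m lam) in
/-- The cycle of length three at a vertex. -/
noncomputable def loop : Vertex → TetrahedralAlgebra K m lam
  | .v1 => cyc K m lam .δ
  | .v2 => cyc K m lam .ε
  | .v3 => cyc K m lam .α
  | .v4 => cyc K m lam .γ
  | .v5 => cyc K m lam .η
  | .v6 => cyc K m lam .μ

/-- The two arrows that start at a vertex have the same 3-cycle. Only the commutativity relations
without λ are needed. -/
theorem cyc_eq_loop (θ : TArrow) : cyc K m lam θ = loop K m lam θ.source := by
  cases θ
  exacts [rfl, cyc_β, rfl, rfl, rfl, rfl, rfl, cyc_δ, cyc_η, cyc_ε, cyc_α, cyc_μ]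

theorem e_mul_arrow_of_eq {θ : TArrow} {i : Vertex} (h : θ.source = i) :
    e K m lam i * arrow K m lam θ = arrow K m lam θ := by
  rw [← h, e_mul_arrow]

theorem arrow_mul_e_of_eq {θ : TArrow} {i : Vertex} (h : θ.target = i) :
    arrow K m lam θ * e K m lam i = arrow K m lam θ := by
  rw [← h, arrow_mul_e]

theorem arrow_mul_e_of_ne {θ : TArrow} {i : Vertex} (h : θ.target ≠ i) :
    arrow K m lam θ * e K m lam i = 0 := by
  rw [← arrow_mul_e, mul_assoc, e_mul_e_of_ne K m lam h, mul_zero]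

theorem e_mul_loop (i : Vertex) : e K m lam i * loop K m lam i = loop K m lam i := by
  cases i <;> exact (mul_assoc _ _ _).symm.trans (congrArg (· * _) (e_mul_arrow_of_eq rfl))

theorem loop_mul_e (i : Vertex) : loop K m lam i * e K m lam i = loop K m lam i := by
  cases i <;> (simp only [loop, cyc, mul_assoc]; exact congrArg (_ * ·) (congrArg (_ * ·) (arrow_mul_e_of_eq rfl)))

/-- Both sides are `θ f(θ) f²(θ) θ`, because `f³ = 1` and θ ends where `f(θ)` starts. -/
theorem loop_mul_arrow (θ : TArrow) : loop K m lam θ.source * arrow K m lam θ =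
    arrow K m lam θ * loop K m lam θ.target := by
  have h : θ.target = θ.f.source := by cases θ <;> rfl
  rw [h, ← cyc_eq_loop, ← cyc_eq_loop, cyc, cyc]
  simp only [mul_assoc]
  congr 4
  cases θ <;> rfl

variable (K m lam) in
/-- The sum of the cycles of length three. -/
noncomputable def loopSum : TetrahedralAlgebra K m lam := ∑ i, loop K m lam i

theorem loopSum_mul {i : Vertex} {x : TetrahedralAlgebra K m lam} (h : e K m lam i * x = x) :
    loopSum K m lam * x = loop K m lam i * x := by
  rw [loopSum, Finset.sum_mul, Finset.sum_eq_single i _ (by simp)]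
  intro j _ hj
  rw [← h, ← loop_mul_e, mul_assoc, ← mul_assoc (e K m lam j), e_mul_e_of_ne K m lam hj, zero_mul,
    mul_zero]

theorem mul_loopSum {i : Vertex} {x : TetrahedralAlgebra K m lam} (h : x * e K m lam i = x) :
    x * loopSum K m lam = x * loop K m lam i := by
  rw [loopSum, Finset.mul_sum, Finset.sum_eq_single i _ (by simp)]
  intro j _ hj
  rw [← h, ← e_mul_loop, mul_assoc, ← mul_assoc (e K m lam i), e_mul_e_of_ne K m lam hj.symm,
    zero_mul, mul_zero]

theorem mem_of_mul_mem (M : Submodule K (TetrahedralAlgebra K m lam)) (h1 : 1 ∈ M)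
    (he : ∀ x ∈ M, ∀ i, x * e K m lam i ∈ M)
    (ha : ∀ x ∈ M, ∀ θ, x * arrow K m lam θ ∈ M) (x : TetrahedralAlgebra K m lam) : x ∈ M :=
  PathAlgebra.mem_of_mul_mem (mk K m lam) (mk_surjective K m lam) M h1 he ha x

theorem loopSum_comm (x : TetrahedralAlgebra K m lam) :
    loopSum K m lam * x = x * loopSum K m lam := by
  refine mem_of_mul_mem (LinearMap.eqLocus (LinearMap.mulLeft K (loopSum K m lam))
    (LinearMap.mulRight K (loopSum K m lam))) ?_ ?_ ?_ x
  · simp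
  · intro x hx i
    simp only [LinearMap.mem_eqLocus, LinearMap.mulLeft_apply, LinearMap.mulRight_apply] at hx ⊢
    rw [← mul_assoc, hx, mul_assoc, mul_assoc, loopSum_mul (e_mul_e K m lam i),
      mul_loopSum (e_mul_e K m lam i), loop_mul_e, e_mul_loop]
  · intro x hx θ
    simp only [LinearMap.mem_eqLocus, LinearMap.mulLeft_apply, LinearMap.mulRight_apply] at hx ⊢
    rw [← mul_assoc, hx, mul_assoc, mul_assoc, loopSum_mul (e_mul_arrow K m lam θ),
      mul_loopSum (arrow_mul_e K m lam θ), loop_mul_arrow]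

/-- The higher tetrahedral algebra is an algebra over `K[X]`, with `X` acting as the sum of the
cycles of length three. -/
noncomputable instance : Algebra K[X] (TetrahedralAlgebra K m lam) :=
  (aeval (loopSum K m lam)).toRingHom.toAlgebra' fun p x => by
    induction p using Polynomial.induction_on' with
    | add p q hp hq => simp only [map_add, add_mul, mul_add, hp, hq]
    | monomial n a =>
      have h : Commute (loopSum K m lam ^ n) x := Commute.pow_left (loopSum_comm x) n
      simp [aeval_monomial, ← Algebra.smul_def, h.eq]

theorem algebraMap_eq_aeval (p : K[X]) :
    algebraMap K[X] (TetrahedralAlgebra K m lam) p = aeval (loopSum K m lam) p := rfl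

instance : IsScalarTower K K[X] (TetrahedralAlgebra K m lam) :=
  IsScalarTower.of_algebraMap_eq fun a => by
    rw [algebraMap_eq_aeval, Polynomial.algebraMap_apply, aeval_C]; rfl

theorem X_smul {i : Vertex} {x : TetrahedralAlgebra K m lam} (h : e K m lam i * x = x) :
    (X : K[X]) • x = loop K m lam i * x := by
  rw [Algebra.smul_def, algebraMap_eq_aeval, aeval_X, loopSum_mul h]

/-- Translates the powers of 3-cycles in the defining relations into powers of `X`. -/
theorem cyc_pow_mul {θ : TArrow} {x : TetrahedralAlgebra K m lam}
    (h : e K m lam θ.source * x = x) (n : ℕ) : cyc K m lam θ ^ n * x = (X ^ n : K[X]) • x := by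
  induction n with
  | zero => simp
  | succ n ih =>
    rw [pow_succ', mul_assoc, ih, pow_succ', mul_smul, X_smul (i := θ.source), cyc_eq_loop]
    rw [mul_smul_comm, h]

variable (m lam) in
/-- The unit `1 + λ X ^ (m - 1)`. -/
noncomputable def uPoly : K[X] := 1 + C lam * X ^ (m - 1)

variable (m lam) in
/-- The inverse `1 - λ X ^ (m - 1)` of `uPoly` modulo `X ^ (2 m - 2)`. -/
noncomputable def vPoly : K[X] := 1 - C lam * X ^ (m - 1)

theorem γδ : tγ * tδ = uPoly m lam • (tβ * tε) := by
  rw [γδ_aux, cyc_pow_mul, uPoly, add_smul, one_smul, mul_smul, ← algebraMap_eq, algebraMap_smul]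
  rw [← mul_assoc, e_mul_arrow]

theorem ρω : tρ * tω = uPoly m lam • (tε * tη) := by
  rw [ρω_aux, cyc_pow_mul, uPoly, add_smul, one_smul, mul_smul, ← algebraMap_eq, algebraMap_smul]
  rw [← mul_assoc, e_mul_arrow]

theorem ξσ : tξ * tσ = uPoly m lam • (tη * tβ) := by
  rw [ξσ_aux, cyc_pow_mul, uPoly, add_smul, one_smul, mul_smul, ← algebraMap_eq, algebraMap_smul]
  rw [← mul_assoc, e_mul_arrow]

theorem X_pow_smul_opp (θ : TArrow) : (X ^ (m - 1) : K[X]) •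
    (arrow K m lam θ * (arrow K m lam θ.f * arrow K m lam θ.f.g)) = 0 := by
  rw [← zero_aux θ, cyc_pow_mul]
  rw [← mul_assoc, e_mul_arrow]

theorem X_smul_arrow (θ : TArrow) : (X : K[X]) • arrow K m lam θ =
    arrow K m lam θ * (arrow K m lam θ.f * (arrow K m lam θ.f.f * arrow K m lam θ)) := by
  rw [X_smul (e_mul_arrow K m lam θ), ← cyc_eq_loop, cyc, mul_assoc, mul_assoc]

theorem X_smul_e {i : Vertex} : (X : K[X]) • e K m lam i = loop K m lam i := by
  rw [X_smul (e_mul_e K m lam i), loop_mul_e]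

/-- Here `Xθ = θ f(θ) f²(θ) θ`. Relations without λ rewrite this as `θ' f(θ') g(f(θ'))` times an
arrow, where θ' starts at the same vertex, and `X^(m-1)` kills that path by a zero relation. Mostly
`θ' = θ`; for δ, σ and ω the other arrow at the vertex is taken, since replacing the last two arrows
directly would bring in a relation with λ. -/
theorem X_pow_smul_arrow (hm : 2 ≤ m) (θ : TArrow) : (X ^ m : K[X]) • arrow K m lam θ = 0 := by
  have key (θ' : TArrow) (x : TetrahedralAlgebra K m lam) {y : TetrahedralAlgebra K m lam}
      (h : y = arrow K m lam θ' * (arrow K m lam θ'.f * (arrow K m lam θ'.f.g * x))) :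
      (X ^ (m - 1) : K[X]) • y = 0 := by
    rw [h, ← mul_assoc, ← mul_assoc, mul_assoc (arrow K m lam θ'), ← smul_mul_assoc,
      X_pow_smul_opp, zero_mul]
  have hX : (X ^ m : K[X]) = X ^ (m - 1) * X := by rw [← pow_succ, Nat.sub_add_cancel (by omega)]
  rw [hX, mul_smul, X_smul_arrow]
  cases θ
  case α =>
    refine key .α tγ ?_
    change tα * (tν * (tμ * tα)) = tα * (tν * (tω * tγ))
    rw [μα]
  case β =>
    refine key .β tσ ?_
    change tβ * (tρ * (tω * tβ)) = tβ * (tρ * (tμ * tσ))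
    rw [ωβ]
  case γ =>
    refine key .γ tα ?_
    change tγ * (tδ * (tη * tγ)) = tγ * (tδ * (tξ * tα))
    rw [ηγ]
  case δ =>
    refine key .ν tε ?_
    change tδ * (tη * (tγ * tδ)) = tν * (tμ * (tσ * tε))
    rw [mul_mul_of_mul_eq ηγ, ← mul_mul_of_mul_eq νμ, σε]
  case ε =>
    refine key .ε tδ ?_
    change tε * (tξ * (tσ * tε)) = tε * (tξ * (tα * tδ))
    rw [σε]
  case η =>
    refine key .η tω ?_
    change tη * (tγ * (tδ * tη)) = tη * (tγ * (tν * tω))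
    rw [δη]
  case μ =>
    refine key .μ tξ ?_
    change tμ * (tα * (tν * tμ)) = tμ * (tα * (tδ * tξ))
    rw [νμ]
  case ν =>
    refine key .ν tρ ?_
    change tν * (tμ * (tα * tν)) = tν * (tμ * (tσ * tρ))
    rw [αν]
  case ξ =>
    refine key .ξ tμ ?_
    change tξ * (tσ * (tε * tξ)) = tξ * (tσ * (tρ * tμ))
    rw [εξ]
  case ρ =>
    refine key .ρ tν ?_
    change tρ * (tω * (tβ * tρ)) = tρ * (tω * (tγ * tν))
    rw [βρ]
  case σ =>
    refine key .α tβ ?_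
    change tσ * (tε * (tξ * tσ)) = tα * (tν * (tω * tβ))
    rw [mul_mul_of_mul_eq σε, ωβ, mul_mul_of_mul_eq νμ]
  case ω =>
    refine key .μ tη ?_
    change tω * (tβ * (tρ * tω)) = tμ * (tα * (tδ * tη))
    rw [mul_mul_of_mul_eq βρ, mul_mul_of_mul_eq μα, δη]

end TetrahedralAlgebra

end

/-! ### Generators of `e i Λ e j` over `K[X]` -/

section

open Polynomial

/-- The vertex opposite to a vertex in the octahedron underlying the triangulation quiver. -/
def Vertex.opp : Vertex → Vertex
  | .v1 => .v2
  | .v2 => .v1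
  | .v3 => .v4
  | .v4 => .v3
  | .v5 => .v6
  | .v6 => .v5

namespace TetrahedralAlgebra

variable {K : Type u} [Field K] {m : ℕ} {lam : K}

local notation "tα" => arrow K m lam TArrow.α
local notation "tβ" => arrow K m lam TArrow.β
local notation "tγ" => arrow K m lam TArrow.γ
local notation "tδ" => arrow K m lam TArrow.δ
local notation "tε" => arrow K m lam TArrow.ε
local notation "tη" => arrow K m lam TArrow.η
local notation "tμ" => arrow K m lam TArrow.μ
local notation "tν" => arrow K m lam TArrow.ν
local notation "tξ" => arrow K m lam TArrow.ξ
local notation "tρ" => arrow K m lam TArrow.ρ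
local notation "tσ" => arrow K m lam TArrow.σ
local notation "tω" => arrow K m lam TArrow.ω

theorem e_α : e K m lam .v3 * tα = tα := e_mul_arrow K m lam .α
theorem α_e : tα * e K m lam .v1 = tα := arrow_mul_e K m lam .α
theorem e_β : e K m lam .v4 * tβ = tβ := e_mul_arrow K m lam .β
theorem β_e : tβ * e K m lam .v2 = tβ := arrow_mul_e K m lam .β
theorem e_γ : e K m lam .v4 * tγ = tγ := e_mul_arrow K m lam .γ
theorem γ_e : tγ * e K m lam .v1 = tγ := arrow_mul_e K m lam .γ
theorem e_δ : e K m lam .v1 * tδ = tδ := e_mul_arrow K m lam .δ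
theorem δ_e : tδ * e K m lam .v5 = tδ := arrow_mul_e K m lam .δ
theorem e_ε : e K m lam .v2 * tε = tε := e_mul_arrow K m lam .ε
theorem ε_e : tε * e K m lam .v5 = tε := arrow_mul_e K m lam .ε
theorem e_η : e K m lam .v5 * tη = tη := e_mul_arrow K m lam .η
theorem η_e : tη * e K m lam .v4 = tη := arrow_mul_e K m lam .η
theorem e_μ : e K m lam .v6 * tμ = tμ := e_mul_arrow K m lam .μ
theorem μ_e : tμ * e K m lam .v3 = tμ := arrow_mul_e K m lam .μ
theorem e_ν : e K m lam .v1 * tν = tν := e_mul_arrow K m lam .ν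
theorem ν_e : tν * e K m lam .v6 = tν := arrow_mul_e K m lam .ν
theorem e_ξ : e K m lam .v5 * tξ = tξ := e_mul_arrow K m lam .ξ
theorem ξ_e : tξ * e K m lam .v3 = tξ := arrow_mul_e K m lam .ξ
theorem e_ρ : e K m lam .v2 * tρ = tρ := e_mul_arrow K m lam .ρ
theorem ρ_e : tρ * e K m lam .v6 = tρ := arrow_mul_e K m lam .ρ
theorem e_σ : e K m lam .v3 * tσ = tσ := e_mul_arrow K m lam .σ
theorem σ_e : tσ * e K m lam .v2 = tσ := arrow_mul_e K m lam .σ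
theorem e_ω : e K m lam .v6 * tω = tω := e_mul_arrow K m lam .ω
theorem ω_e : tω * e K m lam .v4 = tω := arrow_mul_e K m lam .ω

theorem vPoly_mul_uPoly : vPoly m lam * uPoly m lam = 1 - C (lam ^ 2) * X ^ (2 * (m - 1)) := by
  rw [vPoly, uPoly, two_mul, pow_add, C_pow]; ring

/-- The error term `λ²X^(2(m-1))` of `vu = 1` is a multiple of `X^m`, as `2(m-1) = (m-2) + m`. -/
theorem vPoly_smul_uPoly_smul {M : Type*} [AddCommGroup M] [Module K[X] M] (hm : 2 ≤ m) {x : M}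
    (h : (X ^ m : K[X]) • x = 0) : vPoly m lam • uPoly m lam • x = x := by
  rw [← mul_smul, vPoly_mul_uPoly, sub_smul, one_smul,
    show 2 * (m - 1) = (m - 2) + m by omega, pow_add, ← mul_assoc, mul_smul, h, smul_zero, sub_zero]

theorem vPoly_smul_eq_self {M : Type*} [AddCommGroup M] [Module K[X] M] {x : M}
    (h : (X ^ (m - 1) : K[X]) • x = 0) : vPoly m lam • x = x := by
  rw [vPoly, sub_smul, one_smul, mul_smul, h, smul_zero, sub_zero]

theorem βε (hm : 2 ≤ m) : tβ * tε = vPoly m lam • (tγ * tδ) := by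
  rw [γδ, vPoly_smul_uPoly_smul hm]
  rw [← smul_mul_assoc, X_pow_smul_arrow hm, zero_mul]

theorem εη (hm : 2 ≤ m) : tε * tη = vPoly m lam • (tρ * tω) := by
  rw [ρω, vPoly_smul_uPoly_smul hm]
  rw [← smul_mul_assoc, X_pow_smul_arrow hm, zero_mul]

theorem ηβ (hm : 2 ≤ m) : tη * tβ = vPoly m lam • (tξ * tσ) := by
  rw [ξσ, vPoly_smul_uPoly_smul hm]
  rw [← smul_mul_assoc, X_pow_smul_arrow hm, zero_mul]

theorem mul_mul_of_mul_eq_smul {R A : Type*} [CommSemiring R] [Semiring A] [Algebra R A]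
    {r : R} {a b c d : A} (h : a * b = r • (c * d)) (x : A) : a * (b * x) = r • (c * (d * x)) := by
  rw [← mul_assoc, h, smul_mul_assoc, mul_assoc]

variable (K m lam) in
/-- A path from `i` to `j` that generates `e i Λ e j` over `K[X]`. -/
noncomputable def pathTo : Vertex → Vertex → TetrahedralAlgebra K m lam
  | .v1, .v1 => e K m lam .v1
  | .v1, .v2 => tδ * (tξ * tσ)
  | .v1, .v3 => tδ * tξ
  | .v1, .v4 => tδ * tη
  | .v1, .v5 => tδ
  | .v1, .v6 => tν
  | .v2, .v1 => tρ * (tω * tγ)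
  | .v2, .v2 => e K m lam .v2
  | .v2, .v3 => tε * tξ
  | .v2, .v4 => tρ * tω
  | .v2, .v5 => tε
  | .v2, .v6 => tρ
  | .v3, .v1 => tα
  | .v3, .v2 => tσ
  | .v3, .v3 => e K m lam .v3
  | .v3, .v4 => tα * (tδ * tη)
  | .v3, .v5 => tα * tδ
  | .v3, .v6 => tα * tν
  | .v4, .v1 => tγ
  | .v4, .v2 => tβ
  | .v4, .v3 => tγ * (tδ * tξ)
  | .v4, .v4 => e K m lam .v4
  | .v4, .v5 => tγ * tδ
  | .v4, .v6 => tγ * tν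
  | .v5, .v1 => tη * tγ
  | .v5, .v2 => tξ * tσ
  | .v5, .v3 => tξ
  | .v5, .v4 => tη
  | .v5, .v5 => e K m lam .v5
  | .v5, .v6 => tη * (tγ * tν)
  | .v6, .v1 => tω * tγ
  | .v6, .v2 => tω * tβ
  | .v6, .v3 => tμ
  | .v6, .v4 => tω
  | .v6, .v5 => tω * (tγ * tδ)
  | .v6, .v6 => e K m lam .v6

theorem δηγ : tδ * (tη * tγ) = (X : K[X]) • e K m lam .v1 := 
  (X_smul_e (K := K) (m := m) (lam := lam) (i := .v1)).symm
theorem εξσ : tε * (tξ * tσ) = (X : K[X]) • e K m lam .v2 := 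
  (X_smul_e (K := K) (m := m) (lam := lam) (i := .v2)).symm
theorem ρωβ : tρ * (tω * tβ) = (X : K[X]) • e K m lam .v2 := by
  rw [ωβ, ← mul_mul_of_mul_eq εξ, εξσ]
theorem αδξ : tα * (tδ * tξ) = (X : K[X]) • e K m lam .v3 := by
  rw [← νμ]; exact (X_smul_e (K := K) (m := m) (lam := lam) (i := .v3)).symm
theorem γδη : tγ * (tδ * tη) = (X : K[X]) • e K m lam .v4 := 
  (X_smul_e (K := K) (m := m) (lam := lam) (i := .v4)).symm
theorem ηγδ : tη * (tγ * tδ) = (X : K[X]) • e K m lam .v5 := 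
  (X_smul_e (K := K) (m := m) (lam := lam) (i := .v5)).symm
theorem ωγν : tω * (tγ * tν) = (X : K[X]) • e K m lam .v6 := by
  rw [← mul_mul_of_mul_eq μα]; exact (X_smul_e (K := K) (m := m) (lam := lam) (i := .v6)).symm

theorem ρωγδ : tρ * (tω * (tγ * tδ)) = (X : K[X]) • tε := by
  rw [X_smul_arrow, ← mul_mul_of_mul_eq μα, ← mul_mul_of_mul_eq εξ, ← σε]; rfl
theorem γδξσ : tγ * (tδ * (tξ * tσ)) = (X : K[X]) • tβ := by
  rw [X_smul_arrow, ← mul_mul_of_mul_eq νμ, ← mul_mul_of_mul_eq βρ, ← ωβ]; rfl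
theorem ωγδξ : tω * (tγ * (tδ * tξ)) = (X : K[X]) • tμ := by
  rw [X_smul_arrow, ← νμ, ← mul_mul_of_mul_eq μα]; rfl

theorem mul_mul_of_eq_smul_e {a b c : TetrahedralAlgebra K m lam} {r : K[X]} {i : Vertex}
    (h : a * (b * c) = r • e K m lam i) {x : TetrahedralAlgebra K m lam}
    (hx : e K m lam i * x = x) : a * (b * (c * x)) = r • x := by
  rw [← mul_assoc b, ← mul_assoc, h, smul_mul_assoc, hx]

/-- Up to commutativity relations the chosen path to the opposite vertex is `θ f(θ) g(f(θ))` for an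
arrow θ at `i`, so the zero relations say exactly this. In consequence `u` and `v` act trivially on
these paths. -/
theorem X_pow_smul_pathTo_opp (i : Vertex) :
    (X ^ (m - 1) : K[X]) • pathTo K m lam i i.opp = 0 := by
  have key (θ : TArrow) {y : TetrahedralAlgebra K m lam}
      (h : y = arrow K m lam θ * (arrow K m lam θ.f * arrow K m lam θ.f.g)) :
      (X ^ (m - 1) : K[X]) • y = 0 := by rw [h, X_pow_smul_opp]
  cases i
  · exact key .ν (mul_mul_of_mul_eq νμ _).symm
  · exact key .ρ rfl
  · exact key .α (congrArg (tα * ·) δη)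
  · exact key .γ rfl
  · exact key .η rfl
  · exact key .μ (mul_mul_of_mul_eq μα _).symm

/-- The exponent `n` such that `e i Λ e j` is isomorphic to `K[X] / X ^ n`. -/
def expo (m : ℕ) (i j : Vertex) : ℕ := if i = j then m + 1 else if j = i.opp then m - 1 else m

theorem X_pow_smul_e (hm : 2 ≤ m) (i : Vertex) : (X ^ (m + 1) : K[X]) • e K m lam i = 0 := by
  rw [pow_succ, mul_smul, X_smul_e]
  cases i <;>
  · simp only [loop, cyc]
    rw [← smul_mul_assoc, X_pow_smul_arrow hm, zero_mul]

set_option linter.unusedSimpArgs false in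
-- The relations, oriented towards the chosen paths, form a rewriting system; all 72 products reduce
-- to a multiple of the chosen path, the coefficient being a product of powers of `X` and `v`.
theorem pathTo_mul_arrow (hm : 2 ≤ m) (i : Vertex) (θ : TArrow) : ∃ g : K[X],
    pathTo K m lam i θ.source * arrow K m lam θ = g • pathTo K m lam i θ.target := by
  have o (i : Vertex) : vPoly m lam • pathTo K m lam i i.opp = pathTo K m lam i i.opp :=
    vPoly_smul_eq_self (X_pow_smul_pathTo_opp i)
  have o1 := o .v1
  have o2 := o .v2
  have o6 := o .v6
  simp only [pathTo, Vertex.opp] at o1 o2 o6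
  cases θ <;> cases i <;>
  simp only [pathTo, TArrow.source, TArrow.target, mul_assoc, e_α, e_β, e_γ, e_δ, e_ε, e_η, e_μ, e_ν, e_ξ, e_ρ, e_σ, e_ω,
    α_e, β_e, γ_e, δ_e, ε_e, η_e, μ_e, ν_e, ξ_e, ρ_e, σ_e, ω_e, mul_smul_comm, smul_mul_assoc, smul_smul,
    ← δη, νμ, εη hm, ← εξ, ← ηγ, ηβ hm, μα, ← ωβ, σε, ← αν, βε hm, βρ,
    mul_mul_of_mul_eq δη.symm, mul_mul_of_mul_eq νμ, mul_mul_of_mul_eq εξ.symm,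
    mul_mul_of_mul_eq ηγ.symm, mul_mul_of_mul_eq μα, mul_mul_of_mul_eq ωβ.symm,
    mul_mul_of_mul_eq σε, mul_mul_of_mul_eq αν.symm, mul_mul_of_mul_eq βρ,
    mul_mul_of_mul_eq_smul (εη hm), mul_mul_of_mul_eq_smul (ηβ hm), mul_mul_of_mul_eq_smul (βε hm),
    δηγ, εξσ, ρωβ, αδξ, γδη, ηγδ, ωγν, mul_mul_of_eq_smul_e δηγ, mul_mul_of_eq_smul_e εξσ,
    mul_mul_of_eq_smul_e ρωβ, mul_mul_of_eq_smul_e αδξ, mul_mul_of_eq_smul_e γδη,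
    mul_mul_of_eq_smul_e ηγδ, mul_mul_of_eq_smul_e ωγν, ρωγδ, γδξσ, ωγδξ, o1, o2, o6] <;>
  first
    | exact ⟨1, (one_smul _ _).symm⟩
    | exact ⟨_, rfl⟩

end TetrahedralAlgebra

end

section

open Polynomial

namespace TetrahedralAlgebra

variable {K : Type u} [Field K] {m : ℕ} {lam : K}

local notation "tα" => arrow K m lam TArrow.α
local notation "tβ" => arrow K m lam TArrow.β
local notation "tγ" => arrow K m lam TArrow.γ
local notation "tδ" => arrow K m lam TArrow.δ
local notation "tε" => arrow K m lam TArrow.ε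
local notation "tη" => arrow K m lam TArrow.η
local notation "tμ" => arrow K m lam TArrow.μ
local notation "tν" => arrow K m lam TArrow.ν
local notation "tξ" => arrow K m lam TArrow.ξ
local notation "tρ" => arrow K m lam TArrow.ρ
local notation "tσ" => arrow K m lam TArrow.σ
local notation "tω" => arrow K m lam TArrow.ω

theorem pathTo_self (i : Vertex) : pathTo K m lam i i = e K m lam i := by
  cases i <;> rfl

/-- The elements all of whose components `e i x e j` lie in the span of the chosen paths form a
subspace that contains `1` and is stable under right multiplication by trivial paths and arrows. -/
theorem exists_eq_smul_pathTo (hm : 2 ≤ m) (i j : Vertex) (x : TetrahedralAlgebra K m lam) :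
    ∃ f : K[X], e K m lam i * x * e K m lam j = f • pathTo K m lam i j := by
  let M (i j : Vertex) : Submodule K (TetrahedralAlgebra K m lam) :=
    ((Submodule.span K[X] {pathTo K m lam i j}).restrictScalars K).comap
      (LinearMap.mulLeftRight K (e K m lam i, e K m lam j))
  have hM (i j : Vertex) (x) : x ∈ M i j ↔
      ∃ f : K[X], e K m lam i * x * e K m lam j = f • pathTo K m lam i j := by
    simp only [M, Submodule.mem_comap, LinearMap.mulLeftRight_apply,
      Submodule.restrictScalars_mem, Submodule.mem_span_singleton, eq_comm]
  rw [← hM]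
  suffices h : x ∈ ⨅ i, ⨅ j, M i j by
    simp only [Submodule.mem_iInf] at h
    exact h i j
  refine mem_of_mul_mem _ ?_ ?_ ?_ x
  · simp only [Submodule.mem_iInf, hM]
    intro i j
    by_cases h : i = j
    · subst h
      exact ⟨1, by rw [mul_one, e_mul_e, pathTo_self, one_smul]⟩
    · exact ⟨0, by rw [mul_one, e_mul_e_of_ne K m lam h, zero_smul]⟩
  · simp only [Submodule.mem_iInf, hM]
    intro x hx k i j
    by_cases h : k = j
    · subst h
      obtain ⟨f, hf⟩ := hx i k
      exact ⟨f, by rw [← hf, mul_assoc, mul_assoc, e_mul_e, mul_assoc]⟩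
    · exact ⟨0, by rw [mul_assoc, mul_assoc, e_mul_e_of_ne K m lam h, mul_zero, mul_zero, zero_smul]⟩
  · simp only [Submodule.mem_iInf, hM]
    intro x hx θ i j
    by_cases h : θ.target = j
    · subst h
      obtain ⟨f, hf⟩ := hx i θ.source
      obtain ⟨g, hg⟩ := pathTo_mul_arrow (lam := lam) hm i θ
      refine ⟨f * g, ?_⟩
      rw [mul_smul, ← hg, ← smul_mul_assoc, ← hf]
      simp only [mul_assoc, arrow_mul_e, e_mul_arrow]
    · exact ⟨0, by rw [mul_assoc, mul_assoc, arrow_mul_e_of_ne h, mul_zero, mul_zero, zero_smul]⟩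

end TetrahedralAlgebra

end

section

open Polynomial

namespace TetrahedralAlgebra

variable {K : Type u} [Field K] {m : ℕ} {lam : K}

local notation "tα" => arrow K m lam TArrow.α
local notation "tβ" => arrow K m lam TArrow.β
local notation "tγ" => arrow K m lam TArrow.γ
local notation "tδ" => arrow K m lam TArrow.δ
local notation "tε" => arrow K m lam TArrow.ε
local notation "tη" => arrow K m lam TArrow.η
local notation "tμ" => arrow K m lam TArrow.μ
local notation "tν" => arrow K m lam TArrow.ν
local notation "tξ" => arrow K m lam TArrow.ξ
local notation "tρ" => arrow K m lam TArrow.ρ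
local notation "tσ" => arrow K m lam TArrow.σ
local notation "tω" => arrow K m lam TArrow.ω

/-! ### A representation of `Λ` on `⨁ i, K[X] / X ^ n i j` for each vertex `j` -/

section Rep

variable (K m) in
/-- The space underlying the left module `Λ e j`. -/
abbrev RepSpace (j : Vertex) : Type u :=
  ∀ i : Vertex, K[X] ⧸ (Ideal.span {(X ^ expo m i j : K[X])})

variable {j : Vertex}

/-- The map between the components at `t` and `s` given by multiplication by a polynomial. -/
noncomputable def compMap (s t : Vertex) (a : K[X])
    (h : (X ^ expo m s j : K[X]) ∣ a * X ^ expo m t j) : Module.End K[X] (RepSpace K m j) :=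
  LinearMap.single K[X] (fun i : Vertex => K[X] ⧸ (Ideal.span {(X ^ expo m i j : K[X])})) s ∘ₗ
    Submodule.mapQ (Ideal.span {(X ^ expo m t j : K[X])}) (Ideal.span {(X ^ expo m s j : K[X])})
      (LinearMap.mulLeft K[X] a) (by
        rw [Ideal.span, Submodule.span_le, Set.singleton_subset_iff]
        simpa [Ideal.mem_span_singleton] using h) ∘ₗ
    LinearMap.proj t

theorem compMap_single (s t : Vertex) (a b : K[X]) (h) :
    compMap (m := m) (j := j) s t a h (Pi.single t (Submodule.Quotient.mk b)) =
      Pi.single s (Submodule.Quotient.mk (a * b)) := by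
  simp only [compMap, LinearMap.comp_apply, LinearMap.proj_apply, Pi.single_eq_same]
  rfl

theorem compMap_single_of_ne (s : Vertex) {t k : Vertex} (a b : K[X]) (h) (hk : k ≠ t) :
    compMap (m := m) (j := j) s t a h (Pi.single k (Submodule.Quotient.mk b)) = 0 := by
  simp [compMap, Pi.single_eq_of_ne hk.symm]

theorem end_ext {φ ψ : Module.End K[X] (RepSpace K m j)}
    (h : ∀ k b, φ (Pi.single k (Submodule.Quotient.mk b)) =
      ψ (Pi.single k (Submodule.Quotient.mk b))) : φ = ψ := by
  refine LinearMap.pi_ext fun i x => ?_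
  obtain ⟨b, rfl⟩ := Submodule.Quotient.mk_surjective _ x
  exact h i b

theorem compMap_mul (s t k : Vertex) (a b : K[X]) (h h') :
    compMap (m := m) (j := j) s t a h * compMap t k b h' =
      compMap s k (a * b) (by
        rw [mul_assoc]
        exact h.trans (mul_dvd_mul_left a h')) := by
  refine end_ext fun l c => ?_
  rw [Module.End.mul_apply]
  by_cases hl : l = k
  · subst hl
    rw [compMap_single, compMap_single, compMap_single, mul_assoc]
  · rw [compMap_single_of_ne _ _ _ _ hl, compMap_single_of_ne _ _ _ _ hl, map_zero]

theorem compMap_mul_of_ne {s t t' k : Vertex} (a b : K[X]) (h h') (ht : t ≠ t') :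
    compMap (m := m) (j := j) s t a h * compMap t' k b h' = 0 := by
  refine end_ext fun l c => ?_
  rw [Module.End.mul_apply]
  by_cases hl : l = k
  · subst hl
    rw [compMap_single, compMap_single_of_ne _ _ _ _ ht.symm]; rfl
  · rw [compMap_single_of_ne _ _ _ _ hl, map_zero]; rfl

theorem compMap_congr {s t : Vertex} {a b : K[X]} (h h')
    (hab : (X ^ expo m s j : K[X]) ∣ a - b) :
    compMap (m := m) (j := j) s t a h = compMap s t b h' := by
  refine end_ext fun l c => ?_
  by_cases hl : l = t
  · subst hl
    rw [compMap_single, compMap_single]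
    congr 1
    rw [Submodule.Quotient.eq, Ideal.mem_span_singleton, ← sub_mul]
    exact hab.mul_right c
  · rw [compMap_single_of_ne _ _ _ _ hl, compMap_single_of_ne _ _ _ _ hl]

theorem compMap_eq_zero {s t : Vertex} {a : K[X]} (h) (ha : (X ^ expo m s j : K[X]) ∣ a) :
    compMap (m := m) (j := j) s t a h = 0 := by
  refine (compMap_congr h (b := 0) (by simp) (by simpa using ha)).trans (end_ext fun l c => ?_)
  by_cases hl : l = t
  · subst hl
    rw [compMap_single, zero_mul, Submodule.Quotient.mk_zero, Pi.single_zero]; rfl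
  · rw [compMap_single_of_ne _ _ _ _ hl]; rfl

theorem compMap_add_smul (c : K) (s t : Vertex) (a b : K[X]) (h h') :
    compMap (m := m) (j := j) s t a h + c • compMap s t b h' =
      compMap s t (a + C c * b) (by
        rw [add_mul, mul_assoc]; exact dvd_add h (h'.mul_left _)) := by
  refine end_ext fun l d => ?_
  rw [LinearMap.add_apply, ← algebraMap_smul K[X] c, LinearMap.smul_apply]
  by_cases hl : l = t
  · subst hl
    rw [compMap_single, compMap_single, compMap_single, ← Pi.single_smul, ← Pi.single_add]
    congr 1
    rw [← Submodule.Quotient.mk_smul, ← Submodule.Quotient.mk_add, smul_eq_mul, add_mul, mul_assoc]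
    rfl
  · rw [compMap_single_of_ne _ _ _ _ hl, compMap_single_of_ne _ _ _ _ hl,
      compMap_single_of_ne _ _ _ _ hl, smul_zero, add_zero]

theorem compMap_pow_mul (n : ℕ) (s t : Vertex) (a b : K[X]) (h h') :
    compMap (m := m) (j := j) s s a h ^ n * compMap s t b h' =
      compMap s t (a ^ n * b) (by
        induction n with
        | zero => simpa using h'
        | succ n ih =>
          rw [pow_succ', mul_assoc, mul_assoc, ← mul_assoc _ b]
          exact h.trans (mul_dvd_mul_left a ih)) := by
  induction n with
  | zero => simp
  | succ n ih =>
    rw [pow_succ', mul_assoc, ih, compMap_mul]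
    exact compMap_congr _ _ (by rw [pow_succ', mul_assoc, sub_self]; exact dvd_zero _)

theorem sum_compMap_one : ∑ i, compMap (K := K) (m := m) (j := j) i i 1 (by simp) = 1 := by
  refine end_ext fun l c => ?_
  rw [LinearMap.sum_apply, Finset.sum_eq_single l, compMap_single, one_mul]; · rfl
  · intro i _ hi
    rw [compMap_single_of_ne _ _ _ _ hi.symm]
  · simp

/-- The polynomial by which an arrow acts on the left module `Λ e j`. -/
noncomputable def coeff (m : ℕ) (lam : K) : Vertex → TArrow → K[X]
  -- The value `c` is read off from `θ * pathTo t j = c • pathTo s j`, where θ goes from `s` to `t`.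
  -- The three exceptions are `βε = vγδ`, `εη = vρω` and `ηβ = vξσ`.
  | .v5, .β => vPoly m lam
  | .v4, .ε => vPoly m lam
  | .v2, .η => vPoly m lam
  -- A factor `X` appears when the product closes a 3-cycle at `j`, and when θ is put in front of
  -- the path of length three from the vertex opposite to `j`.
  | j, θ => if θ.source = j ∨ θ.target = j.opp then X else 1

theorem coeff_dvd (hm : 2 ≤ m) (θ : TArrow) :
    (X ^ expo m θ.source j : K[X]) ∣ coeff m lam j θ * X ^ expo m θ.target j := by
  obtain ⟨k, rfl⟩ := Nat.exists_eq_add_of_le' hm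
  cases θ <;> cases j <;>
  simp [coeff, expo, TArrow.source, TArrow.target, Vertex.opp] <;>
  first
    | exact ⟨vPoly (k + 2) lam, by ring1⟩
    | exact ⟨1, by ring1⟩
    | exact ⟨X, by ring1⟩

variable (lam) in
/-- The action of an arrow on the left module `Λ e j`. -/
noncomputable def act (hm : 2 ≤ m) (j : Vertex) (θ : TArrow) : Module.End K[X] (RepSpace K m j) :=
  compMap θ.source θ.target (coeff m lam j θ) (coeff_dvd hm θ)

theorem compMap_mul_of_eq {s t t' k : Vertex} (a b : K[X]) (h h') (ht : t = t') :
    compMap (m := m) (j := j) s t a h * compMap t' k b h' =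
      compMap s k (a * b) (by
        subst ht
        rw [mul_assoc]
        exact h.trans (mul_dvd_mul_left a h')) := by
  subst ht
  exact compMap_mul ..

theorem coeff_mul_dvd (hm : 2 ≤ m) {θ θ' : TArrow} (h : θ.target = θ'.source) :
    (X ^ expo m θ.source j : K[X]) ∣
      coeff m lam j θ * coeff m lam j θ' * X ^ expo m θ'.target j := by
  rw [mul_assoc]
  exact (coeff_dvd hm θ).trans (mul_dvd_mul_left _ (h ▸ coeff_dvd hm θ'))

theorem act_mul_act (hm : 2 ≤ m) {θ θ' : TArrow} (h : θ.target = θ'.source) :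
    act lam hm j θ * act lam hm j θ' =
      compMap θ.source θ'.target (coeff m lam j θ * coeff m lam j θ') (coeff_mul_dvd hm h) :=
  compMap_mul_of_eq _ _ _ _ h

/-- A 3-cycle acts as `X`. When one coefficient is `v`, the product of the three is `X - λX^m`; then
`j` is not on the triangle, so the exponent is at most `m` and the second term vanishes. -/
theorem coeff_cyc (hm : 2 ≤ m) (θ : TArrow) : (X ^ expo m θ.source j : K[X]) ∣
    coeff m lam j θ * (coeff m lam j θ.f * coeff m lam j θ.f.f) - X := by
  obtain ⟨k, rfl⟩ := Nat.exists_eq_add_of_le' hm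
  cases θ <;> cases j <;>
  simp [coeff, expo, vPoly, TArrow.source, TArrow.target, TArrow.f, Vertex.opp] <;>
  first
    | exact ⟨0, by ring1⟩
    | exact ⟨C lam, by ring1⟩
    | exact ⟨-C lam, by ring1⟩
    | exact ⟨C lam * X, by ring1⟩
    | exact ⟨-C lam * X, by ring1⟩

theorem coeff_zero (hm : 2 ≤ m) (θ : TArrow) : (X ^ expo m θ.source j : K[X]) ∣
    X ^ (m - 1) * (coeff m lam j θ * (coeff m lam j θ.f * coeff m lam j θ.f.g)) := by
  obtain ⟨k, rfl⟩ := Nat.exists_eq_add_of_le' hm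
  cases θ <;> cases j <;>
  simp [coeff, expo, TArrow.source, TArrow.target, TArrow.f, TArrow.g, Vertex.opp] <;>
  first
    | exact ⟨1, by ring1⟩
    | exact ⟨X, by ring1⟩
    | exact ⟨X ^ 2, by ring1⟩
    | exact ⟨vPoly (k + 2) lam, by ring1⟩

variable (K) in
/-- The action of the idempotent at the vertex `i` on the left module `Λ e j`. -/
noncomputable def actE (m : ℕ) (j i : Vertex) : Module.End K[X] (RepSpace K m j) :=
  compMap i i 1 (by simp)

theorem actE_mul_actE (i : Vertex) : actE K m j i * actE K m j i = actE K m j i := by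
  rw [actE, compMap_mul]
  exact compMap_congr _ _ (by simp)

theorem actE_mul_actE_of_ne (i k : Vertex) (h : i ≠ k) : actE K m j i * actE K m j k = 0 :=
  compMap_mul_of_ne _ _ _ _ h

theorem actE_mul_act (hm : 2 ≤ m) (θ : TArrow) :
    actE K m j θ.source * act lam hm j θ = act lam hm j θ := by
  rw [actE, act, compMap_mul]
  exact compMap_congr _ _ (by simp)

theorem act_mul_actE (hm : 2 ≤ m) (θ : TArrow) :
    act lam hm j θ * actE K m j θ.target = act lam hm j θ := by
  rw [actE, act, compMap_mul]
  exact compMap_congr _ _ (by simp)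

variable (lam) in
/-- The representation of the path algebra on the space of the left module `Λ e j`. -/
noncomputable def repPath (hm : 2 ≤ m) (j : Vertex) :
    PathAlgebra K TArrow.source TArrow.target →ₐ[K] Module.End K[X] (RepSpace K m j) :=
  PathAlgebra.lift (actE K m j) (act lam hm j) (PathAlgebra.lift_respects (K := K)
    (s := TArrow.source) (t := TArrow.target) (B := Module.End K[X] (RepSpace K m j)) _ _
    actE_mul_actE actE_mul_actE_of_ne sum_compMap_one (actE_mul_act hm) (act_mul_actE hm))

theorem repPath_arrow (hm : 2 ≤ m) (θ : TArrow) :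
    repPath lam hm j (PathAlgebra.arrow K _ _ θ) = act lam hm j θ :=
  PathAlgebra.lift_arrow _ _ _ _

theorem repPath_tPath (hm : 2 ≤ m) (l : List TArrow) :
    repPath lam hm j (tPath K l) = (l.map (act lam hm j)).prod := by
  rw [tPath, PathAlgebra.path, map_list_prod, List.map_map]
  exact congrArg _ (List.map_congr_left fun a _ => repPath_arrow hm a)

theorem act_cyc (hm : 2 ≤ m) (θ : TArrow) :
    act lam hm j θ * (act lam hm j θ.f * act lam hm j θ.f.f) =
      compMap θ.source θ.source X ((pow_dvd_pow _ le_rfl).mul_left _) := by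
  have hs : θ.target = θ.f.source := by cases θ <;> rfl
  have hs' : θ.f.target = θ.f.f.source := by cases θ <;> rfl
  have hs'' : θ.source = θ.f.f.target := by cases θ <;> rfl
  rw [act_mul_act hm hs', act, compMap_mul_of_eq _ _ _ _ hs]
  have key : ∀ (t : Vertex) (ht : θ.source = t) (h), compMap (m := m) (j := j) θ.source t
      (coeff m lam j θ * (coeff m lam j θ.f * coeff m lam j θ.f.f)) h =
      compMap θ.source θ.source X ((pow_dvd_pow _ le_rfl).mul_left _) := by
    rintro t rfl h
    exact compMap_congr _ _ (coeff_cyc hm θ)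
  exact key _ hs'' _

theorem act_comm (hm : 2 ≤ m) {θ₁ θ₂ θ₃ θ₄ : TArrow} (h : θ₁.target = θ₂.source)
    (h' : θ₃.target = θ₄.source) (hs : θ₁.source = θ₃.source) (ht : θ₂.target = θ₄.target)
    (hc : (X ^ expo m θ₁.source j : K[X]) ∣
      coeff m lam j θ₁ * coeff m lam j θ₂ - coeff m lam j θ₃ * coeff m lam j θ₄) :
    act lam hm j θ₁ * act lam hm j θ₂ = act lam hm j θ₃ * act lam hm j θ₄ := by
  rw [act_mul_act hm h, act_mul_act hm h']
  have key : ∀ (s t : Vertex) (hs : θ₁.source = s) (ht : θ₂.target = t) (h h'),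
      compMap (m := m) (j := j) θ₁.source θ₂.target (coeff m lam j θ₁ * coeff m lam j θ₂) h =
        compMap s t (coeff m lam j θ₃ * coeff m lam j θ₄) h' := by
    rintro s t rfl rfl h h'
    exact compMap_congr _ _ hc
  exact key _ _ hs ht _ _

theorem act_comm_smul (hm : 2 ≤ m) {θ₁ θ₂ θ₃ θ₄ θ : TArrow} (h : θ₁.target = θ₂.source)
    (h' : θ₃.target = θ₄.source) (hs : θ₁.source = θ₃.source) (ht : θ₂.target = θ₄.target)
    (hθ : θ.source = θ₃.source)
    (hc : (X ^ expo m θ₁.source j : K[X]) ∣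
      coeff m lam j θ₁ * coeff m lam j θ₂ -
        uPoly m lam * (coeff m lam j θ₃ * coeff m lam j θ₄)) :
    act lam hm j θ₁ * act lam hm j θ₂ = act lam hm j θ₃ * act lam hm j θ₄ + lam •
      ((act lam hm j θ * (act lam hm j θ.f * act lam hm j θ.f.f)) ^ (m - 1) *
        (act lam hm j θ₃ * act lam hm j θ₄)) := by
  rw [act_mul_act hm h, act_mul_act hm h', act_cyc]
  have key : ∀ (s r t : Vertex) (hs : θ₁.source = s) (hr : r = s) (ht : θ₂.target = t) (h h' h''),
      compMap (m := m) (j := j) θ₁.source θ₂.target (coeff m lam j θ₁ * coeff m lam j θ₂) h =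
        compMap s t (coeff m lam j θ₃ * coeff m lam j θ₄) h' + lam • (compMap r r X h'' ^ (m - 1) *
          compMap s t (coeff m lam j θ₃ * coeff m lam j θ₄) h') := by
    rintro s r t rfl rfl rfl h h' h''
    rw [compMap_pow_mul, compMap_add_smul]
    refine compMap_congr _ _ ?_
    convert hc using 2
    rw [uPoly]
    ring
  exact key _ _ _ hs hθ ht _ _ _

theorem coeff_comm (hm : 2 ≤ m) :
    ∀ q ∈ ([(.δ, .η, .ν, .ω), (.η, .γ, .ξ, .α), (.ν, .μ, .δ, .ξ), (.ω, .β, .μ, .σ),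
      (.β, .ρ, .γ, .ν), (.μ, .α, .ω, .γ), (.σ, .ε, .α, .δ), (.ε, .ξ, .ρ, .μ),
      (.α, .ν, .σ, .ρ)] : List (TArrow × TArrow × TArrow × TArrow)),
    (X ^ expo m q.1.source j : K[X]) ∣ coeff m lam j q.1 * coeff m lam j q.2.1 -
      coeff m lam j q.2.2.1 * coeff m lam j q.2.2.2 := by
  obtain ⟨k, rfl⟩ := Nat.exists_eq_add_of_le' hm
  simp only [List.forall_mem_cons, List.not_mem_nil, IsEmpty.forall_iff, implies_true, and_true]
  refine ⟨?_, ?_, ?_, ?_, ?_, ?_, ?_, ?_, ?_⟩ <;> cases j <;>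
  simp [coeff, expo, vPoly, TArrow.source, TArrow.target, Vertex.opp] <;>
  first
    | exact ⟨C lam, by ring1⟩
    | exact ⟨-C lam, by ring1⟩

theorem coeff_comm_smul (hm : 2 ≤ m) :
    ∀ q ∈ ([(.γ, .δ, .β, .ε), (.ρ, .ω, .ε, .η), (.ξ, .σ, .η, .β)] :
      List (TArrow × TArrow × TArrow × TArrow)),
    (X ^ expo m q.1.source j : K[X]) ∣ coeff m lam j q.1 * coeff m lam j q.2.1 -
      uPoly m lam * (coeff m lam j q.2.2.1 * coeff m lam j q.2.2.2) := by
  obtain ⟨k, rfl⟩ := Nat.exists_eq_add_of_le' hm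
  simp only [List.forall_mem_cons, List.not_mem_nil, IsEmpty.forall_iff, implies_true, and_true]
  refine ⟨?_, ?_, ?_⟩ <;> cases j <;>
  simp [coeff, expo, vPoly, uPoly, TArrow.source, TArrow.target, Vertex.opp] <;>
  first
    | exact ⟨0, by ring1⟩
    | exact ⟨C lam, by ring1⟩
    | exact ⟨-C lam, by ring1⟩
    | exact ⟨C lam * X, by ring1⟩
    | exact ⟨-C lam * X, by ring1⟩
    -- This covers `1 - uv = λ²X^(2m-2)`, with `2m - 2 = m + k` as `m = k + 2`.
    | exact ⟨C lam ^ 2 * X ^ k, by ring1⟩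

theorem repPath_rel (hm : 2 ≤ m) {a b : PathAlgebra K TArrow.source TArrow.target}
    (h : TetrahedralRel K m lam a b) : repPath lam hm j a = repPath lam hm j b := by
  cases h <;>
  simp only [map_add, map_mul, map_pow, map_smul, map_zero, repPath_tPath, List.map_cons,
    List.map_nil, List.prod_cons, List.prod_nil, mul_one]
  case r1 => exact act_comm_smul hm rfl rfl rfl rfl rfl (coeff_comm_smul hm (.γ, .δ, .β, .ε) (by simp))
  case r2 => exact act_comm hm rfl rfl rfl rfl (coeff_comm hm (.δ, .η, .ν, .ω) (by simp))
  case r3 => exact act_comm hm rfl rfl rfl rfl (coeff_comm hm (.η, .γ, .ξ, .α) (by simp))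
  case r4 => exact act_comm hm rfl rfl rfl rfl (coeff_comm hm (.ν, .μ, .δ, .ξ) (by simp))
  case r5 => exact act_comm_smul hm rfl rfl rfl rfl rfl (coeff_comm_smul hm (.ρ, .ω, .ε, .η) (by simp))
  case r6 => exact act_comm hm rfl rfl rfl rfl (coeff_comm hm (.ω, .β, .μ, .σ) (by simp))
  case r7 => exact act_comm hm rfl rfl rfl rfl (coeff_comm hm (.β, .ρ, .γ, .ν) (by simp))
  case r8 => exact act_comm hm rfl rfl rfl rfl (coeff_comm hm (.μ, .α, .ω, .γ) (by simp))
  case r9 => exact act_comm_smul hm rfl rfl rfl rfl rfl (coeff_comm_smul hm (.ξ, .σ, .η, .β) (by simp))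
  case r10 => exact act_comm hm rfl rfl rfl rfl (coeff_comm hm (.σ, .ε, .α, .δ) (by simp))
  case r11 => exact act_comm hm rfl rfl rfl rfl (coeff_comm hm (.ε, .ξ, .ρ, .μ) (by simp))
  case r12 => exact act_comm hm rfl rfl rfl rfl (coeff_comm hm (.α, .ν, .σ, .ρ) (by simp))
  case zero θ =>
    have hs : θ.target = θ.f.source := by cases θ <;> rfl
    have hs' : θ.f.target = θ.f.g.source := by cases θ <;> rfl
    rw [act_cyc, act_mul_act hm hs', act, compMap_mul_of_eq _ _ _ _ hs, compMap_pow_mul]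
    exact compMap_eq_zero _ (coeff_zero hm θ)

/-- In the representation modelled on `Λ e j` this element sends the class of `1` in the component
`K[X]/X^(m+1)` at `j` to the class of `X^m`. -/
theorem X_pow_smul_e_ne_zero (hm : 2 ≤ m) (j : Vertex) : (X ^ m : K[X]) • e K m lam j ≠ 0 := by
  intro h0
  let φ : TetrahedralAlgebra K m lam →ₐ[K] Module.End K[X] (RepSpace K m j) :=
    RingQuot.liftAlgHom K ⟨repPath lam hm j, fun _ _ h => repPath_rel hm h⟩
  have hφ (x) : φ (mk K m lam x) = repPath lam hm j x := RingQuot.liftAlgHom_mkAlgHom_apply K _ _ _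
  obtain ⟨θ, rfl⟩ : ∃ θ : TArrow, θ.source = j := by
    cases j
    exacts [⟨.δ, rfl⟩, ⟨.ε, rfl⟩, ⟨.α, rfl⟩, ⟨.γ, rfl⟩, ⟨.η, rfl⟩, ⟨.μ, rfl⟩]
  rw [← cyc_pow_mul (e_mul_e K m lam _)] at h0
  have h1 := congrArg φ h0
  have h2 : φ (cyc K m lam θ) = compMap θ.source θ.source X ((pow_dvd_pow _ le_rfl).mul_left _) := by
    rw [← act_cyc (lam := lam) hm, cyc, map_mul, map_mul]
    simp only [arrow, hφ, repPath_arrow]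
  have h3 : φ (e K m lam θ.source) = compMap θ.source θ.source 1 (by simp) :=
    (hφ _).trans (PathAlgebra.lift_e ..)
  rw [map_zero, map_mul, map_pow, h2, h3, compMap_pow_mul] at h1
  have h4 := congrFun (LinearMap.congr_fun h1 (Pi.single θ.source (Submodule.Quotient.mk 1))) θ.source
  rw [compMap_single, Pi.single_eq_same] at h4
  rw [LinearMap.zero_apply, Pi.zero_apply, Submodule.Quotient.mk_eq_zero, Ideal.mem_span_singleton,
    mul_one, mul_one, expo, if_pos rfl, pow_dvd_pow_iff X_ne_zero not_isUnit_X] at h4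
  omega

end Rep

end TetrahedralAlgebra

end

/-! ### The spherical algebra as a `K[X]`-algebra -/

section

open Polynomial

namespace SphericalAlgebra

variable (K : Type u) [Field K] (m : ℕ) (lam : K)

/-- The quotient map `KΔ → S(m, λ)`. -/
noncomputable def mk :
    PathAlgebra K SArrow.source SArrow.target →ₐ[K] SphericalAlgebra K m lam :=
  RingQuot.mkAlgHom K (SphericalRel K m lam)

/-- The idempotent of `S(m, λ)` at the vertex `i`. -/
noncomputable def e (i : Vertex) : SphericalAlgebra K m lam :=
  mk K m lam (PathAlgebra.e K SArrow.source SArrow.target i)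

/-- An arrow as an element of `S(m, λ)`. -/
noncomputable def arrow (a : SArrow) : SphericalAlgebra K m lam :=
  mk K m lam (PathAlgebra.arrow K SArrow.source SArrow.target a)

local notation "sα" => arrow K m lam SArrow.α
local notation "sβ" => arrow K m lam SArrow.β
local notation "sγ" => arrow K m lam SArrow.γ
local notation "sδ" => arrow K m lam SArrow.δ
local notation "sν" => arrow K m lam SArrow.ν
local notation "sρ" => arrow K m lam SArrow.ρ
local notation "sσ" => arrow K m lam SArrow.σ
local notation "sω" => arrow K m lam SArrow.ω

theorem e_mul_e (i : Vertex) : e K m lam i * e K m lam i = e K m lam i := by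
  rw [e, ← map_mul, PathAlgebra.e_mul_e]

theorem e_mul_arrow (a : SArrow) : e K m lam a.source * arrow K m lam a = arrow K m lam a := by
  rw [e, arrow, ← map_mul, PathAlgebra.e_mul_arrow]

theorem arrow_mul_e (a : SArrow) : arrow K m lam a * e K m lam a.target = arrow K m lam a := by
  rw [e, arrow, ← map_mul, PathAlgebra.arrow_mul_e]

theorem mk_surjective : Function.Surjective (mk K m lam) :=
  RingQuot.mkAlgHom_surjective K _

theorem mk_rel {a b : PathAlgebra K SArrow.source SArrow.target}
    (h : SphericalRel K m lam a b) : mk K m lam a = mk K m lam b :=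
  RingQuot.mkAlgHom_rel K h

theorem mk_sPath (l : List SArrow) : mk K m lam (sPath K l) = (l.map (arrow K m lam)).prod := by
  rw [sPath, PathAlgebra.path, map_list_prod, List.map_map]; rfl

theorem e_mul_e_of_ne {i j : Vertex} (h : i ≠ j) : e K m lam i * e K m lam j = 0 := by
  rw [e, e, ← map_mul, PathAlgebra.e_mul_e_of_ne h, map_zero]

theorem sum_e : ∑ i, e K m lam i = 1 := by
  simp only [e, ← map_sum, PathAlgebra.sum_e, map_one]

variable {K m lam}

theorem e_α : e K m lam .v1 * sα = sα := e_mul_arrow K m lam .α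
theorem α_e : sα * e K m lam .v2 = sα := arrow_mul_e K m lam .α
theorem e_β : e K m lam .v2 * sβ = sβ := e_mul_arrow K m lam .β
theorem β_e : sβ * e K m lam .v3 = sβ := arrow_mul_e K m lam .β
theorem e_γ : e K m lam .v3 * sγ = sγ := e_mul_arrow K m lam .γ
theorem γ_e : sγ * e K m lam .v4 = sγ := arrow_mul_e K m lam .γ
theorem e_δ : e K m lam .v5 * sδ = sδ := e_mul_arrow K m lam .δ
theorem δ_e : sδ * e K m lam .v1 = sδ := arrow_mul_e K m lam .δ
theorem e_ν : e K m lam .v3 * sν = sν := e_mul_arrow K m lam .ν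
theorem ν_e : sν * e K m lam .v5 = sν := arrow_mul_e K m lam .ν
theorem e_ρ : e K m lam .v1 * sρ = sρ := e_mul_arrow K m lam .ρ
theorem ρ_e : sρ * e K m lam .v6 = sρ := arrow_mul_e K m lam .ρ
theorem e_σ : e K m lam .v4 * sσ = sσ := e_mul_arrow K m lam .σ
theorem σ_e : sσ * e K m lam .v1 = sσ := arrow_mul_e K m lam .σ
theorem e_ω : e K m lam .v6 * sω = sω := e_mul_arrow K m lam .ω
theorem ω_e : sω * e K m lam .v3 = sω := arrow_mul_e K m lam .ω

theorem αβν : sα * (sβ * sν) = sρ * (sω * sν) := by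
  simpa [mk_sPath] using mk_rel K m lam .r2

theorem δαβ : sδ * (sα * sβ) = sδ * (sρ * sω) := by
  simpa [mk_sPath] using mk_rel K m lam .r4

theorem ωγσ : sω * (sγ * sσ) = sω * (sν * sδ) := by
  simpa [mk_sPath] using mk_rel K m lam .r6

theorem γσρ : sγ * (sσ * sρ) = sν * (sδ * sρ) := by
  simpa [mk_sPath] using mk_rel K m lam .r8

theorem βνδ_aux : sβ * (sν * sδ) =
    sβ * (sγ * sσ) + lam • ((sβ * (sγ * (sσ * sα))) ^ (m - 1) * (sβ * (sγ * sσ))) := by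
  simpa [mk_sPath] using mk_rel K m lam .r1

theorem νδα_aux : sν * (sδ * sα) =
    sγ * (sσ * sα) + lam • ((sγ * (sσ * (sα * sβ))) ^ (m - 1) * (sγ * (sσ * sα))) := by
  simpa [mk_sPath] using mk_rel K m lam .r3

theorem σρω_aux : sσ * (sρ * sω) =
    sσ * (sα * sβ) + lam • ((sσ * (sα * (sβ * sγ))) ^ (m - 1) * (sσ * (sα * sβ))) := by
  simpa [mk_sPath] using mk_rel K m lam .r5

theorem ρωγ_aux : sρ * (sω * sγ) =
    sα * (sβ * sγ) + lam • ((sα * (sβ * (sγ * sσ))) ^ (m - 1) * (sα * (sβ * sγ))) := by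
  simpa [mk_sPath] using mk_rel K m lam .r7

theorem α_aux : (sα * (sβ * (sγ * sσ))) ^ m * sα = 0 := by
  simpa [mk_sPath] using mk_rel K m lam .r9

theorem γ_aux : (sγ * (sσ * (sα * sβ))) ^ m * sγ = 0 := by
  simpa [mk_sPath] using mk_rel K m lam .r10

theorem mul_mul_mul_of_eq {A : Type*} [Semigroup A] {a b c d e f : A}
    (h : a * (b * c) = d * (e * f)) (x : A) : a * (b * (c * x)) = d * (e * (f * x)) := by
  rw [← mul_assoc b, ← mul_assoc, h, mul_assoc, mul_assoc]

variable (K m lam) in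
/-- The cycle of length four at a vertex. -/
noncomputable def loop : Vertex → SphericalAlgebra K m lam
  | .v1 => sα * (sβ * (sν * sδ))
  | .v2 => sβ * (sν * (sδ * sα))
  | .v3 => sν * (sδ * (sα * sβ))
  | .v4 => sσ * (sρ * (sω * sγ))
  | .v5 => sδ * (sα * (sβ * sν))
  | .v6 => sω * (sν * (sδ * sρ))

theorem ρωνδ : sρ * (sω * (sν * sδ)) = loop K m lam .v1 := (mul_mul_mul_of_eq αβν _).symm
theorem ρωγσ : sρ * (sω * (sγ * sσ)) = loop K m lam .v1 := by rw [ωγσ, ρωνδ]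
theorem νδρω : sν * (sδ * (sρ * sω)) = loop K m lam .v3 := by rw [← δαβ]; rfl
theorem γσρω : sγ * (sσ * (sρ * sω)) = loop K m lam .v3 := (mul_mul_mul_of_eq γσρ _).trans νδρω

theorem e_mul_loop (i : Vertex) : e K m lam i * loop K m lam i = loop K m lam i := by
  cases i <;> simp only [loop, ← mul_assoc, e_α, e_β, e_ν, e_σ, e_δ, e_ω]

theorem loop_mul_e (i : Vertex) : loop K m lam i * e K m lam i = loop K m lam i := by
  cases i <;> simp only [loop, mul_assoc, δ_e, α_e, β_e, γ_e, ν_e, ρ_e]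

/-- The cycles in `loop` are chosen so that only the relations without λ are needed: `αβν = ρων`,
`δαβ = δρω`, `ωγσ = ωνδ` and `γσρ = νδρ`. The cycles `αβγσ` of the defining relations differ from
them by the λ-terms. -/
theorem loop_mul_arrow (a : SArrow) : loop K m lam a.source * arrow K m lam a =
    arrow K m lam a * loop K m lam a.target := by
  cases a <;> simp only [SArrow.source, SArrow.target]
  case γ => rw [← γσρω]; simp only [loop, mul_assoc]
  case σ => rw [← ρωγσ]; simp only [loop, mul_assoc]
  case ρ => rw [← ρωνδ]; simp only [loop, mul_assoc]
  case ω => rw [← νδρω]; simp only [loop, mul_assoc]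
  all_goals simp only [loop, mul_assoc]

variable (K m lam) in
/-- The sum of the cycles of length four. -/
noncomputable def loopSum : SphericalAlgebra K m lam := ∑ i, loop K m lam i

theorem loopSum_mul {i : Vertex} {x : SphericalAlgebra K m lam} (h : e K m lam i * x = x) :
    loopSum K m lam * x = loop K m lam i * x := by
  rw [loopSum, Finset.sum_mul, Finset.sum_eq_single i _ (by simp)]
  intro j _ hj
  rw [← h, ← loop_mul_e, mul_assoc, ← mul_assoc (e K m lam j), e_mul_e_of_ne K m lam hj, zero_mul,
    mul_zero]

theorem mul_loopSum {i : Vertex} {x : SphericalAlgebra K m lam} (h : x * e K m lam i = x) :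
    x * loopSum K m lam = x * loop K m lam i := by
  rw [loopSum, Finset.mul_sum, Finset.sum_eq_single i _ (by simp)]
  intro j _ hj
  rw [← h, ← e_mul_loop, mul_assoc, ← mul_assoc (e K m lam i), e_mul_e_of_ne K m lam hj.symm,
    zero_mul, mul_zero]

theorem mem_of_mul_mem (M : Submodule K (SphericalAlgebra K m lam)) (h1 : 1 ∈ M)
    (he : ∀ x ∈ M, ∀ i, x * e K m lam i ∈ M)
    (ha : ∀ x ∈ M, ∀ a, x * arrow K m lam a ∈ M) (x : SphericalAlgebra K m lam) : x ∈ M :=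
  PathAlgebra.mem_of_mul_mem (mk K m lam) (mk_surjective K m lam) M h1 he ha x

theorem loopSum_comm (x : SphericalAlgebra K m lam) :
    loopSum K m lam * x = x * loopSum K m lam := by
  refine mem_of_mul_mem (LinearMap.eqLocus (LinearMap.mulLeft K (loopSum K m lam))
    (LinearMap.mulRight K (loopSum K m lam))) ?_ ?_ ?_ x
  · simp
  · intro x hx i
    simp only [LinearMap.mem_eqLocus, LinearMap.mulLeft_apply, LinearMap.mulRight_apply] at hx ⊢
    rw [← mul_assoc, hx, mul_assoc, mul_assoc, loopSum_mul (e_mul_e K m lam i),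
      mul_loopSum (e_mul_e K m lam i), loop_mul_e, e_mul_loop]
  · intro x hx a
    simp only [LinearMap.mem_eqLocus, LinearMap.mulLeft_apply, LinearMap.mulRight_apply] at hx ⊢
    rw [← mul_assoc, hx, mul_assoc, mul_assoc, loopSum_mul (e_mul_arrow K m lam a),
      mul_loopSum (arrow_mul_e K m lam a), loop_mul_arrow]

/-- The higher spherical algebra is an algebra over `K[X]`, with `X` acting as the sum of the
cycles of length four. -/
noncomputable instance : Algebra K[X] (SphericalAlgebra K m lam) :=
  (aeval (loopSum K m lam)).toRingHom.toAlgebra' fun p x => by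
    induction p using Polynomial.induction_on' with
    | add p q hp hq => simp only [map_add, add_mul, mul_add, hp, hq]
    | monomial n a =>
      have h : Commute (loopSum K m lam ^ n) x := Commute.pow_left (loopSum_comm x) n
      simp [aeval_monomial, ← Algebra.smul_def, h.eq]

theorem algebraMap_eq_aeval (p : K[X]) :
    algebraMap K[X] (SphericalAlgebra K m lam) p = aeval (loopSum K m lam) p := rfl

instance : IsScalarTower K K[X] (SphericalAlgebra K m lam) :=
  IsScalarTower.of_algebraMap_eq fun a => by
    rw [algebraMap_eq_aeval, Polynomial.algebraMap_apply, aeval_C]; rfl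

theorem X_smul {i : Vertex} {x : SphericalAlgebra K m lam} (h : e K m lam i * x = x) :
    (X : K[X]) • x = loop K m lam i * x := by
  rw [Algebra.smul_def, algebraMap_eq_aeval, aeval_X, loopSum_mul h]

theorem X_pow_smul {i : Vertex} {x : SphericalAlgebra K m lam} (h : e K m lam i * x = x) (n : ℕ) :
    (X ^ n : K[X]) • x = loop K m lam i ^ n * x := by
  induction n with
  | zero => simp
  | succ n ih =>
    rw [pow_succ', mul_smul, ih, pow_succ', mul_assoc, ← ih, X_smul (i := i)]
    rw [mul_smul_comm, h]

theorem X_smul_e (i : Vertex) : (X : K[X]) • e K m lam i = loop K m lam i := by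
  rw [X_smul (e_mul_e K m lam i), loop_mul_e]

/-- The difference `l - z = λz^m` kills `y` and every `z^n y`. It is applied with `z` a rotation of
`αβγσ` and `l` the cycle by which `X` acts, so that powers of `z` in the relations may be replaced
by powers of `X`. -/
theorem pow_mul_eq_of_eq_add {A : Type*} [Ring A] [Algebra K A] {z l y : A}
    (hm : 1 ≤ m) (h : l = z + lam • (z ^ (m - 1) * z)) (hy : z ^ m * y = 0) (n : ℕ) :
    l ^ n * y = z ^ n * y := by
  rw [← pow_succ, Nat.sub_add_cancel hm] at h
  induction n with
  | zero => simp
  | succ n ih =>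
    have h0 : z ^ m * (z ^ n * y) = 0 := by
      rw [← mul_assoc, ← pow_add, add_comm, pow_add, mul_assoc, hy, mul_zero]
    rw [pow_succ', mul_assoc, ih, h, add_mul, smul_mul_assoc, h0, smul_zero, add_zero, ← mul_assoc,
      ← pow_succ']

open TetrahedralAlgebra (uPoly vPoly vPoly_smul_uPoly_smul)

theorem eq_uPoly_smul {i : Vertex} {z y x : SphericalAlgebra K m lam} (hm : 2 ≤ m)
    (h : loop K m lam i = z + lam • (z ^ (m - 1) * z)) (hy : z ^ m * y = 0)
    (he : e K m lam i * y = y) (hx : x = y + lam • (z ^ (m - 1) * y)) :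
    x = uPoly m lam • y := by
  rw [hx, ← pow_mul_eq_of_eq_add (by omega) h hy, ← X_pow_smul he, uPoly, add_smul, one_smul,
    mul_smul, ← algebraMap_eq, algebraMap_smul]

/-- Rotates a cycle to another vertex; this carries the two zero relations, imposed only for α and
γ, to the next vertex of the cycle. -/
theorem mul_pow_mul {A : Type*} [Monoid A] (a b c : A) (n : ℕ) :
    a * (b * a) ^ n * c = (a * b) ^ n * (a * c) := by
  induction n with
  | zero => simp
  | succ n ih =>
    rw [pow_succ', pow_succ', mul_assoc (a * b), ← ih]
    simp only [mul_assoc]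

theorem loop_v1_eq : loop K m lam .v1 = sα * (sβ * (sγ * sσ)) +
    lam • ((sα * (sβ * (sγ * sσ))) ^ (m - 1) * (sα * (sβ * (sγ * sσ)))) := by
  have h := congrArg (· * sσ) (ρωγ_aux (K := K) (m := m) (lam := lam))
  simpa only [add_mul, smul_mul_assoc, mul_assoc, ρωγσ] using h

theorem loop_v2_eq : loop K m lam .v2 = sβ * (sγ * (sσ * sα)) +
    lam • ((sβ * (sγ * (sσ * sα))) ^ (m - 1) * (sβ * (sγ * (sσ * sα)))) := by
  have h := congrArg (· * sα) (βνδ_aux (K := K) (m := m) (lam := lam))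
  simpa only [loop, add_mul, smul_mul_assoc, mul_assoc] using h

theorem loop_v3_eq : loop K m lam .v3 = sγ * (sσ * (sα * sβ)) +
    lam • ((sγ * (sσ * (sα * sβ))) ^ (m - 1) * (sγ * (sσ * (sα * sβ)))) := by
  have h := congrArg (· * sβ) (νδα_aux (K := K) (m := m) (lam := lam))
  simpa only [loop, add_mul, smul_mul_assoc, mul_assoc] using h

theorem loop_v4_eq : loop K m lam .v4 = sσ * (sα * (sβ * sγ)) +
    lam • ((sσ * (sα * (sβ * sγ))) ^ (m - 1) * (sσ * (sα * (sβ * sγ)))) := by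
  have h := congrArg (· * sγ) (σρω_aux (K := K) (m := m) (lam := lam))
  simpa only [loop, add_mul, smul_mul_assoc, mul_assoc] using h

theorem βνδ (hm : 2 ≤ m) : sβ * (sν * sδ) = uPoly m lam • (sβ * (sγ * sσ)) := by
  refine eq_uPoly_smul (i := .v2) hm loop_v2_eq ?_ (by rw [← mul_assoc, e_β]) βνδ_aux
  have h := mul_pow_mul sβ (sγ * (sσ * sα)) (sγ * sσ) m
  simp only [mul_assoc] at h
  rw [← h, ← mul_assoc (_ ^ m), γ_aux, zero_mul, mul_zero]

theorem νδα (hm : 2 ≤ m) : sν * (sδ * sα) = uPoly m lam • (sγ * (sσ * sα)) := by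
  refine eq_uPoly_smul (i := .v3) hm loop_v3_eq ?_ (by rw [← mul_assoc, e_γ]) νδα_aux
  rw [← mul_assoc (_ ^ m), γ_aux, zero_mul]

theorem σρω (hm : 2 ≤ m) : sσ * (sρ * sω) = uPoly m lam • (sσ * (sα * sβ)) := by
  refine eq_uPoly_smul (i := .v4) hm loop_v4_eq ?_ (by rw [← mul_assoc, e_σ]) σρω_aux
  have h := mul_pow_mul sσ (sα * (sβ * sγ)) (sα * sβ) m
  simp only [mul_assoc] at h
  rw [← h, ← mul_assoc (_ ^ m), α_aux, zero_mul, mul_zero]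

theorem ρωγ (hm : 2 ≤ m) : sρ * (sω * sγ) = uPoly m lam • (sα * (sβ * sγ)) := by
  refine eq_uPoly_smul (i := .v1) hm loop_v1_eq ?_ (by rw [← mul_assoc, e_α]) ρωγ_aux
  rw [← mul_assoc (_ ^ m), α_aux, zero_mul]

theorem X_pow_smul_α (hm : 2 ≤ m) : (X ^ m : K[X]) • sα = 0 := by
  rw [X_pow_smul e_α, pow_mul_eq_of_eq_add (by omega) loop_v1_eq α_aux, α_aux]

theorem X_pow_smul_γ (hm : 2 ≤ m) : (X ^ m : K[X]) • sγ = 0 := by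
  rw [X_pow_smul e_γ, pow_mul_eq_of_eq_add (by omega) loop_v3_eq γ_aux, γ_aux]

/-- From `x = ux` one gets `λX^(m-1)x = 0`. In this way `λ ≠ 0` produces zero relations that are not
listed in the definition of `S`. -/
theorem X_pow_smul_eq_zero_of_eq (hlam : lam ≠ 0) {x : SphericalAlgebra K m lam}
    (h : x = uPoly m lam • x) : (X ^ (m - 1) : K[X]) • x = 0 := by
  rw [uPoly, add_smul, one_smul, left_eq_add, mul_smul, ← algebraMap_eq, algebraMap_smul] at h
  exact (smul_eq_zero_iff_right hlam).1 h

/-- `βγσρ = βνδρ = uβγσρ`: two relations compare the same paths, one with a λ-term and one without.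
The next three lemmas have the same proof. -/
theorem X_pow_smul_βγσρ (hm : 2 ≤ m) (hlam : lam ≠ 0) :
    (X ^ (m - 1) : K[X]) • (sβ * (sγ * (sσ * sρ))) = 0 := by
  refine X_pow_smul_eq_zero_of_eq hlam ?_
  have h := congrArg (· * sρ) (βνδ (lam := lam) hm)
  simpa only [smul_mul_assoc, mul_assoc, ← γσρ] using h

theorem X_pow_smul_σαβν (hm : 2 ≤ m) (hlam : lam ≠ 0) :
    (X ^ (m - 1) : K[X]) • (sσ * (sα * (sβ * sν))) = 0 := by
  refine X_pow_smul_eq_zero_of_eq hlam ?_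
  have h := congrArg (· * sν) (σρω (lam := lam) hm)
  simpa only [smul_mul_assoc, mul_assoc, ← αβν] using h

theorem X_pow_smul_δαβγ (hm : 2 ≤ m) (hlam : lam ≠ 0) :
    (X ^ (m - 1) : K[X]) • (sδ * (sα * (sβ * sγ))) = 0 := by
  refine X_pow_smul_eq_zero_of_eq hlam ?_
  have h := congrArg (sδ * ·) (ρωγ (lam := lam) hm)
  simpa only [mul_smul_comm, ← mul_mul_mul_of_eq δαβ] using h

theorem X_pow_smul_ωγσα (hm : 2 ≤ m) (hlam : lam ≠ 0) :
    (X ^ (m - 1) : K[X]) • (sω * (sγ * (sσ * sα))) = 0 := by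
  refine X_pow_smul_eq_zero_of_eq hlam ?_
  have h := congrArg (sω * ·) (νδα (lam := lam) hm)
  simpa only [mul_smul_comm, ← mul_mul_mul_of_eq ωγσ] using h

/-- For α and γ this is a defining relation. For any other arrow `a`, the path `Xa` contains one of
the four paths that `X^(m-1)` kills. -/
theorem X_pow_smul_arrow (hm : 2 ≤ m) (hlam : lam ≠ 0) (a : SArrow) :
    (X ^ m : K[X]) • arrow K m lam a = 0 := by
  have hX : (X ^ m : K[X]) = X ^ (m - 1) * X := by rw [← pow_succ, Nat.sub_add_cancel (by omega)]
  have key {x : SphericalAlgebra K m lam} (y z) (h : (X ^ (m - 1) : K[X]) • x = 0) :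
      (X ^ (m - 1) : K[X]) • (y * x * z) = 0 := by
    rw [← smul_mul_assoc, ← mul_smul_comm, h, mul_zero, zero_mul]
  have hβ := X_pow_smul_βγσρ (lam := lam) hm hlam
  have hσ := X_pow_smul_σαβν (lam := lam) hm hlam
  have hδ := X_pow_smul_δαβγ (lam := lam) hm hlam
  have hω := X_pow_smul_ωγσα (lam := lam) hm hlam
  cases a
  case α => exact X_pow_smul_α hm
  case γ => exact X_pow_smul_γ hm
  case β =>
    rw [hX, mul_smul, X_smul e_β]
    convert key 1 sω hβ using 2
    simp only [loop, one_mul, mul_assoc]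
    rw [δαβ, mul_mul_mul_of_eq γσρ]
  case σ =>
    rw [hX, mul_smul, X_smul e_σ]
    convert key 1 sδ hσ using 2
    simp only [loop, one_mul, mul_assoc]
    rw [ρωγσ]; rfl
  case ρ =>
    rw [hX, mul_smul, X_smul e_ρ]
    convert key sα 1 hβ using 2
    simp only [loop, mul_one, mul_assoc, γσρ]
  case δ =>
    rw [hX, mul_smul, X_smul e_δ]
    convert key 1 sσ hδ using 2
    simp only [loop, one_mul, mul_assoc]
    rw [mul_mul_mul_of_eq αβν, mul_mul_mul_of_eq δαβ, ωγσ]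
  case ω =>
    rw [hX, mul_smul, X_smul e_ω]
    convert key 1 sβ hω using 2
    simp only [loop, one_mul, mul_assoc]
    rw [mul_mul_mul_of_eq ωγσ, δαβ]
  case ν =>
    rw [hX, mul_smul, X_smul e_ν, ← γσρω]
    convert key sγ 1 hσ using 2
    simp only [mul_one, mul_assoc, αβν]

end SphericalAlgebra

end

/-! ### Complexes with two terms in the homotopy category -/

section

section Double

open HomologicalComplex TetrahedralAlgebra

variable {V : Type*} [Category V] [Preadditive V]

/-- The null homotopy has `h` as its only nonzero component. -/
theorem quotient_map_eq_zero_of_eq {C D : HomologicalComplex V (ComplexShape.down ℤ)} (f : C ⟶ D)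
    (h : C.X 0 ⟶ D.X 1) (h1 : f.f 1 = C.d 1 0 ≫ h) (h0 : f.f 0 = h ≫ D.d 1 0)
    (hf : ∀ n, n ≠ 0 → n ≠ 1 → f.f n = 0) :
    (HomotopyCategory.quotient V _).map f = 0 := by
  rw [HomotopyCategory.quotient_map_eq_zero_iff]
  refine ⟨⟨fun i j => if hij : i = 0 ∧ j = 1 then
    eqToHom (by rw [hij.1]) ≫ h ≫ eqToHom (by rw [hij.2]) else 0, fun i j hij => ?_, fun i => ?_⟩⟩
  · refine dif_neg ?_
    rintro ⟨rfl, rfl⟩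
    exact hij rel_one_zero
  · rw [HomologicalComplex.zero_f, add_zero,
      dNext_eq (i := i) (i' := i - 1) _ (sub_add_cancel i 1), prevD_eq (j' := i + 1) _ rfl]
    by_cases hi0 : i = 0
    · subst hi0
      rw [dif_neg (by omega), comp_zero, zero_add, dif_pos ⟨rfl, by omega⟩]
      simpa using h0
    · by_cases hi1 : i = 1
      · subst hi1
        rw [dif_neg (c := (1 : ℤ) = 0 ∧ _) (by omega), zero_comp, add_zero,
          dif_pos ⟨by omega, rfl⟩]
        simpa using h1
      · rw [dif_neg (by omega), dif_neg (by omega), hf i hi0 hi1, comp_zero, zero_comp, add_zero]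

/-- The vanishing differentials remove the contributions of the neighbouring components of the
homotopy in degrees `0` and `1`. -/
theorem exists_eq_of_quotient_map_eq_zero {C D : HomologicalComplex V (ComplexShape.down ℤ)}
    {f : C ⟶ D} (hf : (HomotopyCategory.quotient V _).map f = 0) (hC : C.d 0 (-1) = 0)
    (hD : D.d 2 1 = 0) : ∃ h : C.X 0 ⟶ D.X 1, f.f 1 = C.d 1 0 ≫ h ∧ f.f 0 = h ≫ D.d 1 0 := by
  obtain ⟨H⟩ := (HomotopyCategory.quotient_map_eq_zero_iff f).1 hf
  refine ⟨H.hom 0 1, ?_, ?_⟩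
  · have := H.comm 1
    rwa [HomologicalComplex.zero_f, add_zero, dNext_eq (i := 1) (i' := 0) _ rel_one_zero,
      prevD_eq (j' := 2) _ (show (ComplexShape.down ℤ).Rel 2 1 from rfl), hD, comp_zero,
      add_zero] at this
  · have := H.comm 0
    rwa [HomologicalComplex.zero_f, add_zero,
      dNext_eq (i := 0) (i' := -1) _ (show (ComplexShape.down ℤ).Rel 0 (-1) from rfl),
      prevD_eq (j' := 1) _ rel_one_zero, hC, zero_comp, zero_add] at this

variable [HasZeroObject V] {X Y : V} (d : X ⟶ Y)

/-- A map to the right hand term of a complex with two terms, as a map of complexes. -/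
noncomputable def toDouble {M : V} (φ : M ⟶ Y) :
    (single V (ComplexShape.down ℤ) 0).obj M ⟶ double d rel_one_zero :=
  mkHomFromSingle (φ ≫ (doubleXIso₁ d rel_one_zero one_ne_zero).inv) fun k _ => by
    rw [double_d_eq_zero₀ _ _ _ _ zero_ne_one, comp_zero]

/-- A map from the cokernel of a complex with two terms, as a map of complexes. -/
noncomputable def fromDouble {N : V} (ψ : Y ⟶ N) (h : d ≫ ψ = 0) :
    double d rel_one_zero ⟶ (single V (ComplexShape.down ℤ) 0).obj N :=
  mkHomFromDouble rel_one_zero one_ne_zero 0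
    (ψ ≫ (singleObjXSelf (ComplexShape.down ℤ) 0 N).inv)
    (by rw [zero_comp, ← Category.assoc, h, zero_comp]) (by simp)

/-- An endomorphism of a complex with two terms. -/
noncomputable def endDouble (s : X ⟶ X) (t : Y ⟶ Y) (h : s ≫ d = d ≫ t) :
    double d rel_one_zero ⟶ double d rel_one_zero :=
  mkHomFromDouble rel_one_zero one_ne_zero (s ≫ (doubleXIso₀ d rel_one_zero).inv)
    (t ≫ (doubleXIso₁ d rel_one_zero one_ne_zero).inv)
    (by rw [double_d _ _ one_ne_zero]; simp [reassoc_of% h])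
    (fun k _ => by rw [double_d_eq_zero₀ _ _ _ _ zero_ne_one, comp_zero])

variable {d}

theorem exists_eq_toDouble {M : V}
    (F : (single V (ComplexShape.down ℤ) 0).obj M ⟶ double d rel_one_zero) :
    ∃ φ, F = toDouble d φ :=
  ⟨(singleObjXSelf _ 0 M).inv ≫ F.f 0 ≫ (doubleXIso₁ d rel_one_zero one_ne_zero).hom, by
    ext; simp [toDouble]⟩

theorem exists_eq_endDouble (F : double d rel_one_zero ⟶ double d rel_one_zero) :
    ∃ s t h, F = endDouble d s t h :=
  ⟨(doubleXIso₀ d rel_one_zero).inv ≫ F.f 1 ≫ (doubleXIso₀ d rel_one_zero).hom,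
    (doubleXIso₁ d rel_one_zero one_ne_zero).inv ≫ F.f 0 ≫
      (doubleXIso₁ d rel_one_zero one_ne_zero).hom, by
    have := F.comm 1 0
    simp only [double_d _ _ one_ne_zero] at this
    simp [← cancel_mono (doubleXIso₁ d rel_one_zero one_ne_zero).inv, this], by
    ext <;> simp [endDouble]⟩

theorem double_hom_ext {N : V}
    {F G : double d rel_one_zero ⟶ (single V (ComplexShape.down ℤ) 0).obj N} (h : F.f 0 = G.f 0) :
    F = G :=
  from_double_hom_ext ((isZero_single_obj_X _ _ _ _ one_ne_zero).eq_of_tgt _ _) h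

theorem exists_eq_fromDouble {N : V}
    (F : double d rel_one_zero ⟶ (single V (ComplexShape.down ℤ) 0).obj N) :
    ∃ ψ h, F = fromDouble d ψ h :=
  ⟨(doubleXIso₁ d rel_one_zero one_ne_zero).inv ≫ F.f 0 ≫ (singleObjXSelf _ 0 N).hom, by
    have := F.comm 1 0
    rw [(isZero_single_obj_X _ _ _ _ one_ne_zero).eq_of_tgt (F.f 1) 0, zero_comp,
      double_d _ _ one_ne_zero] at this
    rw [← cancel_epi (doubleXIso₀ d rel_one_zero).hom]
    simp only [Category.assoc] at this
    rw [reassoc_of% this.symm]; simp, by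
    apply double_hom_ext; simp [fromDouble]⟩

theorem toDouble_fromDouble {M N : V} (φ : M ⟶ Y) (ψ : Y ⟶ N) (h : d ≫ ψ = 0) :
    toDouble d φ ≫ fromDouble d ψ h = (single V (ComplexShape.down ℤ) 0).map (φ ≫ ψ) := by
  ext; simp [toDouble, fromDouble, single_map_f_self]

theorem single_map_toDouble {M N : V} (χ : M ⟶ N) (φ : N ⟶ Y) :
    (single V (ComplexShape.down ℤ) 0).map χ ≫ toDouble d φ = toDouble d (χ ≫ φ) := by
  ext; simp [toDouble, single_map_f_self]

theorem toDouble_endDouble {M : V} (φ : M ⟶ Y) (s : X ⟶ X) (t : Y ⟶ Y) (h : s ≫ d = d ≫ t) :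
    toDouble d φ ≫ endDouble d s t h = toDouble d (φ ≫ t) := by
  ext; simp [toDouble, endDouble]

theorem fromDouble_toDouble {N : V} (ψ : Y ⟶ N) (h : d ≫ ψ = 0) (φ : N ⟶ Y) :
    fromDouble d ψ h ≫ toDouble d φ = endDouble d 0 (ψ ≫ φ) (by simp [reassoc_of% h]) := by
  ext <;> simp [fromDouble, toDouble, endDouble]

theorem toDouble_add {M : V} (φ φ' : M ⟶ Y) :
    toDouble d (φ + φ') = toDouble d φ + toDouble d φ' := by
  ext; simp [toDouble]

theorem toDouble_sub {M : V} (φ φ' : M ⟶ Y) :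
    toDouble d (φ - φ') = toDouble d φ - toDouble d φ' := by
  ext; simp [toDouble]

theorem endDouble_sub {s s' : X ⟶ X} {t t' : Y ⟶ Y} (h : s ≫ d = d ≫ t) (h' : s' ≫ d = d ≫ t') :
    endDouble d (s - s') (t - t') (by simp [h, h']) = endDouble d s t h - endDouble d s' t' h' := by
  ext <;> simp [endDouble]

theorem quotient_map_toDouble_eq_zero_iff {M : V} (φ : M ⟶ Y) :
    (HomotopyCategory.quotient V _).map (toDouble d φ) = 0 ↔ ∃ h : M ⟶ X, h ≫ d = φ := by
  constructor
  · intro h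
    obtain ⟨h, -, h0⟩ := exists_eq_of_quotient_map_eq_zero h (single_obj_d _ _ _ _ _)
      (double_d_eq_zero₀ _ _ _ _ (by decide))
    refine ⟨(singleObjXSelf _ 0 M).inv ≫ h ≫ (doubleXIso₀ d rel_one_zero).hom, ?_⟩
    rw [double_d _ _ one_ne_zero] at h0
    have := congrArg (fun f => (singleObjXSelf _ 0 M).inv ≫ f ≫
      (doubleXIso₁ d rel_one_zero one_ne_zero).hom) h0
    simpa [toDouble] using this.symm
  · rintro ⟨h, rfl⟩
    refine quotient_map_eq_zero_of_eq _
      ((singleObjXSelf _ 0 M).hom ≫ h ≫ (doubleXIso₀ d rel_one_zero).inv)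
      ((isZero_single_obj_X _ _ _ _ one_ne_zero).eq_of_src _ _) ?_
      fun n hn _ => (isZero_single_obj_X _ _ _ _ hn).eq_of_src _ _
    rw [double_d _ _ one_ne_zero]
    simp [toDouble]

theorem quotient_map_endDouble_eq_zero_iff {s : X ⟶ X} {t : Y ⟶ Y} (h : s ≫ d = d ≫ t) :
    (HomotopyCategory.quotient V _).map (endDouble d s t h) = 0 ↔
      ∃ h : Y ⟶ X, s = d ≫ h ∧ t = h ≫ d := by
  constructor
  · intro h
    obtain ⟨h, h1, h0⟩ := exists_eq_of_quotient_map_eq_zero h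
      (double_d_eq_zero₀ _ _ _ _ (by decide)) (double_d_eq_zero₀ _ _ _ _ (by decide))
    rw [double_d _ _ one_ne_zero] at h0 h1
    refine ⟨(doubleXIso₁ d rel_one_zero one_ne_zero).inv ≫ h ≫ (doubleXIso₀ d rel_one_zero).hom,
      ?_, ?_⟩
    · have := congrArg (fun f => (doubleXIso₀ d rel_one_zero).inv ≫ f ≫
        (doubleXIso₀ d rel_one_zero).hom) h1
      simpa [endDouble] using this
    · have := congrArg (fun f => (doubleXIso₁ d rel_one_zero one_ne_zero).inv ≫ f ≫
        (doubleXIso₁ d rel_one_zero one_ne_zero).hom) h0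
      simpa [endDouble] using this
  · rintro ⟨k, rfl, rfl⟩
    refine quotient_map_eq_zero_of_eq _ ((doubleXIso₁ d rel_one_zero one_ne_zero).hom ≫ k ≫
      (doubleXIso₀ d rel_one_zero).inv) ?_ ?_
      fun n hn hn' => (isZero_double_X _ _ _ hn' hn).eq_of_src _ _ <;>
    · rw [double_d _ _ one_ne_zero]
      simp [endDouble]

end Double

end

/-! ### The regular module and the degree `0` summands of `T` -/

section

open HomologicalComplex

theorem Vertex.sum_univ {M : Type*} [AddCommMonoid M] (f : Vertex → M) :
    ∑ i, f i = f .v1 + f .v2 + f .v3 + f .v4 + f .v5 + f .v6 := by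
  rw [show (Finset.univ : Finset Vertex) = {.v1, .v2, .v3, .v4, .v5, .v6} from rfl]
  simp [add_assoc]

namespace TetrahedralAlgebra

variable (K : Type u) [Field K] (m : ℕ) (lam : K)

/-- The right regular module. -/
noncomputable abbrev regular : RightMod K m lam :=
  ModuleCat.of (TetrahedralAlgebra K m lam)ᵐᵒᵖ (TetrahedralAlgebra K m lam)

variable {K m lam} in
/-- Left multiplication as an endomorphism of the right regular module. -/
noncomputable def mulHom (x : TetrahedralAlgebra K m lam) : regular K m lam ⟶ regular K m lam :=
  ModuleCat.ofHom (LinearMap.mulLeft _ x)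

/-- The inclusion of `P i` into the regular module. -/
noncomputable def incl (i : Vertex) :
    ModuleCat.of (TetrahedralAlgebra K m lam)ᵐᵒᵖ (P K m lam i) ⟶ regular K m lam :=
  ModuleCat.ofHom (P K m lam i).subtype

/-- The projection of the regular module to `P i`. -/
noncomputable def proj (i : Vertex) :
    regular K m lam ⟶ ModuleCat.of (TetrahedralAlgebra K m lam)ᵐᵒᵖ (P K m lam i) :=
  ModuleCat.ofHom (LinearMap.mulLeft _ (e K m lam i)).rangeRestrict

variable {K m lam}

theorem e_mul_of_mem {i : Vertex} {x : TetrahedralAlgebra K m lam} (h : x ∈ P K m lam i) :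
    e K m lam i * x = x := by
  obtain ⟨y, rfl⟩ := h
  rw [LinearMap.mulLeft_apply, ← mul_assoc, e_mul_e]

theorem proj_incl (i : Vertex) :
    proj K m lam i ≫ incl K m lam i = mulHom (e K m lam i) := rfl

theorem incl_proj (i : Vertex) : incl K m lam i ≫ proj K m lam i = 𝟙 _ := by
  refine ModuleCat.hom_ext (LinearMap.ext fun x => ?_)
  exact Subtype.ext (e_mul_of_mem x.2)

theorem incl_proj_of_ne {i j : Vertex} (h : i ≠ j) : incl K m lam i ≫ proj K m lam j = 0 := by
  refine ModuleCat.hom_ext (LinearMap.ext fun x => Subtype.ext ?_)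
  change e K m lam j * x.1 = 0
  rw [← e_mul_of_mem x.2, ← mul_assoc, e_mul_e_of_ne K m lam h.symm, zero_mul]

theorem mulHom_mul (x y : TetrahedralAlgebra K m lam) : mulHom (x * y) = mulHom y ≫ mulHom x := by
  refine ModuleCat.hom_ext (LinearMap.ext fun z => ?_)
  exact mul_assoc x y z

theorem mulHom_one : mulHom (1 : TetrahedralAlgebra K m lam) = 𝟙 _ := by
  refine ModuleCat.hom_ext (LinearMap.ext fun z => ?_)
  exact one_mul z

theorem mulHom_add (x y : TetrahedralAlgebra K m lam) : mulHom (x + y) = mulHom x + mulHom y := by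
  refine ModuleCat.hom_ext (LinearMap.ext fun z => ?_)
  exact add_mul x y z

theorem mulHom_sub (x y : TetrahedralAlgebra K m lam) : mulHom (x - y) = mulHom x - mulHom y := by
  refine ModuleCat.hom_ext (LinearMap.ext fun z => ?_)
  exact sub_mul x y z

/-- On maps of right modules a scalar acts by right multiplication with its image in Λ, which is
central. -/
theorem mulHom_smul (k : K) (x : TetrahedralAlgebra K m lam) :
    mulHom (k • x) = (Linear.homModule (R := K) (regular K m lam) (regular K m lam)).smul k
      (mulHom x) := by
  refine ModuleCat.hom_ext (LinearMap.ext fun z => ?_)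
  change k • x * z = (x * z) * algebraMap K (TetrahedralAlgebra K m lam) k
  rw [smul_mul_assoc, Algebra.smul_def, Algebra.commutes]

theorem exists_eq_mulHom (f : regular K m lam ⟶ regular K m lam) : f = mulHom (f.hom 1) := by
  refine ModuleCat.hom_ext (LinearMap.ext fun z => ?_)
  have := f.hom.map_smul (MulOpposite.op z) 1
  simpa [mulHom] using this

variable (K m lam)

/-- The homotopy category of complexes of right `Λ`-modules. -/
abbrev Ho := HomotopyCategory (RightMod K m lam) (ComplexShape.down ℤ)

/-- The right regular module as a complex concentrated in degree `0`. -/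
noncomputable abbrev regularStalk :
    HomologicalComplex (RightMod K m lam) (ComplexShape.down ℤ) :=
  (single (RightMod K m lam) (ComplexShape.down ℤ) 0).obj (regular K m lam)

/-- The stalk complex of the right regular module in the homotopy category. -/
noncomputable abbrev regularHo : Ho K m lam :=
  (HomotopyCategory.quotient _ _).obj (regularStalk K m lam)

/-- The complex `T` in the homotopy category. -/
noncomputable abbrev THo : Ho K m lam :=
  (HomotopyCategory.quotient _ _).obj (TComplex K m lam)

variable {K m lam}

/-- Left multiplication as an endomorphism of the regular module in the homotopy category. -/
noncomputable def J (x : TetrahedralAlgebra K m lam) : regularHo K m lam ⟶ regularHo K m lam :=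
  (HomotopyCategory.quotient _ _).map
    ((single (RightMod K m lam) (ComplexShape.down ℤ) 0).map (mulHom x))

theorem J_mul (x y : TetrahedralAlgebra K m lam) : J (x * y) = J y ≫ J x := by
  simp only [J, mulHom_mul, Functor.map_comp]

theorem J_one : J (1 : TetrahedralAlgebra K m lam) = 𝟙 _ := by
  rw [J, mulHom_one, CategoryTheory.Functor.map_id, CategoryTheory.Functor.map_id]

theorem J_add (x y : TetrahedralAlgebra K m lam) : J (x + y) = J x + J y := by
  simp only [J, mulHom_add, Functor.map_add]

theorem J_sub (x y : TetrahedralAlgebra K m lam) : J (x - y) = J x - J y := by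
  simp only [J, mulHom_sub, Functor.map_sub]

theorem J_smul (k : K) (x : TetrahedralAlgebra K m lam) : J (k • x) = k • J x := by
  have : (single (RightMod K m lam) (ComplexShape.down ℤ) 0).map (mulHom (k • x)) =
      k • (single (RightMod K m lam) (ComplexShape.down ℤ) 0).map (mulHom x) := by
    apply to_single_hom_ext
    rw [smul_f_apply, single_map_f_self, single_map_f_self, mulHom_smul]
    exact (congrArg _ (Linear.smul_comp _ _ _ _ _ _)).trans (Linear.comp_smul _ _ _ _ _ _)
  rw [J, this, Functor.map_smul, J]

theorem J_zero : J (0 : TetrahedralAlgebra K m lam) = 0 := by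
  simpa using J_sub (0 : TetrahedralAlgebra K m lam) 0

/-- A homotopy between stalk complexes contributes only through zero differentials. -/
theorem quotient_map_single_map_eq_zero {M N : RightMod K m lam} {f : M ⟶ N}
    (h : (HomotopyCategory.quotient _ (ComplexShape.down ℤ)).map
      ((single (RightMod K m lam) (ComplexShape.down ℤ) 0).map f) = 0) : f = 0 := by
  obtain ⟨h, -, h0⟩ := exists_eq_of_quotient_map_eq_zero h (single_obj_d _ _ _ _ _)
    (single_obj_d _ _ _ _ _)
  apply (single (RightMod K m lam) (ComplexShape.down ℤ) 0).map_injective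
  apply to_single_hom_ext
  rw [h0, single_obj_d, Limits.comp_zero, Functor.map_zero, zero_f]

theorem J_eq_zero {x : TetrahedralAlgebra K m lam} (h : J x = 0) : x = 0 := by
  have := quotient_map_single_map_eq_zero h
  simpa [mulHom] using congrArg (fun f => f.hom 1) this

theorem exists_eq_J (f : regularHo K m lam ⟶ regularHo K m lam) : ∃ x, f = J x := by
  obtain ⟨F, rfl⟩ := (HomotopyCategory.quotient _ _).map_surjective f
  obtain ⟨φ, rfl⟩ := (single (RightMod K m lam) (ComplexShape.down ℤ) 0).map_surjective F
  exact ⟨φ.hom 1, by rw [J, ← exists_eq_mulHom]⟩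

variable (K m lam)

/-- The projections of the regular module to the summands of `T` concentrated in degree `0`. -/
noncomputable def toTSummand :
    ∀ i, regularStalk K m lam ⟶ TSummand K m lam i
  | .v1 => (single (RightMod K m lam) (ComplexShape.down ℤ) 0).map (proj K m lam .v1)
  | .v2 => (single (RightMod K m lam) (ComplexShape.down ℤ) 0).map (proj K m lam .v5)
  | .v3 => 0
  | .v4 => (single (RightMod K m lam) (ComplexShape.down ℤ) 0).map (proj K m lam .v3)
  | .v5 => (single (RightMod K m lam) (ComplexShape.down ℤ) 0).map (proj K m lam .v4)
  | .v6 => (single (RightMod K m lam) (ComplexShape.down ℤ) 0).map (proj K m lam .v6)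

/-- The inclusions of the summands of `T` concentrated in degree `0` into the regular module. -/
noncomputable def ofTSummand :
    ∀ i, TSummand K m lam i ⟶ regularStalk K m lam
  | .v1 => (single (RightMod K m lam) (ComplexShape.down ℤ) 0).map (incl K m lam .v1)
  | .v2 => (single (RightMod K m lam) (ComplexShape.down ℤ) 0).map (incl K m lam .v5)
  | .v3 => 0
  | .v4 => (single (RightMod K m lam) (ComplexShape.down ℤ) 0).map (incl K m lam .v3)
  | .v5 => (single (RightMod K m lam) (ComplexShape.down ℤ) 0).map (incl K m lam .v4)
  | .v6 => (single (RightMod K m lam) (ComplexShape.down ℤ) 0).map (incl K m lam .v6)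

/-- The stalk summands run through all `P i` except `P 2`, whence the missing idempotent. -/
theorem toTSummand_ofTSummand : ∑ i, toTSummand K m lam i ≫ ofTSummand K m lam i =
    (single (RightMod K m lam) (ComplexShape.down ℤ) 0).map (mulHom (1 - e K m lam .v2)) := by
  rw [Vertex.sum_univ]
  simp only [toTSummand, ofTSummand, Limits.zero_comp, add_zero]
  erw [← Functor.map_comp, ← Functor.map_comp, ← Functor.map_comp, ← Functor.map_comp,
    ← Functor.map_comp]
  simp only [proj_incl, ← Functor.map_add, ← mulHom_add, ← sum_e K m lam, Vertex.sum_univ]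
  congr 2
  abel

theorem ofTSummand_toTSummand (i : Vertex) (h : i ≠ .v3) :
    ofTSummand K m lam i ≫ toTSummand K m lam i = 𝟙 _ := by
  cases i
  case v3 => exact absurd rfl h
  all_goals
  · refine (Functor.map_comp _ _ _).symm.trans ?_
    rw [incl_proj]
    exact CategoryTheory.Functor.map_id _ _

theorem ofTSummand_toTSummand_of_ne {i j : Vertex} (h : i ≠ j) :
    ofTSummand K m lam i ≫ toTSummand K m lam j = 0 := by
  cases i <;> cases j <;> first
    | exact absurd rfl h
    | exact Limits.zero_comp
    | exact Limits.comp_zero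
    | (refine (Functor.map_comp _ _ _).symm.trans ?_
       rw [incl_proj_of_ne (by decide)]
       exact Functor.map_zero _ _ _)

/-- The inclusion of a summand into `T`. -/
noncomputable def ofT (i : Vertex) : TSummand K m lam i ⟶ TComplex K m lam :=
  biproduct.ι (TSummand K m lam) i

/-- The projection of `T` to a summand. -/
noncomputable def toT (i : Vertex) : TComplex K m lam ⟶ TSummand K m lam i :=
  biproduct.π (TSummand K m lam) i

theorem ofT_toT_self (i : Vertex) : ofT K m lam i ≫ toT K m lam i = 𝟙 _ :=
  biproduct.ι_π_self (TSummand K m lam) i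

theorem ofT_toT_of_ne {i j : Vertex} (h : i ≠ j) : ofT K m lam i ≫ toT K m lam j = 0 :=
  biproduct.ι_π_ne (TSummand K m lam) h

/-- The map from the regular module to the summands of `T` concentrated in degree `0`. -/
noncomputable def regularToT : regularStalk K m lam ⟶ TComplex K m lam :=
  biproduct.lift (toTSummand K m lam)

/-- The map from the summands of `T` concentrated in degree `0` to the regular module. -/
noncomputable def TToRegular : TComplex K m lam ⟶ regularStalk K m lam :=
  biproduct.desc (ofTSummand K m lam)

theorem regularToT_toT (i : Vertex) :
    regularToT K m lam ≫ toT K m lam i = toTSummand K m lam i :=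
  biproduct.lift_π (toTSummand K m lam) i

theorem ofT_TToRegular (i : Vertex) :
    ofT K m lam i ≫ TToRegular K m lam = ofTSummand K m lam i :=
  biproduct.ι_desc (ofTSummand K m lam) i

theorem regularToT_TToRegular : regularToT K m lam ≫ TToRegular K m lam =
    (single (RightMod K m lam) (ComplexShape.down ℤ) 0).map (mulHom (1 - e K m lam .v2)) :=
  biproduct.lift_desc.trans (toTSummand_ofTSummand K m lam)

/-- With `regularToT_TToRegular` this identifies the sum of the stalk summands of `T` with the
direct summand `(1 - e 2)Λ` of the regular module, so that maps between them become elements of Λ.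
-/
theorem TToRegular_regularToT : TToRegular K m lam ≫ regularToT K m lam =
    𝟙 _ - toT K m lam .v3 ≫ ofT K m lam .v3 := by
  suffices h : ∀ i j, ofT K m lam i ≫ (TToRegular K m lam ≫ regularToT K m lam) ≫ toT K m lam j =
      ofT K m lam i ≫ (𝟙 _ - toT K m lam .v3 ≫ ofT K m lam .v3) ≫ toT K m lam j from
    biproduct.hom_ext' _ _ fun i => biproduct.hom_ext _ _ fun j =>
      (Category.assoc _ _ _).trans ((h i j).trans (Category.assoc _ _ _).symm)
  intro i j
  rw [Category.assoc, ← Category.assoc, ofT_TToRegular, regularToT_toT, Preadditive.sub_comp,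
    Preadditive.comp_sub, Category.id_comp, Category.assoc, ← Category.assoc]
  by_cases hij : i = j
  · subst hij
    by_cases hi : i = .v3
    · subst hi
      rw [ofT_toT_self, Category.id_comp, sub_self]
      exact Limits.zero_comp
    · rw [ofTSummand_toTSummand K m lam i hi, ofT_toT_self, ofT_toT_of_ne K m lam hi,
        Limits.zero_comp, sub_zero]
  · rw [ofTSummand_toTSummand_of_ne K m lam hij, ofT_toT_of_ne K m lam hij, zero_sub, eq_comm,
      neg_eq_zero]
    by_cases hi : i = .v3
    · subst hi
      rw [ofT_toT_of_ne K m lam hij, Limits.comp_zero]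
    · rw [ofT_toT_of_ne K m lam hi, Limits.zero_comp]

end TetrahedralAlgebra

end

/-! ### Maps between `T`, `T 3` and the regular module up to homotopy -/

section

namespace TetrahedralAlgebra

open HomologicalComplex

variable {K : Type u} [Field K] {m : ℕ} {lam : K}

local notation "tβ" => arrow K m lam TArrow.β
local notation "tσ" => arrow K m lam TArrow.σ

/-- The map `x ↦ (u x, v x)` from the regular module to `P 3 ⊕ P 4`. -/
noncomputable def pairHom (u v : TetrahedralAlgebra K m lam) : regular K m lam ⟶
    ModuleCat.of (TetrahedralAlgebra K m lam)ᵐᵒᵖ (P K m lam .v3 × P K m lam .v4) :=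
  mulHom u ≫ proj K m lam .v3 ≫ ModuleCat.ofHom (LinearMap.inl _ _ _) +
    mulHom v ≫ proj K m lam .v4 ≫ ModuleCat.ofHom (LinearMap.inr _ _ _)

/-- The map `(x, y) ↦ u x + v y` from `P 3 ⊕ P 4` to the regular module. -/
noncomputable def copairHom (u v : TetrahedralAlgebra K m lam) :
    ModuleCat.of (TetrahedralAlgebra K m lam)ᵐᵒᵖ (P K m lam .v3 × P K m lam .v4) ⟶
      regular K m lam :=
  ModuleCat.ofHom (LinearMap.fst _ _ _) ≫ incl K m lam .v3 ≫ mulHom u +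
    ModuleCat.ofHom (LinearMap.snd _ _ _) ≫ incl K m lam .v4 ≫ mulHom v

theorem pairHom_fst (u v z : TetrahedralAlgebra K m lam) :
    ((pairHom u v).hom z).1.1 = e K m lam .v3 * (u * z) := by
  change e K m lam .v3 * (u * z) + 0 = _
  rw [add_zero]

theorem pairHom_snd (u v z : TetrahedralAlgebra K m lam) :
    ((pairHom u v).hom z).2.1 = e K m lam .v4 * (v * z) := by
  change 0 + e K m lam .v4 * (v * z) = _
  rw [zero_add]

theorem copairHom_apply (u v : TetrahedralAlgebra K m lam) (x) :
    (copairHom u v).hom x = u * x.1.1 + v * x.2.1 := rfl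

theorem dT3_fst (x) : ((dT3 K m lam).hom x).1.1 = -(tσ * x.1) := rfl

theorem dT3_snd (x) : ((dT3 K m lam).hom x).2.1 = tβ * x.1 := rfl

theorem dT3_copairHom {u v : TetrahedralAlgebra K m lam} (h : u * tσ = v * tβ) :
    dT3 K m lam ≫ copairHom u v = 0 := by
  refine ModuleCat.hom_ext (LinearMap.ext fun x => ?_)
  rw [ModuleCat.hom_comp, LinearMap.comp_apply, copairHom_apply, dT3_fst, dT3_snd, mul_neg,
    ← mul_assoc, ← mul_assoc, h, neg_add_cancel]
  rfl

/-- Every map to `P 3 ⊕ P 4` from the regular module is a pair. -/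
theorem exists_eq_pairHom (φ : regular K m lam ⟶
    ModuleCat.of (TetrahedralAlgebra K m lam)ᵐᵒᵖ (P K m lam .v3 × P K m lam .v4)) :
    ∃ u v, φ = mulHom u ≫ pairHom 1 0 + mulHom v ≫ pairHom 0 1 := by
  refine ⟨(φ.hom 1).1.1, (φ.hom 1).2.1, ModuleCat.hom_ext (LinearMap.ext fun z => ?_)⟩
  have h : φ.hom z = MulOpposite.op z • φ.hom 1 := by
    rw [← map_smul]
    exact congrArg _ (one_mul z).symm
  refine Prod.ext (Subtype.ext ?_) (Subtype.ext ?_)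
  · change (φ.hom z).1.1 = ((pairHom 1 0).hom ((φ.hom 1).1.1 * z)).1.1 +
      ((pairHom 0 1).hom ((φ.hom 1).2.1 * z)).1.1
    rw [pairHom_fst, pairHom_fst, h, one_mul, zero_mul, mul_zero, add_zero, ← mul_assoc,
      e_mul_of_mem (φ.hom 1).1.2]
    rfl
  · change (φ.hom z).2.1 = ((pairHom 1 0).hom ((φ.hom 1).1.1 * z)).2.1 +
      ((pairHom 0 1).hom ((φ.hom 1).2.1 * z)).2.1
    rw [pairHom_snd, pairHom_snd, h, one_mul, zero_mul, mul_zero, zero_add, ← mul_assoc,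
      e_mul_of_mem (φ.hom 1).2.2]
    rfl

theorem eq_pairHom_add_pairHom (x : P K m lam .v3 × P K m lam .v4) :
    x = (pairHom 1 0).hom x.1.1 + (pairHom 0 1).hom x.2.1 := by
  refine Prod.ext (Subtype.ext ?_) (Subtype.ext ?_)
  · change x.1.1 = ((pairHom 1 0).hom x.1.1).1.1 + ((pairHom 0 1).hom x.2.1).1.1
    rw [pairHom_fst, pairHom_fst, one_mul, zero_mul, mul_zero, add_zero, e_mul_of_mem x.1.2]
  · change x.2.1 = ((pairHom 1 0).hom x.1.1).2.1 + ((pairHom 0 1).hom x.2.1).2.1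
    rw [pairHom_snd, pairHom_snd, one_mul, zero_mul, mul_zero, zero_add, e_mul_of_mem x.2.2]

theorem hom_ext_pairHom {N : RightMod K m lam}
    {f g : ModuleCat.of (TetrahedralAlgebra K m lam)ᵐᵒᵖ (P K m lam .v3 × P K m lam .v4) ⟶ N}
    (h1 : pairHom 1 0 ≫ f = pairHom 1 0 ≫ g) (h2 : pairHom 0 1 ≫ f = pairHom 0 1 ≫ g) : f = g := by
  refine ModuleCat.hom_ext (LinearMap.ext fun x => ?_)
  rw [eq_pairHom_add_pairHom x, map_add, map_add]
  exact congrArg₂ _ (congrArg (fun f => f.hom x.1.1) h1) (congrArg (fun f => f.hom x.2.1) h2)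

theorem pairHom_copairHom (u v u' v' : TetrahedralAlgebra K m lam) :
    pairHom u v ≫ copairHom u' v' =
      mulHom (u' * e K m lam .v3 * u + v' * e K m lam .v4 * v) := by
  refine ModuleCat.hom_ext (LinearMap.ext fun z => ?_)
  rw [ModuleCat.hom_comp, LinearMap.comp_apply, copairHom_apply, pairHom_fst, pairHom_snd]
  simp only [← mul_assoc, ← add_mul]
  rfl

theorem mulHom_e_pairHom :
    mulHom (e K m lam .v3) ≫ pairHom 1 0 = pairHom 1 0 := by
  refine ModuleCat.hom_ext (LinearMap.ext fun z => Prod.ext (Subtype.ext ?_) (Subtype.ext ?_))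
  · change ((pairHom 1 0).hom (e K m lam .v3 * z)).1.1 = ((pairHom 1 0).hom z).1.1
    rw [pairHom_fst, pairHom_fst, one_mul, one_mul, ← mul_assoc, e_mul_e]
  · change ((pairHom 1 0).hom (e K m lam .v3 * z)).2.1 = ((pairHom 1 0).hom z).2.1
    rw [pairHom_snd, pairHom_snd, zero_mul, zero_mul]

theorem mulHom_e_pairHom' :
    mulHom (e K m lam .v4) ≫ pairHom 0 1 = pairHom 0 1 := by
  refine ModuleCat.hom_ext (LinearMap.ext fun z => Prod.ext (Subtype.ext ?_) (Subtype.ext ?_))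
  · change ((pairHom 0 1).hom (e K m lam .v4 * z)).1.1 = ((pairHom 0 1).hom z).1.1
    rw [pairHom_fst, pairHom_fst, zero_mul, zero_mul]
  · change ((pairHom 0 1).hom (e K m lam .v4 * z)).2.1 = ((pairHom 0 1).hom z).2.1
    rw [pairHom_snd, pairHom_snd, one_mul, one_mul, ← mul_assoc, e_mul_e]

theorem mulHom_pairHom_sub :
    mulHom tσ ≫ pairHom 1 0 - mulHom tβ ≫ pairHom 0 1 = -(proj K m lam .v2 ≫ dT3 K m lam) := by
  refine ModuleCat.hom_ext (LinearMap.ext fun z => Prod.ext (Subtype.ext ?_) (Subtype.ext ?_))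
  · change ((pairHom 1 0).hom (tσ * z)).1.1 - ((pairHom 0 1).hom (tβ * z)).1.1 =
      - -(tσ * (e K m lam .v2 * z))
    rw [pairHom_fst, pairHom_fst, one_mul, zero_mul, mul_zero, sub_zero, neg_neg, ← mul_assoc,
      ← mul_assoc, e_σ, σ_e]
  · change ((pairHom 1 0).hom (tσ * z)).2.1 - ((pairHom 0 1).hom (tβ * z)).2.1 =
      -(tβ * (e K m lam .v2 * z))
    rw [pairHom_snd, pairHom_snd, one_mul, zero_mul, mul_zero, zero_sub, ← mul_assoc,
      ← mul_assoc, e_β, β_e]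

variable (K m lam)

/-- The map from the regular module to the summands of `T` concentrated in degree `0`. -/
noncomputable def iT : regularHo K m lam ⟶ THo K m lam :=
  (HomotopyCategory.quotient _ _).map (regularToT K m lam)

/-- The map from the summands of `T` concentrated in degree `0` to the regular module. -/
noncomputable def pT : THo K m lam ⟶ regularHo K m lam :=
  (HomotopyCategory.quotient _ _).map (TToRegular K m lam)

/-- The complex `T 3` in the homotopy category. -/
noncomputable abbrev T3Ho : Ho K m lam :=
  (HomotopyCategory.quotient _ _).obj (double (dT3 K m lam) rel_one_zero)

/-- The inclusion of `T 3` into `T`. -/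
noncomputable def iT3 : T3Ho K m lam ⟶ THo K m lam :=
  (HomotopyCategory.quotient _ _).map (ofT K m lam .v3)

/-- The projection of `T` to `T 3`. -/
noncomputable def pT3 : THo K m lam ⟶ T3Ho K m lam :=
  (HomotopyCategory.quotient _ _).map (toT K m lam .v3)

/-- The map from the regular module to `T` that factors through `P 3` in `T 3`. -/
noncomputable def leg3 : regularHo K m lam ⟶ THo K m lam :=
  (HomotopyCategory.quotient _ _).map (toDouble (dT3 K m lam) (pairHom 1 0)) ≫ iT3 K m lam

/-- The map from the regular module to `T` that factors through `P 4` in `T 3`. -/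
noncomputable def leg4 : regularHo K m lam ⟶ THo K m lam :=
  (HomotopyCategory.quotient _ _).map (toDouble (dT3 K m lam) (pairHom 0 1)) ≫ iT3 K m lam

variable {K m lam}

/-- The map from `T` to the regular module given by a map from the cokernel of `P 2 → P 3 ⊕ P 4`. -/
noncomputable def ofCokernel (u v : TetrahedralAlgebra K m lam) (h : u * tσ = v * tβ) :
    THo K m lam ⟶ regularHo K m lam :=
  pT3 K m lam ≫ (HomotopyCategory.quotient _ _).map
    (fromDouble (dT3 K m lam) (copairHom u v) (dT3_copairHom h))

theorem iT_pT : iT K m lam ≫ pT K m lam = J (1 - e K m lam .v2) := by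
  rw [iT, pT, ← Functor.map_comp, regularToT_TToRegular, J]

theorem iT_pT_assoc {Z : Ho K m lam} (f : regularHo K m lam ⟶ Z) :
    iT K m lam ≫ pT K m lam ≫ f = J (1 - e K m lam .v2) ≫ f := by
  rw [← Category.assoc, iT_pT]

theorem iT3_pT3 : iT3 K m lam ≫ pT3 K m lam = 𝟙 _ := by
  refine (Functor.map_comp _ _ _).symm.trans ((congrArg _ (ofT_toT_self K m lam .v3)).trans ?_)
  exact CategoryTheory.Functor.map_id _ _

theorem iT3_pT3_assoc {Z : Ho K m lam} (f : T3Ho K m lam ⟶ Z) :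
    iT3 K m lam ≫ pT3 K m lam ≫ f = f := by
  rw [← Category.assoc, iT3_pT3, Category.id_comp]

theorem iT_pT3 : iT K m lam ≫ pT3 K m lam = 0 := by
  refine (Functor.map_comp _ _ _).symm.trans ((congrArg _ (regularToT_toT K m lam .v3)).trans ?_)
  exact Functor.map_zero _ _ _

theorem iT_pT3_assoc {Z : Ho K m lam} (f : T3Ho K m lam ⟶ Z) :
    iT K m lam ≫ pT3 K m lam ≫ f = 0 := by
  rw [← Category.assoc, iT_pT3, Limits.zero_comp]

theorem iT3_pT : iT3 K m lam ≫ pT K m lam = 0 := by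
  refine (Functor.map_comp _ _ _).symm.trans ((congrArg _ (ofT_TToRegular K m lam .v3)).trans ?_)
  exact Functor.map_zero _ _ _

theorem pT_iT_add : pT K m lam ≫ iT K m lam + pT3 K m lam ≫ iT3 K m lam = 𝟙 _ := by
  have h : TToRegular K m lam ≫ regularToT K m lam + toT K m lam .v3 ≫ ofT K m lam .v3 = 𝟙 _ := by
    rw [TToRegular_regularToT, sub_add_cancel]
  have h' := congrArg (HomotopyCategory.quotient _ _).map h
  rw [Functor.map_add, Functor.map_comp, CategoryTheory.Functor.map_id] at h'
  exact (congrArg _ (Functor.map_comp _ _ _)).symm.trans h'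

theorem iT_ofCokernel {u v : TetrahedralAlgebra K m lam} (h : u * tσ = v * tβ) :
    iT K m lam ≫ ofCokernel u v h = 0 := by
  rw [ofCokernel, iT_pT3_assoc]

theorem iT_ofCokernel_assoc {u v : TetrahedralAlgebra K m lam} (h : u * tσ = v * tβ)
    {Z : Ho K m lam} (f : regularHo K m lam ⟶ Z) :
    iT K m lam ≫ ofCokernel u v h ≫ f = 0 := by
  rw [← Category.assoc, iT_ofCokernel, Limits.zero_comp]

theorem leg3_pT : leg3 K m lam ≫ pT K m lam = 0 := by
  rw [leg3, Category.assoc, iT3_pT, Limits.comp_zero]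

theorem leg3_pT_assoc {Z : Ho K m lam} (f : regularHo K m lam ⟶ Z) :
    leg3 K m lam ≫ pT K m lam ≫ f = 0 := by
  rw [← Category.assoc, leg3_pT, Limits.zero_comp]

theorem leg4_pT : leg4 K m lam ≫ pT K m lam = 0 := by
  rw [leg4, Category.assoc, iT3_pT, Limits.comp_zero]

theorem leg4_pT_assoc {Z : Ho K m lam} (f : regularHo K m lam ⟶ Z) :
    leg4 K m lam ≫ pT K m lam ≫ f = 0 := by
  rw [← Category.assoc, leg4_pT, Limits.zero_comp]

theorem leg3_ofCokernel {u v : TetrahedralAlgebra K m lam} (h : u * tσ = v * tβ) :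
    leg3 K m lam ≫ ofCokernel u v h = J (u * e K m lam .v3) := by
  rw [leg3, ofCokernel, Category.assoc, iT3_pT3_assoc, ← Functor.map_comp, toDouble_fromDouble,
    pairHom_copairHom, mul_zero, add_zero, mul_one, J]

theorem leg3_ofCokernel_assoc {u v : TetrahedralAlgebra K m lam} (h : u * tσ = v * tβ)
    {Z : Ho K m lam} (f : regularHo K m lam ⟶ Z) :
    leg3 K m lam ≫ ofCokernel u v h ≫ f = J (u * e K m lam .v3) ≫ f := by
  rw [← Category.assoc, leg3_ofCokernel]

theorem leg4_ofCokernel {u v : TetrahedralAlgebra K m lam} (h : u * tσ = v * tβ) :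
    leg4 K m lam ≫ ofCokernel u v h = J (v * e K m lam .v4) := by
  rw [leg4, ofCokernel, Category.assoc, iT3_pT3_assoc, ← Functor.map_comp, toDouble_fromDouble,
    pairHom_copairHom, mul_zero, zero_add, mul_one, J]

theorem leg4_ofCokernel_assoc {u v : TetrahedralAlgebra K m lam} (h : u * tσ = v * tβ)
    {Z : Ho K m lam} (f : regularHo K m lam ⟶ Z) :
    leg4 K m lam ≫ ofCokernel u v h ≫ f = J (v * e K m lam .v4) ≫ f := by
  rw [← Category.assoc, leg4_ofCokernel]

/-- The difference factors through the differential of `T 3`, hence is null homotopic. This is the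
only relation that the homotopy category adds to the module maps used here. -/
theorem J_σ_leg3 : J tσ ≫ leg3 K m lam = J tβ ≫ leg4 K m lam := by
  rw [leg3, leg4, J, J, ← Category.assoc, ← Category.assoc, ← Functor.map_comp,
    ← Functor.map_comp, single_map_toDouble, single_map_toDouble, ← sub_eq_zero,
    ← Preadditive.sub_comp, ← Functor.map_sub, ← toDouble_sub, mulHom_pairHom_sub,
    (quotient_map_toDouble_eq_zero_iff _).2 ⟨-proj K m lam .v2, by simp⟩, Limits.zero_comp]

theorem J_e_leg3 : J (e K m lam .v3) ≫ leg3 K m lam = leg3 K m lam := by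
  rw [leg3, J, ← Category.assoc, ← Functor.map_comp, single_map_toDouble]
  rw [mulHom_e_pairHom]

theorem J_e_leg4 : J (e K m lam .v4) ≫ leg4 K m lam = leg4 K m lam := by
  rw [leg4, J, ← Category.assoc, ← Functor.map_comp, single_map_toDouble]
  rw [mulHom_e_pairHom']

/-- The source is in degree `0`, so the component in `T 3` is a pair of elements of `P 3` and `P 4`;
the other component is an element of Λ. -/
theorem exists_eq_of_regularHo_hom (f : regularHo K m lam ⟶ THo K m lam) :
    ∃ w u v, f = J w ≫ iT K m lam + J u ≫ leg3 K m lam + J v ≫ leg4 K m lam := by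
  obtain ⟨w, hw⟩ := exists_eq_J (f ≫ pT K m lam)
  obtain ⟨F, hF⟩ := (HomotopyCategory.quotient _ _).map_surjective (f ≫ pT3 K m lam)
  obtain ⟨φ, rfl⟩ := exists_eq_toDouble F
  obtain ⟨u, v, rfl⟩ := exists_eq_pairHom φ
  refine ⟨w, u, v, ?_⟩
  rw [← Category.comp_id f, ← pT_iT_add, Preadditive.comp_add, ← Category.assoc, ← Category.assoc,
    hw, ← hF, toDouble_add, Functor.map_add, Preadditive.add_comp, add_assoc, leg3, leg4, J, J, J,
    ← single_map_toDouble, ← single_map_toDouble, Functor.map_comp, Functor.map_comp,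
    Category.assoc, Category.assoc]

/-- A map from `T 3` to a stalk complex in degree `0` is determined by its restriction to `P 3 ⊕ P
4`, and between stalk complexes no homotopy intervenes. Equalities of maps `T → Λ` are therefore
checked on three test maps. -/
theorem eq_zero_of_THo_hom {g : THo K m lam ⟶ regularHo K m lam} (h : iT K m lam ≫ g = 0)
    (h3 : leg3 K m lam ≫ g = 0) (h4 : leg4 K m lam ≫ g = 0) : g = 0 := by
  obtain ⟨F, hF⟩ := (HomotopyCategory.quotient _ _).map_surjective (iT3 K m lam ≫ g)
  obtain ⟨ψ, hψ, rfl⟩ := exists_eq_fromDouble F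
  rw [leg3, Category.assoc, ← hF, ← Functor.map_comp, toDouble_fromDouble] at h3
  rw [leg4, Category.assoc, ← hF, ← Functor.map_comp, toDouble_fromDouble] at h4
  have h0 : ψ = 0 := hom_ext_pairHom
    ((quotient_map_single_map_eq_zero h3).trans Limits.comp_zero.symm)
    ((quotient_map_single_map_eq_zero h4).trans Limits.comp_zero.symm)
  have hF0 : iT3 K m lam ≫ g = 0 := by
    rw [← hF]
    subst h0
    rw [show fromDouble (dT3 K m lam) 0 hψ = 0 from double_hom_ext (by simp [fromDouble]),
      Functor.map_zero]
  rw [← Category.id_comp g, ← pT_iT_add, Preadditive.add_comp, Category.assoc, Category.assoc, h,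
    hF0, Limits.comp_zero, Limits.comp_zero, add_zero]

end TetrahedralAlgebra

end

/-! ### Endomorphisms of `T 3` that vanish on `P 3` and `P 4` -/

section

namespace TetrahedralAlgebra

open HomologicalComplex (single double)
open Polynomial (X)

variable {K : Type u} [Field K] {m : ℕ} {lam : K}

local notation "R" => Polynomial K
local notation "tβ" => arrow K m lam TArrow.β
local notation "tγ" => arrow K m lam TArrow.γ
local notation "tδ" => arrow K m lam TArrow.δ
local notation "tε" => arrow K m lam TArrow.ε
local notation "tξ" => arrow K m lam TArrow.ξ
local notation "tρ" => arrow K m lam TArrow.ρ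
local notation "tσ" => arrow K m lam TArrow.σ
local notation "tω" => arrow K m lam TArrow.ω

/-- `βεξ = vγδξ` is a multiple of the path between the opposite vertices `4` and `3`. -/
theorem βγδξ_pow (hm : 2 ≤ m) : tβ * ((X ^ (m - 1) : R) • (tε * tξ)) = 0 := by
  have h := X_pow_smul_pathTo_opp (K := K) (m := m) (lam := lam) .v4
  simp only [pathTo, Vertex.opp] at h
  rw [mul_smul_comm, mul_mul_of_mul_eq_smul (βε hm), smul_comm, h, smul_zero]

theorem σεξ : tσ * (tε * tξ) = (X : R) • e K m lam .v3 := by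
  rw [mul_mul_of_mul_eq σε, αδξ]

/-- Multiply by `εξ`: since `σεξ = X e 3`, the polynomial `fX` kills `e 3`, whose annihilator is
generated by `X^(m+1)`. -/
theorem X_pow_dvd_of_smul_arrow_eq_zero (hm : 2 ≤ m) {f : R} (h : f • tσ = 0) : X ^ m ∣ f := by
  have h3 : (f * X) • e K m lam .v3 = 0 := by
    rw [mul_smul, ← σεξ, ← smul_mul_assoc, h, zero_mul]
  have := X_pow_dvd_of_smul_eq_zero (X_pow_smul_e hm .v3) (X_pow_smul_e_ne_zero hm .v3) h3
  rw [pow_succ] at this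
  exact (mul_dvd_mul_iff_right Polynomial.X_ne_zero).1 this

theorem map_eq_map_e_mul {i : Vertex} {N : RightMod K m lam}
    (f : ModuleCat.of (TetrahedralAlgebra K m lam)ᵐᵒᵖ (P K m lam i) ⟶ N) (x : P K m lam i) :
    f.hom x = MulOpposite.op x.1 • f.hom ⟨e K m lam i, e K m lam i, e_mul_e K m lam i⟩ := by
  rw [← map_smul]
  exact congrArg _ (Subtype.ext (e_mul_of_mem x.2).symm)

theorem ofCokernel_leg3 {u v : TetrahedralAlgebra K m lam} (h : u * tσ = v * tβ) :
    ofCokernel u v h ≫ leg3 K m lam = pT3 K m lam ≫ (HomotopyCategory.quotient _ _).map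
      (endDouble (dT3 K m lam) 0 (copairHom u v ≫ pairHom 1 0)
        (by rw [← Category.assoc, dT3_copairHom h, Limits.zero_comp, Limits.zero_comp])) ≫
          iT3 K m lam := by
  rw [ofCokernel, leg3, Category.assoc, ← fromDouble_toDouble, Functor.map_comp, Category.assoc]

theorem copairHom_pairHom_fst (u v : TetrahedralAlgebra K m lam) (x) :
    ((copairHom u v ≫ pairHom 1 0).hom x).1.1 = e K m lam .v3 * (u * x.1.1 + v * x.2.1) := by
  rw [ModuleCat.hom_comp, LinearMap.comp_apply, pairHom_fst, one_mul, copairHom_apply]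

theorem copairHom_pairHom_snd (u v : TetrahedralAlgebra K m lam) (x) :
    ((copairHom u v ≫ pairHom 1 0).hom x).2.1 = 0 := by
  rw [ModuleCat.hom_comp, LinearMap.comp_apply, pairHom_snd, zero_mul, mul_zero]

theorem copairHom_neg (u : TetrahedralAlgebra K m lam) :
    copairHom (-u) 0 = -copairHom u 0 := by
  refine ModuleCat.hom_ext (LinearMap.ext fun x => ?_)
  rw [ModuleCat.hom_neg, LinearMap.neg_apply, copairHom_apply, copairHom_apply, zero_mul, add_zero,
    add_zero, neg_mul]

/-- The map `(x, y) ↦ p x` from `P 3 ⊕ P 4` to `P 2`. -/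
noncomputable def fstHom (p : TetrahedralAlgebra K m lam) :
    ModuleCat.of (TetrahedralAlgebra K m lam)ᵐᵒᵖ (P K m lam .v3 × P K m lam .v4) ⟶
      ModuleCat.of (TetrahedralAlgebra K m lam)ᵐᵒᵖ (P K m lam .v2) :=
  copairHom p 0 ≫ proj K m lam .v2

theorem fstHom_apply (p : TetrahedralAlgebra K m lam) (x) :
    ((fstHom p).hom x).1 = e K m lam .v2 * (p * x.1.1) := by
  change e K m lam .v2 * ((copairHom p 0).hom x) = _
  rw [copairHom_apply, zero_mul, add_zero]

theorem dT3_fstHom (hm : 2 ≤ m) (κ : K) (x) :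
    ((dT3 K m lam ≫ fstHom (-κ • (X ^ (m - 1) : R) • (tε * tξ))).hom x).1 =
      κ • (X ^ m : R) • x.1 := by
  rw [ModuleCat.hom_comp, LinearMap.comp_apply, fstHom_apply, dT3_fst]
  simp only [neg_smul, neg_mul_neg, smul_mul_assoc, mul_smul_comm, mul_assoc,
    mul_mul_of_eq_smul_e εξσ (e_mul_of_mem x.2), e_mul_of_mem x.2]
  rw [← mul_smul (X ^ (m - 1) : R), ← pow_succ, Nat.sub_add_cancel (by omega)]

/-- With `dT3_fstHom`: this map, taken as a homotopy, trades `κX^m` on `P 2` in degree `1` for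
`-κX^m` on `P 3` in degree `0`. Nothing appears on `P 4`, by `βγδξ_pow`. -/
theorem fstHom_dT3 (hm : 2 ≤ m) (κ : K) :
    fstHom (-κ • (X ^ (m - 1) : R) • (tε * tξ)) ≫ dT3 K m lam =
      copairHom (κ • (X ^ m : R) • e K m lam .v3) 0 ≫ pairHom 1 0 := by
  refine ModuleCat.hom_ext (LinearMap.ext fun x => Prod.ext (Subtype.ext ?_) (Subtype.ext ?_))
  · rw [copairHom_pairHom_fst, ModuleCat.hom_comp, LinearMap.comp_apply, dT3_fst, fstHom_apply,
      ← mul_assoc, σ_e, zero_mul, add_zero, ← mul_assoc, ← mul_assoc]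
    simp only [neg_smul, mul_neg, neg_mul, neg_neg, mul_smul_comm, smul_mul_assoc, σεξ, e_mul_e]
    rw [← mul_smul (X ^ (m - 1) : R), ← pow_succ, Nat.sub_add_cancel (by omega)]
  · rw [copairHom_pairHom_snd, ModuleCat.hom_comp, LinearMap.comp_apply, dT3_snd, fstHom_apply,
      ← mul_assoc, β_e, ← mul_assoc, mul_smul_comm, βγδξ_pow hm, smul_zero, zero_mul]

/-- Up to homotopy the only endomorphisms of `T` that vanish in degree `0` come from the kernel of
`P 2 → P 3 ⊕ P 4`. -/
theorem exists_eq_of_THo_end (hm : 2 ≤ m) {g : THo K m lam ⟶ THo K m lam}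
    (h : iT K m lam ≫ g = 0) (h3 : leg3 K m lam ≫ g = 0) (h4 : leg4 K m lam ≫ g = 0) :
    ∃ κ : K, ∀ H, g = ofCokernel (κ • (X ^ m : R) • e K m lam .v3) 0 H ≫ leg3 K m lam := by
  have hp : g ≫ pT K m lam = 0 := eq_zero_of_THo_hom
    (by rw [← Category.assoc, h, Limits.zero_comp]) (by rw [← Category.assoc, h3, Limits.zero_comp])
    (by rw [← Category.assoc, h4, Limits.zero_comp])
  obtain ⟨F, hF⟩ := (HomotopyCategory.quotient _ _).map_surjective
    (iT3 K m lam ≫ g ≫ pT3 K m lam)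
  obtain ⟨s, t, hst, rfl⟩ := exists_eq_endDouble F
  have hg : g = pT3 K m lam ≫ (iT3 K m lam ≫ g ≫ pT3 K m lam) ≫ iT3 K m lam := by
    have h1 : g = pT3 K m lam ≫ iT3 K m lam ≫ g := by
      conv_lhs => rw [← Category.id_comp g, ← pT_iT_add, Preadditive.add_comp, Category.assoc, h,
        Limits.comp_zero, zero_add, Category.assoc]
    have h2 : g = g ≫ pT3 K m lam ≫ iT3 K m lam := by
      conv_lhs => rw [← Category.comp_id g, ← pT_iT_add, Preadditive.comp_add, ← Category.assoc, hp,
        Limits.zero_comp, zero_add]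
    conv_lhs => rw [h1, h2]
    simp only [Category.assoc]
  have key {φ} (hφ : ((HomotopyCategory.quotient _ _).map (toDouble (dT3 K m lam) φ) ≫
      iT3 K m lam) ≫ g = 0) : ∃ k : regular K m lam ⟶ _, k ≫ dT3 K m lam = φ ≫ t := by
    rw [← quotient_map_toDouble_eq_zero_iff, ← toDouble_endDouble _ s t hst, Functor.map_comp, hF]
    simp only [← Category.assoc, hφ, Limits.zero_comp]
  obtain ⟨k3, hk3⟩ := key h3
  obtain ⟨k4, hk4⟩ := key h4
  -- Vanishing on each inclusion up to homotopy gives a lift of that component of `t` through the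
  -- differential; the two lifts are assembled into a homotopy that removes the part in degree `0`.
  let k : ModuleCat.of (TetrahedralAlgebra K m lam)ᵐᵒᵖ (P K m lam .v3 × P K m lam .v4) ⟶
      ModuleCat.of (TetrahedralAlgebra K m lam)ᵐᵒᵖ (P K m lam .v2) :=
    ModuleCat.ofHom ((k3.hom ∘ₗ (P K m lam .v3).subtype).coprod
      (k4.hom ∘ₗ (P K m lam .v4).subtype))
  have hk : k ≫ dT3 K m lam = t := by
    refine ModuleCat.hom_ext (LinearMap.ext fun x => ?_)
    change (dT3 K m lam).hom (k3.hom x.1.1 + k4.hom x.2.1) = t.hom x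
    conv_rhs => rw [eq_pairHom_add_pairHom x]
    rw [map_add, map_add]
    exact congrArg₂ _ (congrArg (fun f => f.hom x.1.1) hk3) (congrArg (fun f => f.hom x.2.1) hk4)
  -- The corrected map lives in degree `1` only and takes values in the kernel of the differential;
  -- it is left multiplication by some `z = f e 2` with `fσ = 0`.
  set s' := s - dT3 K m lam ≫ k with hs'
  have hs0 : s' ≫ dT3 K m lam = 0 := by
    rw [hs', Preadditive.sub_comp, hst, Category.assoc, hk, sub_self]
  set z := s'.hom ⟨e K m lam .v2, e K m lam .v2, e_mul_e K m lam .v2⟩ with hz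
  have hsz (x) : (s'.hom x).1 = z.1 * x.1 := by rw [map_eq_map_e_mul]; rfl
  have hze : e K m lam .v2 * z.1 * e K m lam .v2 = z.1 := by
    rw [e_mul_of_mem z.2]
    exact (hsz ⟨e K m lam .v2, e K m lam .v2, e_mul_e K m lam .v2⟩).symm
  obtain ⟨f, hf⟩ := exists_eq_smul_pathTo (lam := lam) hm .v2 .v2 z.1
  rw [hze] at hf
  have hσ : f • tσ = 0 := by
    have : -(tσ * z.1) = 0 := congrArg (fun φ => (φ.hom ⟨e K m lam .v2, e K m lam .v2, e_mul_e K m lam .v2⟩).1.1) hs0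
    rw [neg_eq_zero, hf] at this
    simpa only [pathTo, mul_smul_comm, σ_e] using this
  obtain ⟨f', rfl⟩ := X_pow_dvd_of_smul_arrow_eq_zero hm hσ
  -- Only the constant coefficient matters because `X^(m+1) e 2 = 0`.
  set κ := f'.coeff 0
  have hzκ : z.1 = κ • (X ^ m : R) • e K m lam .v2 := by
    rw [hf, ← Polynomial.divX_mul_X_add f', mul_add, add_smul, mul_left_comm, ← pow_succ, mul_smul]
    simp only [pathTo]
    rw [X_pow_smul_e hm, smul_zero, zero_add, mul_comm, mul_smul, ← Polynomial.algebraMap_eq,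
      algebraMap_smul]
  refine ⟨-κ, fun H => ?_⟩
  rw [hg, ofCokernel_leg3, ← hF]
  congr 2
  rw [← sub_eq_zero, ← Functor.map_sub, ← endDouble_sub, quotient_map_endDouble_eq_zero_iff]
  refine ⟨k + fstHom (-κ • (X ^ (m - 1) : R) • (tε * tξ)), ?_, ?_⟩
  · rw [sub_zero, Preadditive.comp_add, ← sub_eq_iff_eq_add', ← hs']
    refine ModuleCat.hom_ext (LinearMap.ext fun x => Subtype.ext ?_)
    rw [hsz, dT3_fstHom hm, hzκ, smul_mul_assoc, smul_mul_assoc, e_mul_of_mem x.2]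
  · rw [Preadditive.add_comp, hk, fstHom_dT3 hm, sub_eq_add_neg, neg_smul, copairHom_neg,
      Preadditive.neg_comp, neg_neg]

/-- Suppose a homotopy has components `p = fεξ` and `q = gρω`. In degree `0` it gives `-σp = X^m e
3` and `βq = 0`, so `fX ≡ -X^m` and `gX ≡ 0` modulo `X^(m+1)`. In degree `1` it gives `pσ = qβ`,
that is `fX e 2 = gX e 2`, and then `X^m e 2 = 0`, which is false. -/
theorem ofCokernel_leg3_ne_zero (hm : 2 ≤ m)
    (H : (X ^ m : R) • e K m lam .v3 * tσ = 0 * tβ) :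
    ofCokernel ((X ^ m : R) • e K m lam .v3) 0 H ≫ leg3 K m lam ≠ 0 := by
  intro h0
  rw [ofCokernel_leg3] at h0
  have h1 := congrArg (fun f => iT3 K m lam ≫ f ≫ pT3 K m lam) h0
  simp only [Category.assoc, iT3_pT3, iT3_pT3_assoc, Limits.comp_zero, Limits.zero_comp,
    Category.comp_id] at h1
  obtain ⟨h, hd, hh⟩ := (quotient_map_endDouble_eq_zero_iff _).1 h1
  set p := pairHom 1 0 ≫ h ≫ incl K m lam .v2 with hp
  set q := pairHom 0 1 ≫ h ≫ incl K m lam .v2 with hq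
  have hpi (x) : p.hom x = p.hom 1 * x := by rw [exists_eq_mulHom p]; simp [mulHom]
  have hqi (x) : q.hom x = q.hom 1 * x := by rw [exists_eq_mulHom q]; simp [mulHom]
  have hp3 : p.hom 1 * e K m lam .v3 = p.hom 1 := by
    have := congrArg (fun f => (f ≫ h ≫ incl K m lam .v2).hom 1) (mulHom_e_pairHom (K := K) (m := m) (lam := lam))
    rw [← hpi]
    simpa [mulHom, hp] using this
  have hq4 : q.hom 1 * e K m lam .v4 = q.hom 1 := by
    have := congrArg (fun f => (f ≫ h ≫ incl K m lam .v2).hom 1) (mulHom_e_pairHom' (K := K) (m := m) (lam := lam))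
    rw [← hqi]
    simpa [mulHom, hq] using this
  have hp2 : e K m lam .v2 * p.hom 1 = p.hom 1 := e_mul_of_mem (h.hom _).2
  have hq2 : e K m lam .v2 * q.hom 1 = q.hom 1 := e_mul_of_mem (h.hom _).2
  have hσp : -(tσ * p.hom 1) = (X ^ m : R) • e K m lam .v3 := by
    have := congrArg (fun f => (f.hom ((pairHom 1 0).hom 1)).1.1) hh
    refine this.symm.trans ?_
    rw [copairHom_pairHom_fst, pairHom_fst, pairHom_snd]
    simp [e_mul_e]
  have hβq : tβ * q.hom 1 = 0 := by
    have := congrArg (fun f => (f.hom ((pairHom 0 1).hom 1)).2.1) hh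
    refine this.symm.trans ?_
    rw [copairHom_pairHom_snd]
  have hpq : q.hom 1 * tβ = p.hom 1 * tσ := by
    let y : P K m lam .v2 := ⟨e K m lam .v2, e K m lam .v2, e_mul_e K m lam .v2⟩
    have := congrArg (fun f => (f.hom y).1) hd
    have h2 : (h.hom ((dT3 K m lam).hom y)).1 = 0 := this.symm
    rw [eq_pairHom_add_pairHom ((dT3 K m lam).hom y), map_add] at h2
    have h3 : p.hom (-(tσ * e K m lam .v2)) + q.hom (tβ * e K m lam .v2) = 0 := h2
    rw [hpi, hqi, σ_e, β_e, mul_neg] at h3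
    rwa [neg_add_eq_zero, eq_comm] at h3
  obtain ⟨f, hf⟩ := exists_eq_smul_pathTo (lam := lam) hm .v2 .v3 (p.hom 1)
  obtain ⟨g, hg⟩ := exists_eq_smul_pathTo (lam := lam) hm .v2 .v4 (q.hom 1)
  rw [hp2, hp3] at hf
  rw [hq2, hq4] at hg
  simp only [pathTo] at hf hg
  rw [hf, mul_smul_comm, σεξ, eq_comm, ← add_eq_zero_iff_eq_neg, ← mul_smul, ← add_smul] at hσp
  have hXf := X_pow_dvd_of_smul_eq_zero (X_pow_smul_e hm .v3) (X_pow_smul_e_ne_zero hm .v3) hσp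
  rw [hg, mul_smul_comm, mul_mul_of_mul_eq βρ, ← δη, γδη, ← mul_smul] at hβq
  have hXg := X_pow_dvd_of_smul_eq_zero (X_pow_smul_e hm .v4) (X_pow_smul_e_ne_zero hm .v4) hβq
  rw [hf, hg, smul_mul_assoc, smul_mul_assoc, mul_assoc, mul_assoc, εξσ, ρωβ, ← mul_smul,
    ← mul_smul] at hpq
  obtain ⟨a, ha⟩ := hXf
  obtain ⟨b, hb⟩ := hXg
  rw [hb, mul_comm, mul_smul, X_pow_smul_e hm, smul_zero, ← add_sub_cancel_left (X ^ m) (f * X), ha,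
    sub_smul, mul_comm, mul_smul, X_pow_smul_e hm, smul_zero, zero_sub, zero_eq_neg] at hpq
  exact X_pow_smul_e_ne_zero hm .v2 hpq

end TetrahedralAlgebra

end

/-! ### Generators of `e i S e j` over `K[X]` and their annihilators -/

section

namespace SphericalAlgebra

open Polynomial
open TetrahedralAlgebra (uPoly vPoly vPoly_smul_uPoly_smul mul_mul_of_mul_eq_smul)

variable {K : Type u} [Field K] {m : ℕ} {lam : K}

local notation "sα" => arrow K m lam SArrow.α
local notation "sβ" => arrow K m lam SArrow.β
local notation "sγ" => arrow K m lam SArrow.γ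
local notation "sδ" => arrow K m lam SArrow.δ
local notation "sν" => arrow K m lam SArrow.ν
local notation "sρ" => arrow K m lam SArrow.ρ
local notation "sσ" => arrow K m lam SArrow.σ
local notation "sω" => arrow K m lam SArrow.ω

theorem arrow_mul_e_of_ne {a : SArrow} {i : Vertex} (h : a.target ≠ i) :
    arrow K m lam a * e K m lam i = 0 := by
  rw [← arrow_mul_e, mul_assoc, e_mul_e_of_ne K m lam h, mul_zero]

theorem eq_vPoly_smul {x y : SphericalAlgebra K m lam} (hm : 2 ≤ m) (a : SArrow)
    (h : x = uPoly m lam • (arrow K m lam a * y)) (ha : (X ^ m : K[X]) • arrow K m lam a = 0) :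
    arrow K m lam a * y = vPoly m lam • x := by
  rw [h, vPoly_smul_uPoly_smul hm]
  rw [← smul_mul_assoc, ha, zero_mul]

theorem αβγ (hm : 2 ≤ m) : sα * (sβ * sγ) = vPoly m lam • (sρ * (sω * sγ)) :=
  eq_vPoly_smul hm .α (ρωγ hm) (X_pow_smul_α hm)

theorem γσα (hm : 2 ≤ m) : sγ * (sσ * sα) = vPoly m lam • (sν * (sδ * sα)) :=
  eq_vPoly_smul hm .γ (νδα hm) (X_pow_smul_γ hm)

theorem βγσ (hm : 2 ≤ m) (hlam : lam ≠ 0) :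
    sβ * (sγ * sσ) = vPoly m lam • (sβ * (sν * sδ)) :=
  eq_vPoly_smul hm .β (βνδ hm) (X_pow_smul_arrow hm hlam .β)

theorem σαβ (hm : 2 ≤ m) (hlam : lam ≠ 0) :
    sσ * (sα * sβ) = vPoly m lam • (sσ * (sρ * sω)) :=
  eq_vPoly_smul hm .σ (σρω hm) (X_pow_smul_arrow hm hlam .σ)

theorem ρωνδ_eq : sρ * (sω * (sν * sδ)) = (X : K[X]) • e K m lam .v1 := by
  rw [X_smul_e, ρωνδ]
theorem βνδα_eq : sβ * (sν * (sδ * sα)) = (X : K[X]) • e K m lam .v2 := by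
  rw [X_smul_e]; rfl
theorem νδρω_eq : sν * (sδ * (sρ * sω)) = (X : K[X]) • e K m lam .v3 := by
  rw [X_smul_e, νδρω]
theorem σρωγ_eq : sσ * (sρ * (sω * sγ)) = (X : K[X]) • e K m lam .v4 := by
  rw [X_smul_e]; rfl
theorem δρων_eq : sδ * (sρ * (sω * sν)) = (X : K[X]) • e K m lam .v5 := by
  rw [X_smul_e, loop, αβν]
theorem ωνδρ_eq : sω * (sν * (sδ * sρ)) = (X : K[X]) • e K m lam .v6 := by
  rw [X_smul_e]; rfl

theorem mul_mul_mul_of_eq_smul {R A : Type*} [CommSemiring R] [Semiring A] [Algebra R A]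
    {r : R} {a b c d e : A} (h : a * (b * (c * d)) = r • e) (x : A) :
    a * (b * (c * (d * x))) = r • (e * x) := by
  rw [← mul_assoc c, ← mul_assoc b, ← mul_assoc a, h, smul_mul_assoc]

theorem e_mul_mul {A : Type*} [Semigroup A] {a b : A} (h : a * b = b) (x : A) :
    a * (b * x) = b * x := by
  rw [← mul_assoc, h]

theorem smul_eq_smul_add_zero_smul {R M : Type*} [Semiring R] [AddCommMonoid M] [Module R M]
    (r : R) (x y : M) : r • x = r • x + (0 : R) • y := by
  rw [zero_smul, add_zero]

variable (K m lam) in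
/-- A path from `i` to `j`. -/
noncomputable def wordTo : Vertex → Vertex → SphericalAlgebra K m lam
  | .v1, .v1 => e K m lam .v1
  | .v1, .v2 => sα
  | .v1, .v3 => sρ * sω
  | .v1, .v4 => sρ * (sω * sγ)
  | .v1, .v5 => sρ * (sω * sν)
  | .v1, .v6 => sρ
  | .v2, .v1 => sβ * (sν * sδ)
  | .v2, .v2 => e K m lam .v2
  | .v2, .v3 => sβ
  | .v2, .v4 => sβ * sγ
  | .v2, .v5 => sβ * sν
  | .v2, .v6 => sβ * (sν * (sδ * sρ))
  | .v3, .v1 => sν * sδ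
  | .v3, .v2 => sν * (sδ * sα)
  | .v3, .v3 => e K m lam .v3
  | .v3, .v4 => sγ
  | .v3, .v5 => sν
  | .v3, .v6 => sν * (sδ * sρ)
  | .v4, .v1 => sσ
  | .v4, .v2 => sσ * sα
  | .v4, .v3 => sσ * (sρ * sω)
  | .v4, .v4 => e K m lam .v4
  | .v4, .v5 => sσ * (sρ * (sω * sν))
  | .v4, .v6 => sσ * sρ
  | .v5, .v1 => sδ
  | .v5, .v2 => sδ * sα
  | .v5, .v3 => sδ * (sρ * sω)
  | .v5, .v4 => sδ * (sρ * (sω * sγ))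
  | .v5, .v5 => e K m lam .v5
  | .v5, .v6 => sδ * sρ
  | .v6, .v1 => sω * (sν * sδ)
  | .v6, .v2 => sω * (sν * (sδ * sα))
  | .v6, .v3 => sω
  | .v6, .v4 => sω * sγ
  | .v6, .v5 => sω * sν
  | .v6, .v6 => e K m lam .v6

variable (K m lam) in
/-- A path from `i` to `j` that generates `e i S e j` together with `wordTo i j`. -/
noncomputable def wordTo' : Vertex → Vertex → SphericalAlgebra K m lam
  | .v1, .v3 => sα * sβ
  | .v3, .v1 => sγ * sσ
  | i, j => wordTo K m lam i j

theorem wordTo_self (i : Vertex) : wordTo K m lam i i = e K m lam i := by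
  cases i <;> rfl

set_option linter.unusedSimpArgs false in
theorem wordTo_mul_arrow (hm : 2 ≤ m) (hlam : lam ≠ 0) (i : Vertex) (a : SArrow) : ∃ f g : K[X],
    wordTo K m lam i a.source * arrow K m lam a =
      f • wordTo K m lam i a.target + g • wordTo' K m lam i a.target := by
  cases a <;> cases i <;>
  simp only [wordTo, wordTo', SArrow.source, SArrow.target, mul_assoc, e_α, e_β, e_γ, e_δ, e_ν, e_ρ, e_σ,
    e_ω, α_e, β_e, γ_e, δ_e, ν_e, ρ_e, σ_e, ω_e, mul_smul_comm, smul_mul_assoc, smul_smul,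
    αβγ hm, γσα hm, βγσ hm hlam, σαβ hm hlam, αβν, γσρ, δαβ, ωγσ,
    ρωνδ_eq, βνδα_eq, νδρω_eq, σρωγ_eq, δρων_eq, ωνδρ_eq] <;>
  first
    | (refine ⟨1, 0, ?_⟩; rw [one_smul, zero_smul, add_zero]; done)
    | (refine ⟨0, 1, ?_⟩; rw [one_smul, zero_smul, zero_add]; done)
    | exact ⟨_, 0, smul_eq_smul_add_zero_smul _ _ _⟩

set_option linter.unusedSimpArgs false in
theorem wordTo'_mul_arrow (hm : 2 ≤ m) (hlam : lam ≠ 0) (i : Vertex) (a : SArrow) : ∃ f g : K[X],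
    wordTo' K m lam i a.source * arrow K m lam a =
      f • wordTo K m lam i a.target + g • wordTo' K m lam i a.target := by
  have key : ∀ j, wordTo' K m lam i j = wordTo K m lam i j ∨
      i = .v1 ∧ j = .v3 ∨ i = .v3 ∧ j = .v1 := by
    intro j
    cases i <;> cases j <;> first | exact .inl rfl | exact .inr (by decide)
  obtain h | ⟨rfl, h⟩ | ⟨rfl, h⟩ := key a.source
  · rw [h]
    exact wordTo_mul_arrow hm hlam i a
  · cases a <;> cases h <;>
    simp only [wordTo, wordTo', SArrow.source, SArrow.target, mul_assoc, αβγ hm, αβν] <;>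
    first
      | (refine ⟨1, 0, ?_⟩; rw [one_smul, zero_smul, add_zero]; done)
      | exact ⟨_, 0, smul_eq_smul_add_zero_smul _ _ _⟩
  · cases a <;> cases h <;>
    simp only [wordTo, wordTo', SArrow.source, SArrow.target, mul_assoc, γσα hm, γσρ] <;>
    first
      | (refine ⟨1, 0, ?_⟩; rw [one_smul, zero_smul, add_zero]; done)
      | exact ⟨_, 0, smul_eq_smul_add_zero_smul _ _ _⟩

theorem exists_eq_smul_add_smul (hm : 2 ≤ m) (hlam : lam ≠ 0) (i j : Vertex)
    (x : SphericalAlgebra K m lam) : ∃ f g : K[X],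
      e K m lam i * x * e K m lam j = f • wordTo K m lam i j + g • wordTo' K m lam i j := by
  let M (i j : Vertex) : Submodule K (SphericalAlgebra K m lam) :=
    ((Submodule.span K[X] {wordTo K m lam i j, wordTo' K m lam i j}).restrictScalars K).comap
      (LinearMap.mulLeftRight K (e K m lam i, e K m lam j))
  have hM (i j : Vertex) (x) : x ∈ M i j ↔ ∃ f g : K[X],
      e K m lam i * x * e K m lam j = f • wordTo K m lam i j + g • wordTo' K m lam i j := by
    simp only [M, Submodule.mem_comap, LinearMap.mulLeftRight_apply,
      Submodule.restrictScalars_mem, Submodule.mem_span_pair, eq_comm]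
  rw [← hM]
  suffices h : x ∈ ⨅ i, ⨅ j, M i j by
    simp only [Submodule.mem_iInf] at h
    exact h i j
  refine mem_of_mul_mem _ ?_ ?_ ?_ x
  · simp only [Submodule.mem_iInf, hM]
    intro i j
    by_cases h : i = j
    · subst h
      exact ⟨1, 0, by rw [mul_one, e_mul_e, wordTo_self, one_smul, zero_smul, add_zero]⟩
    · exact ⟨0, 0, by rw [mul_one, e_mul_e_of_ne K m lam h, zero_smul, zero_smul, add_zero]⟩
  · simp only [Submodule.mem_iInf, hM]
    intro x hx k i j
    by_cases h : k = j
    · subst h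
      obtain ⟨f, g, hf⟩ := hx i k
      exact ⟨f, g, by rw [← hf, mul_assoc, mul_assoc, e_mul_e, mul_assoc]⟩
    · exact ⟨0, 0, by rw [mul_assoc, mul_assoc, e_mul_e_of_ne K m lam h, mul_zero, mul_zero,
        zero_smul, zero_smul, add_zero]⟩
  · simp only [Submodule.mem_iInf, hM]
    intro x hx a i j
    by_cases h : a.target = j
    · subst h
      obtain ⟨f, g, hf⟩ := hx i a.source
      obtain ⟨p, q, hp⟩ := wordTo_mul_arrow (lam := lam) hm hlam i a
      obtain ⟨p', q', hp'⟩ := wordTo'_mul_arrow (lam := lam) hm hlam i a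
      refine ⟨f * p + g * p', f * q + g * q', ?_⟩
      have h1 : e K m lam i * (x * arrow K m lam a) * e K m lam a.target =
          e K m lam i * x * e K m lam a.source * arrow K m lam a := by
        simp only [mul_assoc, arrow_mul_e, e_mul_arrow]
      rw [h1, hf, add_mul, smul_mul_assoc, smul_mul_assoc, hp, hp']
      simp only [smul_add, add_smul, mul_smul]
      abel
    · exact ⟨0, 0, by rw [mul_assoc, mul_assoc, arrow_mul_e_of_ne h, mul_zero, mul_zero, zero_smul,
        zero_smul, add_zero]⟩

/-- The exponent `n` such that the element `wordTo i j` generates `K[X] / X ^ (m + 1 - n)`. -/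
def coexpo : Vertex → Vertex → ℕ
  | .v2, .v6 => 2
  | .v6, .v2 => 2
  | .v4, .v5 => 2
  | .v5, .v4 => 2
  | i, j => if i = j then 0 else 1

set_option linter.unusedSimpArgs false in
-- Reduces annihilators of paths to those of the idempotents: the way there and back is a power of
-- `X` up to powers of `v`, and `v` is invertible modulo powers of `X`. The exponent is `2` for the
-- pairs joined only by paths of length four.
theorem wordTo_mul_wordTo (hm : 2 ≤ m) (i j : Vertex) : ∃ a,
    wordTo K m lam i j * wordTo K m lam j i =
      (X ^ coexpo i j * vPoly m lam ^ a) • e K m lam i := by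
  cases i <;> cases j <;>
  simp only [wordTo, coexpo, mul_assoc, e_mul_e, mul_smul_comm, smul_mul_assoc, smul_smul, αβγ hm,
    γσα hm, αβν, γσρ, δαβ, ωγσ,
    mul_mul_mul_of_eq αβν, mul_mul_mul_of_eq γσρ, mul_mul_mul_of_eq δαβ, mul_mul_mul_of_eq ωγσ,
    ρωνδ_eq, βνδα_eq, νδρω_eq, σρωγ_eq, δρων_eq, ωνδρ_eq, mul_mul_mul_of_eq_smul ρωνδ_eq,
    mul_mul_mul_of_eq_smul νδρω_eq, e_ν, e_α, e_γ, ν_e, ρ_e, e_mul_mul e_ρ, e_mul_mul e_ν, pow_one, pow_zero] <;>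
  first
    | (refine ⟨0, ?_⟩; simp [pow_two]; done)
    | (refine ⟨1, ?_⟩; simp [mul_comm])

theorem X_pow_smul_e (hm : 2 ≤ m) (hlam : lam ≠ 0) (i : Vertex) :
    (X ^ (m + 1) : K[X]) • e K m lam i = 0 := by
  rw [pow_succ, mul_smul, X_smul_e]
  cases i <;>
  · simp only [loop]
    rw [← smul_mul_assoc, X_pow_smul_arrow hm hlam, zero_mul]

/-- A path that starts with an arrow is killed by `X^m`; the four paths of length four are killed
already by `X^(m-1)`, which rests on `λ ≠ 0`. -/
theorem X_pow_smul_wordTo (hm : 2 ≤ m) (hlam : lam ≠ 0) (i j : Vertex) :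
    (X ^ (m + 1 - coexpo i j) : K[X]) • wordTo K m lam i j = 0 := by
  have hβ := X_pow_smul_βγσρ (lam := lam) hm hlam
  have hσ := X_pow_smul_σαβν (lam := lam) hm hlam
  have hδ := X_pow_smul_δαβγ (lam := lam) hm hlam
  have hω := X_pow_smul_ωγσα (lam := lam) hm hlam
  rw [γσρ] at hβ
  rw [αβν] at hσ
  rw [mul_mul_mul_of_eq δαβ] at hδ
  rw [mul_mul_mul_of_eq ωγσ] at hω
  cases i <;> cases j <;> first
    | assumption
    | exact X_pow_smul_e hm hlam _
    | exact X_pow_smul_arrow hm hlam _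
    | (simp only [wordTo]; exact (smul_mul_assoc _ _ _).symm.trans
        (by erw [X_pow_smul_arrow hm hlam, zero_mul]))

end SphericalAlgebra

end

/-! ### Block matrices for endomorphisms of `T` -/

section

namespace TetrahedralAlgebra

open Polynomial (X C)

variable {K : Type u} [Field K] {m : ℕ} {lam : K}

local notation "R" => Polynomial K
local notation "tα" => arrow K m lam TArrow.α
local notation "tβ" => arrow K m lam TArrow.β
local notation "tγ" => arrow K m lam TArrow.γ
local notation "tδ" => arrow K m lam TArrow.δ
local notation "tε" => arrow K m lam TArrow.ε
local notation "tη" => arrow K m lam TArrow.η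
local notation "tμ" => arrow K m lam TArrow.μ
local notation "tν" => arrow K m lam TArrow.ν
local notation "tξ" => arrow K m lam TArrow.ξ
local notation "tρ" => arrow K m lam TArrow.ρ
local notation "tσ" => arrow K m lam TArrow.σ
local notation "tω" => arrow K m lam TArrow.ω

theorem ofCokernel_J {u v : TetrahedralAlgebra K m lam} (h : u * tσ = v * tβ)
    (x : TetrahedralAlgebra K m lam) : ofCokernel u v h ≫ J x =
      ofCokernel (x * u) (x * v) (by rw [mul_assoc, h, mul_assoc]) := by
  rw [← sub_eq_zero]
  apply eq_zero_of_THo_hom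
  · rw [Preadditive.comp_sub, iT_ofCokernel_assoc, iT_ofCokernel, sub_zero]
  · rw [Preadditive.comp_sub, leg3_ofCokernel_assoc, leg3_ofCokernel, ← J_mul, mul_assoc, sub_self]
  · rw [Preadditive.comp_sub, leg4_ofCokernel_assoc, leg4_ofCokernel, ← J_mul, mul_assoc, sub_self]

theorem ofCokernel_congr {u v u' v' : TetrahedralAlgebra K m lam} (hu : u = u') (hv : v = v')
    (h : u * tσ = v * tβ) (h' : u' * tσ = v' * tβ) : ofCokernel u v h = ofCokernel u' v' h' := by
  subst hu hv
  rfl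

theorem ofCokernel_add {u v u' v' : TetrahedralAlgebra K m lam} (h : u * tσ = v * tβ)
    (h' : u' * tσ = v' * tβ) : ofCokernel u v h + ofCokernel u' v' h' =
      ofCokernel (u + u') (v + v') (by rw [add_mul, add_mul, h, h']) := by
  rw [← sub_eq_zero]
  apply eq_zero_of_THo_hom
  · rw [Preadditive.comp_sub, Preadditive.comp_add, iT_ofCokernel, iT_ofCokernel, iT_ofCokernel,
      add_zero, sub_zero]
  · rw [Preadditive.comp_sub, Preadditive.comp_add, leg3_ofCokernel, leg3_ofCokernel,
      leg3_ofCokernel, ← J_add, add_mul, sub_self]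
  · rw [Preadditive.comp_sub, Preadditive.comp_add, leg4_ofCokernel, leg4_ofCokernel,
      leg4_ofCokernel, ← J_add, add_mul, sub_self]

theorem ofCokernel_smul {u v : TetrahedralAlgebra K m lam} (h : u * tσ = v * tβ) (k : K) :
    k • ofCokernel u v h = ofCokernel (k • u) (k • v)
      (by rw [smul_mul_assoc, smul_mul_assoc, h]) := by
  rw [← sub_eq_zero]
  apply eq_zero_of_THo_hom
  · rw [Preadditive.comp_sub, Linear.comp_smul, iT_ofCokernel, iT_ofCokernel, smul_zero, sub_zero]
  · rw [Preadditive.comp_sub, Linear.comp_smul, leg3_ofCokernel, leg3_ofCokernel, ← J_smul,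
      smul_mul_assoc, sub_self]
  · rw [Preadditive.comp_sub, Linear.comp_smul, leg4_ofCokernel, leg4_ofCokernel, ← J_smul,
      smul_mul_assoc, sub_self]

/-- An element of `Λ` as an endomorphism of the summands of `T` in degree `0`. -/
noncomputable def corner (x : TetrahedralAlgebra K m lam) : End (THo K m lam) :=
  pT K m lam ≫ J x ≫ iT K m lam

/-- A map to `T 3` from the summands of `T` in degree `0`. -/
noncomputable def row (u v : TetrahedralAlgebra K m lam) : End (THo K m lam) :=
  pT K m lam ≫ (J u ≫ leg3 K m lam + J v ≫ leg4 K m lam)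

/-- A map from `T 3` to the summands of `T` in degree `0`. -/
noncomputable def col (u v : TetrahedralAlgebra K m lam) (h : u * tσ = v * tβ) :
    End (THo K m lam) :=
  ofCokernel u v h ≫ iT K m lam

theorem corner_add (x y : TetrahedralAlgebra K m lam) :
    corner (x + y) = corner x + corner y := by
  simp only [corner, J_add, Preadditive.add_comp, Preadditive.comp_add]

theorem corner_smul (k : K) (x : TetrahedralAlgebra K m lam) :
    corner (k • x) = k • corner x := by
  simp only [corner, J_smul, Linear.smul_comp, Linear.comp_smul]

theorem corner_zero : corner (0 : TetrahedralAlgebra K m lam) = 0 := by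
  simp only [corner, J_zero, Limits.zero_comp, Limits.comp_zero]

theorem row_add (u v u' v' : TetrahedralAlgebra K m lam) :
    row (u + u') (v + v') = row u v + row u' v' := by
  simp only [row, J_add, Preadditive.add_comp, Preadditive.comp_add]
  abel

theorem row_smul (k : K) (u v : TetrahedralAlgebra K m lam) :
    row (k • u) (k • v) = k • row u v := by
  simp only [row, J_smul, Linear.smul_comp, Linear.comp_smul, Preadditive.comp_add, smul_add]

/-- The homotopy relation `J_σ_leg3` in matrix form. -/
theorem row_σ_mul (x : TetrahedralAlgebra K m lam) : row (tσ * x) 0 = row 0 (tβ * x) := by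
  simp only [row, J_zero, Limits.zero_comp, add_zero, zero_add, J_mul, Category.assoc, J_σ_leg3]

theorem row_zero : row 0 (0 : TetrahedralAlgebra K m lam) = 0 := by
  simp only [row, J_zero, Limits.zero_comp, Limits.comp_zero, add_zero]

/-- Composition inserts `1 - e 2` between the factors; the hypothesis absorbs it. -/
theorem corner_mul_corner {x : TetrahedralAlgebra K m lam} (hx : x * e K m lam .v2 = 0)
    (y : TetrahedralAlgebra K m lam) : corner x * corner y = corner (x * y) := by
  rw [End.mul_def, corner, corner, corner]
  simp only [Category.assoc, iT_pT_assoc]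
  rw [← Category.assoc (J (1 - _)), ← J_mul, mul_sub, hx, mul_one, sub_zero, J_mul, Category.assoc]

theorem row_mul_corner {u v : TetrahedralAlgebra K m lam} (hu : u * e K m lam .v2 = 0)
    (hv : v * e K m lam .v2 = 0) (x : TetrahedralAlgebra K m lam) :
    row u v * corner x = row (u * x) (v * x) := by
  rw [End.mul_def, corner, row, row]
  simp only [Category.assoc, iT_pT_assoc, Preadditive.comp_add]
  simp only [← Category.assoc (J (1 - _)), ← J_mul, mul_sub, hu, hv, mul_one, sub_zero]
  simp only [J_mul, Category.assoc]

theorem corner_mul_col {x : TetrahedralAlgebra K m lam} (hx : x * e K m lam .v2 = 0)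
    {u v : TetrahedralAlgebra K m lam} (h : u * tσ = v * tβ) :
    corner x * col u v h = col (x * u) (x * v) (by rw [mul_assoc, h, mul_assoc]) := by
  rw [End.mul_def, corner, col, col]
  simp only [Category.assoc, iT_pT_assoc]
  rw [← Category.assoc (J (1 - _)), ← J_mul, mul_sub, hx, mul_one, sub_zero, ← Category.assoc,
    ofCokernel_J]

theorem col_mul_row {u v : TetrahedralAlgebra K m lam} (h : u * tσ = v * tβ)
    (u' v' : TetrahedralAlgebra K m lam) :
    col u v h * row u' v' = corner (u * e K m lam .v3 * u' + v * e K m lam .v4 * v') := by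
  rw [End.mul_def, corner, row, col]
  simp only [Preadditive.comp_add, Preadditive.add_comp, Category.assoc, leg3_ofCokernel_assoc,
    leg4_ofCokernel_assoc, J_add, J_mul]

theorem corner_mul_row (x u v : TetrahedralAlgebra K m lam) : corner x * row u v = 0 := by
  rw [End.mul_def, corner, row]
  simp only [Preadditive.comp_add, Preadditive.add_comp, Category.assoc, leg3_pT_assoc,
    leg4_pT_assoc, Limits.comp_zero, add_zero]

theorem col_mul_corner {u v : TetrahedralAlgebra K m lam} (h : u * tσ = v * tβ)
    (x : TetrahedralAlgebra K m lam) : col u v h * corner x = 0 := by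
  rw [End.mul_def, corner, col]
  simp only [Category.assoc, iT_ofCokernel_assoc, Limits.comp_zero]

theorem J_sub_iT : J (1 - e K m lam .v2) ≫ iT K m lam = iT K m lam := by
  conv_rhs => rw [← Category.comp_id (iT K m lam), ← pT_iT_add, Preadditive.comp_add, iT_pT3_assoc,
    add_zero, iT_pT_assoc]

/-- Hence `corner 1` is the idempotent of all summands of `T` in degree `0`, and `1 - corner 1` that
of `T 3`. -/
theorem corner_e_v2 : corner (e K m lam .v2) = 0 := by
  have h := J_sub_iT (K := K) (m := m) (lam := lam)
  rw [J_sub, Preadditive.sub_comp, J_one, Category.id_comp, sub_eq_self] at h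
  rw [corner, h, Limits.comp_zero]

theorem corner_one_mul {x : TetrahedralAlgebra K m lam} (hx : e K m lam .v2 * x = 0) :
    corner 1 * corner x = corner x := by
  rw [show corner (1 : TetrahedralAlgebra K m lam) = corner (1 - e K m lam .v2) by
      rw [sub_eq_add_neg, corner_add, ← neg_one_smul K (e K m lam .v2), corner_smul, corner_e_v2,
        smul_zero, add_zero],
    corner_mul_corner (by rw [sub_mul, one_mul, e_mul_e, sub_self]), sub_mul, hx, one_mul, sub_zero]

theorem mul_corner_one {x : TetrahedralAlgebra K m lam} (hx : x * e K m lam .v2 = 0) :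
    corner x * corner 1 = corner x := by
  rw [corner_mul_corner hx, mul_one]

theorem smul_e_mul_e_v2 {i : Vertex} (hi : i ≠ .v2) (f : R) :
    f • e K m lam i * e K m lam .v2 = 0 := by
  rw [smul_mul_assoc, e_mul_e_of_ne K m lam hi, smul_zero]

theorem corner_pow_mul_corner {i : Vertex} (hi : i ≠ .v2) {x : TetrahedralAlgebra K m lam}
    (hx : e K m lam i * x = x) (f : R) (n : ℕ) :
    corner (f • e K m lam i) ^ n * corner x = corner (f ^ n • x) := by
  induction n with
  | zero => rw [pow_zero, one_mul, pow_zero, one_smul]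
  | succ n ih =>
    rw [pow_succ', mul_assoc, ih, corner_mul_corner (smul_e_mul_e_v2 hi f), smul_mul_assoc,
      mul_smul_comm, hx, pow_succ', mul_smul]

theorem corner_pow_mul_col {i : Vertex} (hi : i ≠ .v2) {u v : TetrahedralAlgebra K m lam}
    (h : u * tσ = v * tβ) (hu : e K m lam i * u = u) (hv : e K m lam i * v = v) (f : R) (n : ℕ) :
    corner (f • e K m lam i) ^ n * col u v h = col (f ^ n • u) (f ^ n • v)
      (by rw [smul_mul_assoc, h, smul_mul_assoc]) := by
  induction n with
  | zero => simp only [pow_zero, one_mul, one_smul]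
  | succ n ih =>
    rw [pow_succ', mul_assoc, ih, corner_mul_col (smul_e_mul_e_v2 hi f)]
    exact congrArg (· ≫ _) (ofCokernel_congr
      (by rw [smul_mul_assoc, mul_smul_comm, hu, pow_succ', mul_smul])
      (by rw [smul_mul_assoc, mul_smul_comm, hv, pow_succ', mul_smul]) _ _)

end TetrahedralAlgebra

end

/-! ### Images of the idempotents and arrows of `S` -/

section

namespace TetrahedralAlgebra

open Polynomial (X C)

variable {K : Type u} [Field K] {m : ℕ} {lam : K}

local notation "R" => Polynomial K
local notation "tα" => arrow K m lam TArrow.α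
local notation "tβ" => arrow K m lam TArrow.β
local notation "tγ" => arrow K m lam TArrow.γ
local notation "tδ" => arrow K m lam TArrow.δ
local notation "tε" => arrow K m lam TArrow.ε
local notation "tη" => arrow K m lam TArrow.η
local notation "tμ" => arrow K m lam TArrow.μ
local notation "tν" => arrow K m lam TArrow.ν
local notation "tξ" => arrow K m lam TArrow.ξ
local notation "tρ" => arrow K m lam TArrow.ρ
local notation "tσ" => arrow K m lam TArrow.σ
local notation "tω" => arrow K m lam TArrow.ω

theorem arrow_mul_e_v2 {θ : TArrow} (h : θ.target ≠ .v2) :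
    arrow K m lam θ * e K m lam .v2 = 0 :=
  arrow_mul_e_of_ne h

theorem vPoly_pow_smul_eq_self {M : Type*} [AddCommGroup M] [Module R M] {x : M}
    (h : (X ^ (m - 1) : R) • x = 0) (n : ℕ) : vPoly m lam ^ n • x = x := by
  induction n with
  | zero => rw [pow_zero, one_smul]
  | succ n ih => rw [pow_succ, mul_smul, vPoly_smul_eq_self h, ih]

theorem vPoly_mul_X_pow_smul {M : Type*} [AddCommGroup M] [Module R M] (hm : 2 ≤ m) {x : M}
    (h : (X ^ m : R) • x = 0) :
    (vPoly m lam * X) ^ (m - 1) • x = (X ^ (m - 1) : R) • x := by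
  rw [mul_pow, mul_smul, vPoly_pow_smul_eq_self]
  rw [← mul_smul, ← pow_add, show m - 1 + (m - 1) = m - 2 + m by omega, pow_add, mul_smul, h,
    smul_zero]

/-- Where `X^m = 0` also `X^(2(m-1)) = 0`, so `(vX)^(m-1)v = X^(m-1)` and the sum is `v + λX^(m-1) =
1`. This is the shape of the relations of `S` whose cycle acts as `vX`. -/
theorem vPoly_smul_add {M : Type*} [AddCommGroup M] [Module R M] [Module K M]
    [IsScalarTower K R M] (hm : 2 ≤ m) {x : M} (h : (X ^ m : R) • x = 0) :
    vPoly m lam • x + lam • (vPoly m lam * X) ^ (m - 1) • vPoly m lam • x = x := by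
  have h' : (X ^ (m - 1) : R) • (X ^ (m - 1) : R) • x = 0 := by
    rw [← mul_smul, ← pow_add, show m - 1 + (m - 1) = m - 2 + m by omega, pow_add, mul_smul, h,
      smul_zero]
  rw [smul_comm ((vPoly m lam * X) ^ (m - 1)), vPoly_mul_X_pow_smul hm h, vPoly_smul_eq_self h',
    vPoly, sub_smul, one_smul, mul_smul, ← Polynomial.algebraMap_eq, algebraMap_smul,
    sub_add_cancel]

theorem add_smul_vPoly {M : Type*} [AddCommGroup M] [Module R M] [Module K M]
    [IsScalarTower K R M] (hm : 2 ≤ m) {x : M} (h : (X ^ m : R) • x = 0) :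
    x + lam • (vPoly m lam * X) ^ (m - 1) • x = uPoly m lam • x := by
  rw [vPoly_mul_X_pow_smul hm h, uPoly, add_smul, one_smul, mul_smul, ← Polynomial.algebraMap_eq,
    algebraMap_smul]

variable (K m lam) in
/-- The idempotents of the endomorphism algebra of `T`. -/
noncomputable def endIdem : Vertex → End (THo K m lam)
  | .v1 => corner (e K m lam .v1)
  | .v2 => corner (e K m lam .v5)
  | .v3 => 1 - corner 1
  | .v4 => corner (e K m lam .v3)
  | .v5 => corner (e K m lam .v4)
  | .v6 => corner (e K m lam .v6)

variable (K m lam) in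
/-- The images of the arrows of the quiver of `S(m, λ)` in the endomorphism algebra of `T`. -/
noncomputable def endArrow (hm : 2 ≤ m) : SArrow → End (THo K m lam)
  | .α => corner tδ
  -- The factor `v` is forced by `ηβ = vξσ`: without it the pair does not kill the differential of
  -- `T 3`.
  | .β => col (vPoly m lam • tξ) tη (by rw [ηβ hm, smul_mul_assoc])
  | .γ => row (e K m lam .v3) 0
  | .δ => corner tγ
  | .ν => row 0 (e K m lam .v4)
  | .ρ => corner tν
  | .σ => corner tα
  | .ω => col tμ tω ωβ.symm

theorem corner_e_mul_corner_e (i : Vertex) :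
    corner (e K m lam i) * corner (e K m lam i) = corner (e K m lam i) := by
  by_cases h : i = .v2
  · rw [h, corner_e_v2, zero_mul]
  · rw [corner_mul_corner (e_mul_e_of_ne K m lam h), e_mul_e]

theorem corner_e_mul_corner_e_of_ne {i j : Vertex} (h : i ≠ j) :
    corner (e K m lam i) * corner (e K m lam j) = 0 := by
  by_cases hi : i = .v2
  · rw [hi, corner_e_v2, zero_mul]
  · rw [corner_mul_corner (e_mul_e_of_ne K m lam hi), e_mul_e_of_ne K m lam h, corner_zero]

theorem corner_one_mul_corner_one :
    corner (1 : TetrahedralAlgebra K m lam) * corner 1 = corner 1 := by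
  have h : corner (1 : TetrahedralAlgebra K m lam) = corner (1 - e K m lam .v2) := by
    rw [sub_eq_add_neg, corner_add, ← neg_one_smul K (e K m lam .v2), corner_smul, corner_e_v2,
        smul_zero, add_zero]
  have h' := corner_one_mul (x := 1 - e K m lam .v2) (by rw [mul_sub, e_mul_e, mul_one, sub_self])
  rwa [← h] at h'

theorem endIdem_mul_self (i : Vertex) : 
    endIdem K m lam i * endIdem K m lam i = endIdem K m lam i := by
  cases i
  case v3 => simp only [endIdem, mul_sub, sub_mul, one_mul, mul_one, corner_one_mul_corner_one,
    sub_self, sub_zero]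
  all_goals exact corner_e_mul_corner_e _

theorem corner_one_mul_corner_e {i : Vertex} (hi : i ≠ .v2) :
    corner 1 * corner (e K m lam i) = corner (e K m lam i) :=
  corner_one_mul (e_mul_e_of_ne K m lam hi.symm)

theorem corner_e_mul_corner_one {i : Vertex} (hi : i ≠ .v2) :
    corner (e K m lam i) * corner 1 = corner (e K m lam i) :=
  mul_corner_one (e_mul_e_of_ne K m lam hi)

theorem endIdem_mul_of_ne (i j : Vertex) (h : i ≠ j) :
    endIdem K m lam i * endIdem K m lam j = 0 := by
  cases i <;> cases j <;> first
    | exact absurd rfl h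
    | exact corner_e_mul_corner_e_of_ne (by decide)
    | (simp only [endIdem]; rw [sub_mul, one_mul, corner_one_mul_corner_e (by decide), sub_self])
    | (simp only [endIdem]; rw [mul_sub, mul_one, corner_e_mul_corner_one (by decide), sub_self])

theorem sum_endIdem : ∑ i, endIdem K m lam i = 1 := by
  have h : corner (1 : TetrahedralAlgebra K m lam) = corner (e K m lam .v1) +
      corner (e K m lam .v3) + corner (e K m lam .v4) + corner (e K m lam .v5) +
      corner (e K m lam .v6) := by
    rw [← sum_e, Vertex.sum_univ]
    simp only [corner_add, corner_e_v2, add_zero]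
  rw [Vertex.sum_univ]
  simp only [endIdem]
  rw [h]
  abel

theorem corner_e_mul_corner {i : Vertex} (hi : i ≠ .v2) {x : TetrahedralAlgebra K m lam}
    (hx : e K m lam i * x = x) : corner (e K m lam i) * corner x = corner x := by
  rw [corner_mul_corner (e_mul_e_of_ne K m lam hi), hx]

theorem corner_mul_corner_e {i : Vertex} (hi : i ≠ .v2) {x : TetrahedralAlgebra K m lam}
    (hx : x * e K m lam i = x) : corner x * corner (e K m lam i) = corner x := by
  rw [corner_mul_corner _, hx]
  rw [← hx, mul_assoc, e_mul_e_of_ne K m lam hi, mul_zero]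

theorem corner_e_mul_col {i : Vertex} (hi : i ≠ .v2) {u v : TetrahedralAlgebra K m lam}
    (h : u * tσ = v * tβ) (hu : e K m lam i * u = u) (hv : e K m lam i * v = v) :
    corner (e K m lam i) * col u v h = col u v h := by
  rw [corner_mul_col (e_mul_e_of_ne K m lam hi)]
  exact congrArg (· ≫ _) (ofCokernel_congr hu hv _ _)

theorem endIdem_mul_endArrow (hm : 2 ≤ m) (a : SArrow) :
    endIdem K m lam a.source * endArrow K m lam hm a = endArrow K m lam hm a := by
  cases a
  case α => exact corner_e_mul_corner (by decide) e_δ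
  case β => exact corner_e_mul_col (by decide) _ (by rw [mul_smul_comm, e_ξ]) e_η
  case γ => simp only [endIdem, endArrow, SArrow.source, sub_mul, corner_mul_row, one_mul, sub_zero]
  case δ => exact corner_e_mul_corner (by decide) e_γ
  case ν => simp only [endIdem, endArrow, SArrow.source, sub_mul, corner_mul_row, one_mul, sub_zero]
  case ρ => exact corner_e_mul_corner (by decide) e_ν
  case σ => exact corner_e_mul_corner (by decide) e_α
  case ω => exact corner_e_mul_col (by decide) _ e_μ e_ω

theorem row_left_mul_corner (x : TetrahedralAlgebra K m lam) :
    row (e K m lam .v3) 0 * corner x = row (e K m lam .v3 * x) 0 := by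
  rw [row_mul_corner (e_mul_e_of_ne K m lam (by decide)) (zero_mul _), zero_mul]

theorem row_right_mul_corner (x : TetrahedralAlgebra K m lam) :
    row 0 (e K m lam .v4) * corner x = row 0 (e K m lam .v4 * x) := by
  rw [row_mul_corner (zero_mul _) (e_mul_e_of_ne K m lam (by decide)), zero_mul]

theorem endArrow_mul_endIdem (hm : 2 ≤ m) (a : SArrow) :
    endArrow K m lam hm a * endIdem K m lam a.target = endArrow K m lam hm a := by
  cases a
  case α => exact corner_mul_corner_e (by decide) δ_e
  case β => simp only [endIdem, endArrow, SArrow.target, mul_sub, col_mul_corner, mul_one, sub_zero]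
  case γ => exact (row_left_mul_corner _).trans (by rw [e_mul_e]; rfl)
  case δ => exact corner_mul_corner_e (by decide) γ_e
  case ν => exact (row_right_mul_corner _).trans (by rw [e_mul_e]; rfl)
  case ρ => exact corner_mul_corner_e (by decide) ν_e
  case σ => exact corner_mul_corner_e (by decide) α_e
  case ω => simp only [endIdem, endArrow, SArrow.target, mul_sub, col_mul_corner, mul_one, sub_zero]

variable (K m lam) in
/-- The homomorphism from the path algebra to the endomorphism algebra of `T`. -/
noncomputable def pathHom (hm : 2 ≤ m) :
    PathAlgebra K SArrow.source SArrow.target →ₐ[K] End (THo K m lam) :=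
  PathAlgebra.lift (endIdem K m lam) (endArrow K m lam hm)
    (PathAlgebra.lift_respects _ _ endIdem_mul_self endIdem_mul_of_ne sum_endIdem
      (endIdem_mul_endArrow hm) (endArrow_mul_endIdem hm))

theorem pathHom_sPath (hm : 2 ≤ m) (l : List SArrow) :
    pathHom K m lam hm (sPath K l) = (l.map (endArrow K m lam hm)).prod := by
  rw [sPath, PathAlgebra.path, map_list_prod, List.map_map]
  congr 2
  funext a
  exact PathAlgebra.lift_arrow _ _ _ a

theorem endArrow_β_γ (hm : 2 ≤ m) : endArrow K m lam hm .β * endArrow K m lam hm .γ =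
    corner (vPoly m lam • tξ) := by
  refine (col_mul_row _ _ _).trans (congrArg _ ?_)
  rw [mul_zero, add_zero, mul_assoc, e_mul_e, smul_mul_assoc, ξ_e]

theorem endArrow_β_ν (hm : 2 ≤ m) : endArrow K m lam hm .β * endArrow K m lam hm .ν =
    corner tη := by
  refine (col_mul_row _ _ _).trans (congrArg _ ?_)
  rw [mul_zero, zero_add, mul_assoc, e_mul_e, η_e]

theorem endArrow_ω_γ (hm : 2 ≤ m) : endArrow K m lam hm .ω * endArrow K m lam hm .γ =
    corner tμ := by
  refine (col_mul_row _ _ _).trans (congrArg _ ?_)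
  rw [mul_zero, add_zero, mul_assoc, e_mul_e, μ_e]

theorem endArrow_ω_ν (hm : 2 ≤ m) : endArrow K m lam hm .ω * endArrow K m lam hm .ν =
    corner tω := by
  refine (col_mul_row _ _ _).trans (congrArg _ ?_)
  rw [mul_zero, zero_add, mul_assoc, e_mul_e, ω_e]

end TetrahedralAlgebra

end

/-! ### The relations of `S` hold in `End T` -/

section

namespace TetrahedralAlgebra

open Polynomial (X C)
open SphericalAlgebra (mul_pow_mul)

variable {K : Type u} [Field K] {m : ℕ} {lam : K}

local notation "R" => Polynomial K
local notation "tα" => arrow K m lam TArrow.α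
local notation "tβ" => arrow K m lam TArrow.β
local notation "tγ" => arrow K m lam TArrow.γ
local notation "tδ" => arrow K m lam TArrow.δ
local notation "tε" => arrow K m lam TArrow.ε
local notation "tη" => arrow K m lam TArrow.η
local notation "tμ" => arrow K m lam TArrow.μ
local notation "tν" => arrow K m lam TArrow.ν
local notation "tξ" => arrow K m lam TArrow.ξ
local notation "tρ" => arrow K m lam TArrow.ρ
local notation "tσ" => arrow K m lam TArrow.σ
local notation "tω" => arrow K m lam TArrow.ω
local notation "E" => End (THo K m lam)

section Relations

variable (hm : 2 ≤ m)

local notation "φα" => endArrow K m lam hm SArrow.α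
local notation "φβ" => endArrow K m lam hm SArrow.β
local notation "φγ" => endArrow K m lam hm SArrow.γ
local notation "φδ" => endArrow K m lam hm SArrow.δ
local notation "φν" => endArrow K m lam hm SArrow.ν
local notation "φρ" => endArrow K m lam hm SArrow.ρ
local notation "φσ" => endArrow K m lam hm SArrow.σ
local notation "φω" => endArrow K m lam hm SArrow.ω

theorem corner_arrow_mul_corner {θ : TArrow} (h : θ.target ≠ .v2) (y : TetrahedralAlgebra K m lam) :
    corner (arrow K m lam θ) * corner y = corner (arrow K m lam θ * y) :=
  corner_mul_corner (arrow_mul_e_v2 h) y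

theorem endArrow_βνδ : φβ * (φν * φδ) = corner (tη * tγ) := by
  rw [← mul_assoc, endArrow_β_ν]
  exact corner_arrow_mul_corner (by decide) _

theorem endArrow_βγσ : φβ * (φγ * φσ) = corner (vPoly m lam • (tη * tγ)) := by
  rw [← mul_assoc, endArrow_β_γ]
  refine (corner_mul_corner ?_ _).trans (congrArg _ ?_)
  · rw [smul_mul_assoc, arrow_mul_e_v2 (by decide), smul_zero]
  · rw [smul_mul_assoc, ηγ]

theorem endArrow_αβγ : φα * (φβ * φγ) = corner (vPoly m lam • (tδ * tξ)) := by
  rw [endArrow_β_γ]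
  refine (corner_arrow_mul_corner (by decide) _).trans (congrArg _ ?_)
  rw [mul_smul_comm]

theorem endArrow_αβν : φα * (φβ * φν) = corner (tδ * tη) := by
  rw [endArrow_β_ν]
  exact corner_arrow_mul_corner (by decide) _

theorem endArrow_ρων : φρ * (φω * φν) = corner (tδ * tη) := by
  rw [endArrow_ω_ν, δη]
  exact corner_arrow_mul_corner (by decide) _

theorem endArrow_ρωγ : φρ * (φω * φγ) = corner (tδ * tξ) := by
  rw [endArrow_ω_γ, ← νμ]
  exact corner_arrow_mul_corner (by decide) _

theorem endArrow_ωγσ : φω * (φγ * φσ) = corner (tω * tγ) := by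
  rw [← mul_assoc, endArrow_ω_γ, ← μα]
  exact corner_arrow_mul_corner (by decide) _

theorem endArrow_ωνδ : φω * (φν * φδ) = corner (tω * tγ) := by
  rw [← mul_assoc, endArrow_ω_ν]
  exact corner_arrow_mul_corner (by decide) _

theorem endArrow_σα : φσ * φα = corner (tα * tδ) := corner_arrow_mul_corner (by decide) _
theorem endArrow_σρ : φσ * φρ = corner (tα * tν) := corner_arrow_mul_corner (by decide) _
theorem endArrow_δα : φδ * φα = corner (tγ * tδ) := corner_arrow_mul_corner (by decide) _
theorem endArrow_δρ : φδ * φρ = corner (tγ * tν) := corner_arrow_mul_corner (by decide) _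

theorem endArrow_γσα : φγ * (φσ * φα) = row (tα * tδ) 0 := by
  rw [endArrow_σα]
  exact (row_left_mul_corner _).trans (by rw [← mul_assoc, e_α])

/-- `γδ = uβε` in the component `P 4` is homotopic to `uσε = uαδ` in the component `P 3`. -/
theorem endArrow_νδα : φν * (φδ * φα) = row (uPoly m lam • (tα * tδ)) 0 := by
  rw [endArrow_δα, ← σε, ← mul_smul_comm, row_σ_mul, mul_smul_comm, ← γδ]
  exact (row_right_mul_corner _).trans (by rw [← mul_assoc, e_γ])

theorem endArrow_γσρ : φγ * (φσ * φρ) = row (tα * tν) 0 := by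
  rw [endArrow_σρ]
  exact (row_left_mul_corner _).trans (by rw [← mul_assoc, e_α])

theorem endArrow_νδρ : φν * (φδ * φρ) = row (tα * tν) 0 := by
  rw [endArrow_δρ, αν, row_σ_mul, βρ]
  exact (row_right_mul_corner _).trans (by rw [← mul_assoc, e_γ])

theorem col_congr {u v u' v' : TetrahedralAlgebra K m lam} {h : u * tσ = v * tβ}
    (hu : u = u') (hv : v = v') :
    col u v h = col u' v' (by rw [← hu, ← hv, h]) := by
  subst hu hv
  rfl

theorem vPoly_smul_αδη : vPoly m lam • (tα * (tδ * tη)) = tα * (tδ * tη) :=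
  vPoly_smul_eq_self (X_pow_smul_pathTo_opp .v3)

theorem vPoly_smul_γδξ : vPoly m lam • (tγ * (tδ * tξ)) = tγ * (tδ * tξ) :=
  vPoly_smul_eq_self (X_pow_smul_pathTo_opp .v4)

theorem αδξσ : tα * (tδ * tξ) * tσ = tα * (tδ * tη) * tβ := by
  rw [← νμ, δη]
  simp only [mul_assoc, ωβ]

theorem endArrow_σαβ : φσ * (φα * φβ) = col (vPoly m lam • (tα * (tδ * tξ)))
    (vPoly m lam • (tα * (tδ * tη))) (by rw [smul_mul_assoc, αδξσ, smul_mul_assoc]) := by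
  rw [← mul_assoc, endArrow_σα]
  refine (corner_mul_col ?_ _).trans (col_congr ?_ ?_)
  · rw [mul_assoc, arrow_mul_e_v2 (by decide), mul_zero]
  · rw [mul_smul_comm, mul_assoc]
  · rw [mul_assoc, vPoly_smul_αδη]

theorem endArrow_σρω : φσ * (φρ * φω) = col (tα * (tδ * tξ)) (tα * (tδ * tη)) (αδξσ) := by
  rw [← mul_assoc, endArrow_σρ]
  refine (corner_mul_col ?_ _).trans (col_congr ?_ ?_)
  · rw [mul_assoc, arrow_mul_e_v2 (by decide), mul_zero]
  · rw [mul_assoc, νμ]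
  · rw [mul_assoc, δη]

/-- The factor `v` of β disappears because `γδξ` joins opposite vertices. -/
theorem endArrow_δαβ : φδ * (φα * φβ) = φδ * (φρ * φω) := by
  rw [← mul_assoc, ← mul_assoc, endArrow_δα, endArrow_δρ]
  refine (corner_mul_col ?_ _).trans ((col_congr ?_ ?_).trans (corner_mul_col ?_ _).symm)
  · rw [mul_assoc, arrow_mul_e_v2 (by decide), mul_zero]
  · rw [mul_smul_comm, mul_assoc, vPoly_smul_γδξ, mul_assoc, νμ]
  · rw [mul_assoc, mul_assoc, δη]
  · rw [mul_assoc, arrow_mul_e_v2 (by decide), mul_zero]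

theorem endArrow_βγσα : φβ * (φγ * (φσ * φα)) = corner ((vPoly m lam * X) • e K m lam .v5) := by
  rw [← mul_assoc φγ, ← mul_assoc, endArrow_βγσ]
  refine (corner_mul_corner ?_ _).trans (congrArg _ ?_)
  · rw [smul_mul_assoc, mul_assoc, arrow_mul_e_v2 (by decide), mul_zero, smul_zero]
  · rw [smul_mul_assoc, mul_assoc, ηγδ, mul_smul]

theorem endArrow_σαβγ : φσ * (φα * (φβ * φγ)) = corner ((vPoly m lam * X) • e K m lam .v3) := by
  rw [endArrow_αβγ]
  refine (corner_arrow_mul_corner (by decide) _).trans (congrArg _ ?_)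
  rw [mul_smul_comm, αδξ, mul_smul]

theorem endArrow_αβγσ : φα * (φβ * (φγ * φσ)) = corner ((vPoly m lam * X) • e K m lam .v1) := by
  rw [endArrow_βγσ]
  refine (corner_arrow_mul_corner (by decide) _).trans (congrArg _ ?_)
  rw [mul_smul_comm, δηγ, mul_smul]

theorem col_add {u v u' v' : TetrahedralAlgebra K m lam} (h : u * tσ = v * tβ)
    (h' : u' * tσ = v' * tβ) : col u v h + col u' v' h' =
      col (u + u') (v + v') (by rw [add_mul, add_mul, h, h']) := by
  rw [col, col, col, ← Preadditive.add_comp, ofCokernel_add]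

theorem col_smul {u v : TetrahedralAlgebra K m lam} (h : u * tσ = v * tβ) (k : K) :
    k • col u v h = col (k • u) (k • v) (by rw [smul_mul_assoc, smul_mul_assoc, h]) := by
  rw [col, col, ← Linear.smul_comp, ofCokernel_smul]

theorem X_pow_smul_arrow_mul (θ : TArrow) (x : TetrahedralAlgebra K m lam) (hm : 2 ≤ m) :
    (X ^ m : R) • (arrow K m lam θ * x) = 0 := by
  rw [← smul_mul_assoc, X_pow_smul_arrow hm, zero_mul]

theorem pathHom_eq_of_rel ⦃a b : PathAlgebra K SArrow.source SArrow.target⦄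
    (h : SphericalRel K m lam a b) : pathHom K m lam hm a = pathHom K m lam hm b := by
  cases h <;> simp only [map_add, map_smul, map_mul, map_pow, map_zero, pathHom_sPath, List.map_cons,
    List.map_nil, List.prod_cons, List.prod_nil, mul_one]
  case r1 =>
    rw [endArrow_βνδ, endArrow_βγσα, endArrow_βγσ,
      corner_pow_mul_corner (by decide) (by rw [mul_smul_comm, ← mul_assoc, e_η]), ← corner_smul,
      ← corner_add, vPoly_smul_add hm (X_pow_smul_arrow_mul _ _ hm)]
  case r2 => rw [endArrow_αβν, endArrow_ρων]
  case r3 =>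
    -- The cycle is rotated from `T 3` to `T 4`, where it becomes an element of Λ.
    have h := mul_pow_mul φγ (φσ * (φα * φβ)) (φσ * φα) (m - 1)
    simp only [mul_assoc] at h
    rw [← h, endArrow_σαβγ, endArrow_νδα, endArrow_γσα, endArrow_σα,
      corner_pow_mul_corner (by decide) (by rw [← mul_assoc, e_α])]
    have hr (x y : TetrahedralAlgebra K m lam) :
        row (x + lam • y) 0 = row x 0 + lam • row y 0 := by
      rw [← row_smul, smul_zero, ← row_add, add_zero]
    rw [← add_smul_vPoly hm (X_pow_smul_arrow_mul _ _ hm), hr]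
    refine congrArg (row (tα * tδ) 0 + lam • ·) (Eq.trans ?_ (row_left_mul_corner _).symm)
    rw [mul_smul_comm, ← mul_assoc, e_α]
  case r4 => exact endArrow_δαβ hm
  case r5 =>
    rw [endArrow_σαβγ, endArrow_σαβ, endArrow_σρω,
      corner_pow_mul_col (by decide) _ (by rw [mul_smul_comm, ← mul_assoc, e_α])
        (by rw [mul_smul_comm, ← mul_assoc, e_α]), col_smul, col_add]
    exact col_congr (vPoly_smul_add hm (X_pow_smul_arrow_mul _ _ hm)).symm
      (vPoly_smul_add hm (X_pow_smul_arrow_mul _ _ hm)).symm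
  case r6 => rw [endArrow_ωγσ, endArrow_ωνδ]
  case r7 =>
    rw [endArrow_ρωγ, endArrow_αβγσ, endArrow_αβγ,
      corner_pow_mul_corner (by decide) (by rw [mul_smul_comm, ← mul_assoc, e_δ]), ← corner_smul,
      ← corner_add, vPoly_smul_add hm (X_pow_smul_arrow_mul _ _ hm)]
  case r8 => rw [endArrow_γσρ, endArrow_νδρ]
  case r9 =>
    rw [endArrow_αβγσ]
    refine (corner_pow_mul_corner (by decide) e_δ _ _).trans ?_
    rw [mul_pow, mul_smul, X_pow_smul_arrow hm, smul_zero, corner_zero]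
  case r10 =>
    have h' : φγ * corner (e K m lam .v3) = φγ :=
      (row_left_mul_corner _).trans (by rw [e_mul_e]; rfl)
    have h := mul_pow_mul φγ (φσ * (φα * φβ)) (corner (e K m lam .v3)) m
    simp only [mul_assoc] at h
    rw [h', endArrow_σαβγ, corner_pow_mul_corner (by decide) (e_mul_e K m lam _)] at h
    rw [← h]
    refine (row_left_mul_corner _).trans ?_
    -- `X^m e 3` is not zero in Λ. It factors through σ, so the homotopy moves it to `P 4`, where
    -- `X^(m-1)βεξ = 0`.
    have h3 : (vPoly m lam * X) ^ m • e K m lam .v3 =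
        tσ * (vPoly m lam ^ m • (X ^ (m - 1) : R) • (tε * tξ)) := by
      rw [mul_smul_comm, mul_smul_comm, σεξ, ← mul_smul (X ^ (m - 1)), ← pow_succ,
        Nat.sub_add_cancel (by omega), mul_pow, mul_smul]
    rw [mul_smul_comm, e_mul_e, h3, row_σ_mul, mul_smul_comm, βγδξ_pow hm, smul_zero, row_zero]

variable (K m lam) in
/-- The homomorphism from `S(m, λ)` to the endomorphism algebra of `T`. -/
noncomputable def sphericalHom : SphericalAlgebra K m lam →ₐ[K] End (THo K m lam) :=
  RingQuot.liftAlgHom K ⟨pathHom K m lam hm, pathHom_eq_of_rel hm⟩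

theorem sphericalHom_mk (x : PathAlgebra K SArrow.source SArrow.target) :
    sphericalHom K m lam hm (SphericalAlgebra.mk K m lam x) = pathHom K m lam hm x :=
  RingQuot.liftAlgHom_mkAlgHom_apply K _ _ _

theorem sphericalHom_e (i : Vertex) :
    sphericalHom K m lam hm (SphericalAlgebra.e K m lam i) = endIdem K m lam i :=
  (sphericalHom_mk hm _).trans (PathAlgebra.lift_e _ _ _ i)

theorem sphericalHom_arrow (a : SArrow) :
    sphericalHom K m lam hm (SphericalAlgebra.arrow K m lam a) = endArrow K m lam hm a :=
  (sphericalHom_mk hm _).trans (PathAlgebra.lift_arrow _ _ _ a)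

end Relations

end TetrahedralAlgebra

end

/-! ### The image of `X^m e i` is not zero -/

section

namespace SphericalAlgebra

open Polynomial
open TetrahedralAlgebra (uPoly vPoly vPoly_smul_uPoly_smul mul_mul_of_mul_eq_smul)

variable {K : Type u} [Field K] {m : ℕ} {lam : K}

local notation "sα" => arrow K m lam SArrow.α
local notation "sβ" => arrow K m lam SArrow.β
local notation "sγ" => arrow K m lam SArrow.γ
local notation "sδ" => arrow K m lam SArrow.δ
local notation "sν" => arrow K m lam SArrow.ν
local notation "sρ" => arrow K m lam SArrow.ρ
local notation "sσ" => arrow K m lam SArrow.σ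
local notation "sω" => arrow K m lam SArrow.ω

local notation "tα" => TetrahedralAlgebra.arrow K m lam TArrow.α
local notation "tβ" => TetrahedralAlgebra.arrow K m lam TArrow.β
local notation "tγ" => TetrahedralAlgebra.arrow K m lam TArrow.γ
local notation "tδ" => TetrahedralAlgebra.arrow K m lam TArrow.δ
local notation "tε" => TetrahedralAlgebra.arrow K m lam TArrow.ε
local notation "tη" => TetrahedralAlgebra.arrow K m lam TArrow.η
local notation "tμ" => TetrahedralAlgebra.arrow K m lam TArrow.μ
local notation "tν" => TetrahedralAlgebra.arrow K m lam TArrow.ν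
local notation "tξ" => TetrahedralAlgebra.arrow K m lam TArrow.ξ
local notation "tρ" => TetrahedralAlgebra.arrow K m lam TArrow.ρ
local notation "tσ" => TetrahedralAlgebra.arrow K m lam TArrow.σ
local notation "tω" => TetrahedralAlgebra.arrow K m lam TArrow.ω

open TetrahedralAlgebra (THo sphericalHom sphericalHom_e sphericalHom_arrow endArrow corner row col)

theorem corner_eq_zero {x : TetrahedralAlgebra K m lam}
    (h1 : TetrahedralAlgebra.e K m lam .v2 * x = 0) (h2 : x * TetrahedralAlgebra.e K m lam .v2 = 0)
    (h : corner x = 0) : x = 0 := by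
  have h3 := congrArg (fun f => TetrahedralAlgebra.iT K m lam ≫ f ≫ TetrahedralAlgebra.pT K m lam) h
  simp only [corner, Category.assoc, TetrahedralAlgebra.iT_pT, TetrahedralAlgebra.iT_pT_assoc,
    Limits.zero_comp, Limits.comp_zero] at h3
  rw [← TetrahedralAlgebra.J_mul, ← TetrahedralAlgebra.J_mul, sub_mul, one_mul, h1, sub_zero,
    mul_sub, mul_one, h2, sub_zero] at h3
  exact TetrahedralAlgebra.J_eq_zero h3

section

variable (hm : 2 ≤ m)

theorem sphericalHom_loop {i : Vertex} {x : TetrahedralAlgebra K m lam} {j : Vertex} (hj : j ≠ .v2)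
    {y : SphericalAlgebra K m lam} (hy : e K m lam i * y = y)
    (h : sphericalHom K m lam hm (loop K m lam i) =
      corner ((X : K[X]) • TetrahedralAlgebra.e K m lam j))
    (hx : TetrahedralAlgebra.e K m lam j * x = x) (h' : sphericalHom K m lam hm y = corner x)
    (n : ℕ) : sphericalHom K m lam hm ((X ^ n : K[X]) • y) = corner ((X ^ n : K[X]) • x) := by
  rw [X_pow_smul hy, map_mul, map_pow, h, h', TetrahedralAlgebra.corner_pow_mul_corner hj hx]

theorem sphericalHom_loop_v1 : sphericalHom K m lam hm (loop K m lam .v1) =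
    corner ((X : K[X]) • TetrahedralAlgebra.e K m lam .v1) := by
  rw [← TetrahedralAlgebra.δηγ, loop]
  simp only [map_mul, sphericalHom_arrow]
  rw [TetrahedralAlgebra.endArrow_βνδ]
  exact TetrahedralAlgebra.corner_arrow_mul_corner (by decide) _

theorem sphericalHom_loop_v2 : sphericalHom K m lam hm (loop K m lam .v2) =
    corner ((X : K[X]) • TetrahedralAlgebra.e K m lam .v5) := by
  rw [← TetrahedralAlgebra.ηγδ, loop]
  simp only [map_mul, sphericalHom_arrow]
  rw [← mul_assoc, TetrahedralAlgebra.endArrow_β_ν, TetrahedralAlgebra.endArrow_δα]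
  exact TetrahedralAlgebra.corner_arrow_mul_corner (by decide) _

theorem sphericalHom_loop_v4 : sphericalHom K m lam hm (loop K m lam .v4) =
    corner ((X : K[X]) • TetrahedralAlgebra.e K m lam .v3) := by
  rw [← TetrahedralAlgebra.αδξ, loop]
  simp only [map_mul, sphericalHom_arrow]
  rw [TetrahedralAlgebra.endArrow_ρωγ]
  exact TetrahedralAlgebra.corner_arrow_mul_corner (by decide) _

theorem sphericalHom_loop_v5 : sphericalHom K m lam hm (loop K m lam .v5) =
    corner ((X : K[X]) • TetrahedralAlgebra.e K m lam .v4) := by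
  rw [← TetrahedralAlgebra.γδη, loop]
  simp only [map_mul, sphericalHom_arrow]
  rw [TetrahedralAlgebra.endArrow_αβν]
  exact TetrahedralAlgebra.corner_arrow_mul_corner (by decide) _

theorem sphericalHom_loop_v6 : sphericalHom K m lam hm (loop K m lam .v6) =
    corner ((X : K[X]) • TetrahedralAlgebra.e K m lam .v6) := by
  rw [← TetrahedralAlgebra.ωγν, loop]
  simp only [map_mul, sphericalHom_arrow]
  rw [← mul_assoc, TetrahedralAlgebra.endArrow_ω_ν, TetrahedralAlgebra.endArrow_δρ]
  exact TetrahedralAlgebra.corner_arrow_mul_corner (by decide) _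

theorem sphericalHom_X_pow_smul_e_ne_zero {i j : Vertex} (hj : j ≠ .v2)
    (h : sphericalHom K m lam hm (loop K m lam i) =
      corner ((X : K[X]) • TetrahedralAlgebra.e K m lam j))
    (h' : sphericalHom K m lam hm (e K m lam i) = corner (TetrahedralAlgebra.e K m lam j)) :
    sphericalHom K m lam hm ((X ^ m : K[X]) • e K m lam i) ≠ 0 := by
  rw [sphericalHom_loop hm hj (e_mul_e K m lam i) h (TetrahedralAlgebra.e_mul_e K m lam j) h']
  intro h0
  refine TetrahedralAlgebra.X_pow_smul_e_ne_zero hm j (corner_eq_zero ?_ ?_ h0)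
  · rw [mul_smul_comm, TetrahedralAlgebra.e_mul_e_of_ne K m lam hj.symm, smul_zero]
  · rw [smul_mul_assoc, TetrahedralAlgebra.e_mul_e_of_ne K m lam hj, smul_zero]

/-- In `S` one has `X^m e 3 = γ X^(m-1)σρω`. The image of `X^(m-1)σρω` has entries `X^(m-1)αδξ = X^m
e 3` and `X^(m-1)αδη = 0`, the latter by the relation for opposite vertices. -/
theorem sphericalHom_X_pow_smul_e_v3 :
    ∃ H, sphericalHom K m lam hm ((X ^ m : K[X]) • e K m lam .v3) =
      TetrahedralAlgebra.ofCokernel ((X ^ m : K[X]) • TetrahedralAlgebra.e K m lam .v3) 0 H ≫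
        TetrahedralAlgebra.leg3 K m lam := by
  have hX : (X ^ m : K[X]) = X ^ (m - 1) * X := by rw [← pow_succ, Nat.sub_add_cancel (by omega)]
  have h1 : (X ^ m : K[X]) • e K m lam .v3 = sγ * ((X ^ (m - 1) : K[X]) • (sσ * (sρ * sω))) := by
    rw [hX, mul_smul, ← νδρω_eq, mul_smul_comm, ← mul_mul_mul_of_eq γσρ]
  have h2 : (X ^ (m - 1) : K[X]) • (tα * (tδ * tξ)) =
      (X ^ m : K[X]) • TetrahedralAlgebra.e K m lam .v3 := by
    rw [TetrahedralAlgebra.αδξ, hX, mul_smul]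
  have h3 : (X ^ (m - 1) : K[X]) • (tα * (tδ * tη)) = 0 :=
    TetrahedralAlgebra.X_pow_smul_pathTo_opp .v3
  have H : (X ^ m : K[X]) • TetrahedralAlgebra.e K m lam .v3 * tσ = 0 * tβ := by
    rw [← h2, ← h3, smul_mul_assoc, smul_mul_assoc, TetrahedralAlgebra.αδξσ]
  refine ⟨H, ?_⟩
  rw [h1, map_mul, X_pow_smul (i := .v4) (by rw [← mul_assoc, e_σ]), map_mul, map_pow,
    sphericalHom_loop_v4]
  simp only [map_mul, sphericalHom_arrow]
  rw [TetrahedralAlgebra.endArrow_σρω, TetrahedralAlgebra.corner_pow_mul_col (by decide) _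
    (by rw [← mul_assoc, TetrahedralAlgebra.e_α]) (by rw [← mul_assoc, TetrahedralAlgebra.e_α]),
    TetrahedralAlgebra.col_congr h2 h3, End.mul_def]
  simp only [endArrow, row, col, Category.assoc, TetrahedralAlgebra.iT_pT_assoc,
    TetrahedralAlgebra.J_zero, Limits.zero_comp, add_zero, TetrahedralAlgebra.J_e_leg3]
  rw [← TetrahedralAlgebra.J_e_leg3, ← Category.assoc (TetrahedralAlgebra.J (1 - _)),
    ← TetrahedralAlgebra.J_mul, mul_sub, mul_one,
    TetrahedralAlgebra.e_mul_e_of_ne K m lam (by decide), sub_zero]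

theorem sphericalHom_X_pow_smul_ne_zero (i : Vertex) :
    sphericalHom K m lam hm ((X ^ m : K[X]) • e K m lam i) ≠ 0 := by
  cases i
  case v3 =>
    obtain ⟨H, h⟩ := sphericalHom_X_pow_smul_e_v3 (K := K) (lam := lam) hm
    rw [h]
    exact TetrahedralAlgebra.ofCokernel_leg3_ne_zero hm H
  case v1 =>
    exact sphericalHom_X_pow_smul_e_ne_zero hm (j := .v1) (by decide) (sphericalHom_loop_v1 hm)
      (sphericalHom_e hm _)
  case v2 =>
    exact sphericalHom_X_pow_smul_e_ne_zero hm (j := .v5) (by decide) (sphericalHom_loop_v2 hm)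
      (sphericalHom_e hm _)
  case v4 =>
    exact sphericalHom_X_pow_smul_e_ne_zero hm (j := .v3) (by decide) (sphericalHom_loop_v4 hm)
      (sphericalHom_e hm _)
  case v5 =>
    exact sphericalHom_X_pow_smul_e_ne_zero hm (j := .v4) (by decide) (sphericalHom_loop_v5 hm)
      (sphericalHom_e hm _)
  case v6 =>
    exact sphericalHom_X_pow_smul_e_ne_zero hm (j := .v6) (by decide) (sphericalHom_loop_v6 hm)
      (sphericalHom_e hm _)

theorem isCoprime_X_pow_vPoly_pow (hm : 2 ≤ m) (n a : ℕ) :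
    IsCoprime (X ^ n : K[X]) (vPoly m lam ^ a) := by
  refine IsCoprime.pow (⟨C lam * X ^ (m - 2), 1, ?_⟩ : IsCoprime (X : K[X]) (vPoly m lam))
  rw [vPoly, mul_assoc, ← pow_succ, show m - 2 + 1 = m - 1 by omega]
  ring

theorem sphericalHom_smul_eq_zero {x : SphericalAlgebra K m lam}
    (h : sphericalHom K m lam hm x = 0) (p : K[X]) : sphericalHom K m lam hm (p • x) = 0 := by
  rw [Algebra.smul_def, map_mul, h, mul_zero]

/-- Multiply by the path back from `j` to `i`. If `X^(m+1)` did not divide the resulting coefficient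
of `e i`, a multiple of it would be `X^m` modulo `X^(m+1)`, although `X^m e i` survives. The power
of `v` is then cancelled because it is prime to `X`. -/
theorem X_pow_dvd_of_sphericalHom_eq_zero (hlam : lam ≠ 0) {i j : Vertex} {f : K[X]}
    (h : sphericalHom K m lam hm (f • wordTo K m lam i j) = 0) :
    X ^ (m + 1 - coexpo i j) ∣ f := by
  obtain ⟨a, ha⟩ := wordTo_mul_wordTo (lam := lam) hm i j
  have h1 : sphericalHom K m lam hm
      ((f * (X ^ coexpo i j * vPoly m lam ^ a)) • e K m lam i) = 0 := by
    rw [mul_smul, ← ha, ← smul_mul_assoc, map_mul, h, zero_mul]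
  have hk : coexpo i j ≤ m + 1 := by
    have : coexpo i j ≤ 2 := by cases i <;> cases j <;> decide
    omega
  suffices h2 : X ^ (m + 1) ∣ f * (X ^ coexpo i j * vPoly m lam ^ a) by
    rw [← mul_assoc] at h2
    have h3 := (isCoprime_X_pow_vPoly_pow hm (m + 1) a).dvd_of_dvd_mul_right h2
    rw [← Nat.sub_add_cancel hk, pow_add] at h3
    exact (mul_dvd_mul_iff_right (pow_ne_zero _ Polynomial.X_ne_zero)).1
      (by simpa [Nat.sub_add_cancel hk] using h3)
  by_contra hd
  obtain ⟨p, q, hpq⟩ := exists_mul_eq_X_pow hd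
  refine sphericalHom_X_pow_smul_ne_zero (K := K) (lam := lam) hm i ?_
  have h3 := sphericalHom_smul_eq_zero hm h1 p
  rwa [smul_smul, hpq, sub_smul, mul_smul q, X_pow_smul_e hm hlam, smul_zero, sub_zero] at h3

end

end SphericalAlgebra

end

/-! ### Injectivity -/

section

namespace SphericalAlgebra

open Polynomial
open TetrahedralAlgebra (uPoly vPoly vPoly_smul_uPoly_smul mul_mul_of_mul_eq_smul)

variable {K : Type u} [Field K] {m : ℕ} {lam : K}

local notation "sα" => arrow K m lam SArrow.α
local notation "sβ" => arrow K m lam SArrow.β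
local notation "sγ" => arrow K m lam SArrow.γ
local notation "sδ" => arrow K m lam SArrow.δ
local notation "sν" => arrow K m lam SArrow.ν
local notation "sρ" => arrow K m lam SArrow.ρ
local notation "sσ" => arrow K m lam SArrow.σ
local notation "sω" => arrow K m lam SArrow.ω

local notation "tα" => TetrahedralAlgebra.arrow K m lam TArrow.α
local notation "tβ" => TetrahedralAlgebra.arrow K m lam TArrow.β
local notation "tγ" => TetrahedralAlgebra.arrow K m lam TArrow.γ
local notation "tδ" => TetrahedralAlgebra.arrow K m lam TArrow.δ
local notation "tε" => TetrahedralAlgebra.arrow K m lam TArrow.ε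
local notation "tη" => TetrahedralAlgebra.arrow K m lam TArrow.η
local notation "tμ" => TetrahedralAlgebra.arrow K m lam TArrow.μ
local notation "tν" => TetrahedralAlgebra.arrow K m lam TArrow.ν
local notation "tξ" => TetrahedralAlgebra.arrow K m lam TArrow.ξ
local notation "tρ" => TetrahedralAlgebra.arrow K m lam TArrow.ρ
local notation "tσ" => TetrahedralAlgebra.arrow K m lam TArrow.σ
local notation "tω" => TetrahedralAlgebra.arrow K m lam TArrow.ω

open TetrahedralAlgebra (THo sphericalHom sphericalHom_e sphericalHom_arrow endArrow corner row col)

open TetrahedralAlgebra (THo sphericalHom)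

/-- `X` acts from the right at vertex `3` as the cycle `νδρω`, and `αβν = ρων`. -/
theorem X_smul_αβ : (X : K[X]) • (sα * sβ) = (X : K[X]) • (sρ * sω) := by
  have h (x : SphericalAlgebra K m lam) (hx : x * e K m lam .v3 = x) :
      (X : K[X]) • x = x * (sν * (sδ * (sρ * sω))) := by
    rw [νδρω_eq, mul_smul_comm, hx]
  rw [h _ (by rw [mul_assoc, β_e]), h _ (by rw [mul_assoc, ω_e]), mul_assoc, mul_assoc,
    mul_mul_mul_of_eq αβν]

theorem X_smul_γσ : (X : K[X]) • (sγ * sσ) = (X : K[X]) • (sν * sδ) := by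
  have h (x : SphericalAlgebra K m lam) (hx : x * e K m lam .v1 = x) :
      (X : K[X]) • x = x * (sρ * (sω * (sν * sδ))) := by
    rw [ρωνδ_eq, mul_smul_comm, hx]
  rw [h _ (by rw [mul_assoc, σ_e]), h _ (by rw [mul_assoc, δ_e]), mul_assoc, mul_assoc,
    mul_mul_mul_of_eq γσρ]

section

variable (hm : 2 ≤ m)

theorem X_dvd_of_X_pow_dvd_add_mul_vPoly {f g : K[X]} (hm : 2 ≤ m) (hlam : lam ≠ 0)
    (h1 : X ^ m ∣ f + g * vPoly m lam)
    (h2 : X ^ m ∣ f + g) : X ∣ g := by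
  have h3 := dvd_sub h2 h1
  have h4 : f + g - (f + g * vPoly m lam) = C lam * (g * X ^ (m - 1)) := by
    rw [vPoly]
    ring
  have h5 : (X ^ m : K[X]) = X * X ^ (m - 1) := by rw [← pow_succ', Nat.sub_add_cancel (by omega)]
  rw [h4, (isUnit_C.2 hlam.isUnit).dvd_mul_left, h5] at h3
  exact (mul_dvd_mul_iff_right (pow_ne_zero _ Polynomial.X_ne_zero)).1 h3

theorem smul_wordTo_eq_zero_of_sphericalHom_eq_zero (hlam : lam ≠ 0) {i j : Vertex} {f : K[X]}
    (h : sphericalHom K m lam hm (f • wordTo K m lam i j) = 0) : f • wordTo K m lam i j = 0 := by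
  obtain ⟨p, rfl⟩ := X_pow_dvd_of_sphericalHom_eq_zero hm hlam h
  rw [mul_comm, mul_smul, X_pow_smul_wordTo hm hlam, smul_zero]

/-- Serves the pairs `(1,3)` and `(3,1)`. The arrow `a` turns the second generator into `v` times
the first, the arrow `b` identifies them; so `f + gv` and `f + g` are both divisible by `X^m`. Their
difference `λgX^(m-1)` forces `X ∣ g`, and on multiples of `X` the two generators coincide. -/
theorem smul_add_smul_eq_zero_of_sphericalHom_eq_zero (hlam : lam ≠ 0) {i j k l : Vertex}
    {w a b : SphericalAlgebra K m lam} (h1 : wordTo K m lam i j * a = wordTo K m lam i k)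
    (h1' : w * a = vPoly m lam • wordTo K m lam i k)
    (h2 : wordTo K m lam i j * b = wordTo K m lam i l) (h2' : w * b = wordTo K m lam i l)
    (hk : coexpo i k = 1) (hl : coexpo i l = 1)
    (hX : (X : K[X]) • w = (X : K[X]) • wordTo K m lam i j) {f g : K[X]}
    (h : sphericalHom K m lam hm (f • wordTo K m lam i j + g • w) = 0) :
    f • wordTo K m lam i j + g • w = 0 := by
  have ha : X ^ m ∣ f + g * vPoly m lam := by
    have : sphericalHom K m lam hm ((f + g * vPoly m lam) • wordTo K m lam i k) = 0 := by
      rw [add_smul, mul_smul, ← h1', ← h1, ← smul_mul_assoc, ← smul_mul_assoc, ← add_mul, map_mul,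
        h, zero_mul]
    simpa only [hk, Nat.add_sub_cancel] using X_pow_dvd_of_sphericalHom_eq_zero hm hlam this
  have hb : X ^ m ∣ f + g := by
    have : sphericalHom K m lam hm ((f + g) • wordTo K m lam i l) = 0 := by
      rw [add_smul]
      nth_rw 2 [← h2']
      rw [← h2, ← smul_mul_assoc, ← smul_mul_assoc, ← add_mul, map_mul, h, zero_mul]
    simpa only [hl, Nat.add_sub_cancel] using X_pow_dvd_of_sphericalHom_eq_zero hm hlam this
  obtain ⟨p, rfl⟩ := X_dvd_of_X_pow_dvd_add_mul_vPoly hm hlam ha hb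
  have hg : (X * p) • w = (X * p) • wordTo K m lam i j := by
    rw [mul_comm, mul_smul, hX, ← mul_smul]
  rw [hg, ← add_smul] at h ⊢
  exact smul_wordTo_eq_zero_of_sphericalHom_eq_zero hm hlam h

theorem e_mul_mul_e_eq_zero_of_sphericalHom_eq_zero (hlam : lam ≠ 0) (i j : Vertex)
    {x : SphericalAlgebra K m lam} (h : sphericalHom K m lam hm x = 0) :
    e K m lam i * x * e K m lam j = 0 := by
  replace h : sphericalHom K m lam hm (e K m lam i * x * e K m lam j) = 0 := by
    rw [map_mul, map_mul, h, mul_zero, zero_mul]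
  obtain ⟨f, g, hx⟩ := exists_eq_smul_add_smul hm hlam i j x
  rw [hx] at h ⊢
  have key (hw : wordTo' K m lam i j = wordTo K m lam i j) :
      f • wordTo K m lam i j + g • wordTo' K m lam i j = 0 := by
    rw [hw, ← add_smul] at h ⊢
    exact smul_wordTo_eq_zero_of_sphericalHom_eq_zero hm hlam h
  by_cases h13 : i = .v1 ∧ j = .v3
  · obtain ⟨rfl, rfl⟩ := h13
    refine smul_add_smul_eq_zero_of_sphericalHom_eq_zero hm hlam (a := sγ) (b := sν) (k := .v4)
      (l := .v5) ?_ ?_ ?_ ?_ rfl rfl X_smul_αβ h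
    · exact mul_assoc _ _ _
    · exact (mul_assoc _ _ _).trans (αβγ hm)
    · exact mul_assoc _ _ _
    · exact (mul_assoc _ _ _).trans αβν
  by_cases h31 : i = .v3 ∧ j = .v1
  · obtain ⟨rfl, rfl⟩ := h31
    refine smul_add_smul_eq_zero_of_sphericalHom_eq_zero hm hlam (a := sα) (b := sρ) (k := .v2)
      (l := .v6) ?_ ?_ ?_ ?_ rfl rfl X_smul_γσ h
    · exact mul_assoc _ _ _
    · exact (mul_assoc _ _ _).trans (γσα hm)
    · exact mul_assoc _ _ _
    · exact (mul_assoc _ _ _).trans γσρ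
  refine key ?_
  cases i <;> cases j <;> simp at h13 h31 <;> rfl

theorem sphericalHom_injective (hlam : lam ≠ 0) :
    Function.Injective (sphericalHom K m lam hm) := by
  rw [injective_iff_map_eq_zero]
  intro x h
  rw [← one_mul x, ← mul_one (1 * x), ← sum_e, Finset.sum_mul, Finset.sum_mul]
  refine Finset.sum_eq_zero fun i _ => ?_
  rw [Finset.mul_sum]
  exact Finset.sum_eq_zero fun j _ => e_mul_mul_e_eq_zero_of_sphericalHom_eq_zero hm hlam i j h

end

end SphericalAlgebra

end

/-! ### Maps out of the degree `0` summands lie in the image -/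

section

namespace TetrahedralAlgebra

open Polynomial (X C)
open SphericalAlgebra (mul_pow_mul)

variable {K : Type u} [Field K] {m : ℕ} {lam : K}

local notation "R" => Polynomial K
local notation "tα" => arrow K m lam TArrow.α
local notation "tβ" => arrow K m lam TArrow.β
local notation "tγ" => arrow K m lam TArrow.γ
local notation "tδ" => arrow K m lam TArrow.δ
local notation "tε" => arrow K m lam TArrow.ε
local notation "tη" => arrow K m lam TArrow.η
local notation "tμ" => arrow K m lam TArrow.μ
local notation "tν" => arrow K m lam TArrow.ν
local notation "tξ" => arrow K m lam TArrow.ξ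
local notation "tρ" => arrow K m lam TArrow.ρ
local notation "tσ" => arrow K m lam TArrow.σ
local notation "tω" => arrow K m lam TArrow.ω

open SphericalAlgebra (sphericalHom_loop_v1 sphericalHom_loop_v2 sphericalHom_loop_v4
  sphericalHom_loop_v5 sphericalHom_loop_v6)

theorem corner_e_v2_mul (x : TetrahedralAlgebra K m lam) : corner (e K m lam .v2 * x) = 0 := by
  have h : J (e K m lam .v2) ≫ iT K m lam = 0 := by
    rw [← J_sub_iT, ← Category.assoc, ← J_mul, sub_mul, one_mul, e_mul_e, sub_self, J_zero,
      Limits.zero_comp]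
  rw [corner, J_mul, Category.assoc, h, Limits.comp_zero, Limits.comp_zero]

theorem pT_J_sub : pT K m lam ≫ J (1 - e K m lam .v2) = pT K m lam := by
  rw [← iT_pT]
  conv_rhs => rw [← Category.id_comp (pT K m lam), ← pT_iT_add, Preadditive.add_comp,
    Category.assoc, Category.assoc, iT3_pT, Limits.comp_zero, add_zero]

theorem corner_mul_e_v2 (x : TetrahedralAlgebra K m lam) : corner (x * e K m lam .v2) = 0 := by
  have h : pT K m lam ≫ J (e K m lam .v2) = 0 := by
    rw [← pT_J_sub, Category.assoc, ← J_mul, mul_sub, mul_one, e_mul_e, sub_self, J_zero,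
      Limits.comp_zero]
  rw [corner, J_mul, Category.assoc, ← Category.assoc, h, Limits.zero_comp]

section

variable (hm : 2 ≤ m)

theorem corner_X_smul_e_mem_range {i : Vertex} (hi : i ≠ .v2) :
    corner ((X : R) • e K m lam i) ∈ (sphericalHom K m lam hm).range := by
  cases i
  case v1 => exact ⟨_, sphericalHom_loop_v1 hm⟩
  case v2 => exact absurd rfl hi
  case v3 => exact ⟨_, sphericalHom_loop_v4 hm⟩
  case v4 => exact ⟨_, sphericalHom_loop_v5 hm⟩
  case v5 => exact ⟨_, sphericalHom_loop_v2 hm⟩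
  case v6 => exact ⟨_, sphericalHom_loop_v6 hm⟩

/-- The action of `X` on the corner is multiplication by `corner (X e i)`, the image of a 4-cycle of
`S`. -/
theorem corner_smul_mem_range {i : Vertex} (hi : i ≠ .v2) {x : TetrahedralAlgebra K m lam}
    (hx : e K m lam i * x = x) (h : corner x ∈ (sphericalHom K m lam hm).range) (f : R) :
    corner (f • x) ∈ (sphericalHom K m lam hm).range := by
  induction f using Polynomial.induction_on' with
  | add p q hp hq =>
    rw [add_smul, corner_add]
    exact add_mem hp hq
  | monomial n a =>
    rw [← Polynomial.C_mul_X_pow_eq_monomial, mul_smul, ← Polynomial.algebraMap_eq,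
      algebraMap_smul, corner_smul, ← corner_pow_mul_corner hi hx]
    exact Subalgebra.smul_mem _ (mul_mem (pow_mem (corner_X_smul_e_mem_range hm hi) n) h) a

theorem endArrow_mul_endArrow_mem_range (a b : SArrow) :
    endArrow K m lam hm a * endArrow K m lam hm b ∈ (sphericalHom K m lam hm).range :=
  mul_mem ⟨_, sphericalHom_arrow hm a⟩ ⟨_, sphericalHom_arrow hm b⟩

theorem corner_arrow_mem_range (θ : TArrow) (hs : θ.source ≠ .v2) (ht : θ.target ≠ .v2) :
    corner (arrow K m lam θ) ∈ (sphericalHom K m lam hm).range := by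
  cases θ
  case α => exact ⟨_, sphericalHom_arrow hm .σ⟩
  case β => exact absurd rfl ht
  case γ => exact ⟨_, sphericalHom_arrow hm .δ⟩
  case δ => exact ⟨_, sphericalHom_arrow hm .α⟩
  case ε => exact absurd rfl hs
  case η =>
    rw [← endArrow_β_ν hm]
    exact endArrow_mul_endArrow_mem_range hm _ _
  case μ =>
    rw [← endArrow_ω_γ hm]
    exact endArrow_mul_endArrow_mem_range hm _ _
  case ν => exact ⟨_, sphericalHom_arrow hm .ρ⟩
  case ξ =>
    have h : corner (vPoly m lam • tξ) ∈ (sphericalHom K m lam hm).range := by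
      rw [← endArrow_β_γ hm]
      exact endArrow_mul_endArrow_mem_range hm _ _
    -- Only `vξ` is directly an image, of `βγ`; multiplication by `u` recovers ξ.
    rw [← vPoly_smul_uPoly_smul (lam := lam) hm (X_pow_smul_arrow hm .ξ), smul_comm]
    exact corner_smul_mem_range hm (i := .v5) (by decide) (by rw [mul_smul_comm, e_ξ]) h _
  case ρ => exact absurd rfl hs
  case σ => exact absurd rfl ht
  case ω =>
    rw [← endArrow_ω_ν hm]
    exact endArrow_mul_endArrow_mem_range hm _ _

theorem corner_e_mem_range {i : Vertex} (hi : i ≠ .v2) :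
    corner (e K m lam i) ∈ (sphericalHom K m lam hm).range := by
  cases i
  case v1 => exact ⟨_, sphericalHom_e hm .v1⟩
  case v2 => exact absurd rfl hi
  case v3 => exact ⟨_, sphericalHom_e hm .v4⟩
  case v4 => exact ⟨_, sphericalHom_e hm .v5⟩
  case v5 => exact ⟨_, sphericalHom_e hm .v2⟩
  case v6 => exact ⟨_, sphericalHom_e hm .v6⟩

theorem corner_arrow_mul_mem_range (θ : TArrow) (hs : θ.source ≠ .v2) (ht : θ.target ≠ .v2)
    {x : TetrahedralAlgebra K m lam} (h : corner x ∈ (sphericalHom K m lam hm).range) :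
    corner (arrow K m lam θ * x) ∈ (sphericalHom K m lam hm).range := by
  rw [← corner_arrow_mul_corner ht]
  exact mul_mem (corner_arrow_mem_range hm θ hs ht) h

theorem corner_pathTo_mem_range {i j : Vertex} (hi : i ≠ .v2) (hj : j ≠ .v2) :
    corner (pathTo K m lam i j) ∈ (sphericalHom K m lam hm).range := by
  have h1 (θ : TArrow) := corner_arrow_mem_range (lam := lam) hm θ
  have h2 (θ θ' : TArrow) (hs : θ.source ≠ .v2) (ht : θ.target ≠ .v2) (hs' : θ'.source ≠ .v2)
      (ht' : θ'.target ≠ .v2) := corner_arrow_mul_mem_range hm θ hs ht (h1 θ' hs' ht')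
  have h3 (θ θ' θ'' : TArrow) (hs : θ.source ≠ .v2) (ht : θ.target ≠ .v2) (hs' : θ'.source ≠ .v2)
      (ht' : θ'.target ≠ .v2) (hs'' : θ''.source ≠ .v2) (ht'' : θ''.target ≠ .v2) :=
    corner_arrow_mul_mem_range hm θ hs ht (h2 θ' θ'' hs' ht' hs'' ht'')
  cases i <;> cases j <;> simp only [ne_eq, not_true_eq_false] at hi hj <;> simp only [pathTo] <;>
    with_reducible first
    | refine corner_e_mem_range hm ?_
    | refine h1 _ ?_ ?_
    | refine h2 _ _ ?_ ?_ ?_ ?_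
    | refine h3 _ _ _ ?_ ?_ ?_ ?_ ?_ ?_
  all_goals decide

theorem e_mul_pathTo (i j : Vertex) : e K m lam i * pathTo K m lam i j = pathTo K m lam i j := by
  cases i <;> cases j <;>
    simp only [pathTo, e_mul_e, ← mul_assoc, e_α, e_β, e_γ, e_δ, e_ε, e_η, e_μ, e_ν, e_ξ, e_ρ, e_σ,
      e_ω]

theorem corner_mem_range (x : TetrahedralAlgebra K m lam) :
    corner x ∈ (sphericalHom K m lam hm).range := by
  let M : AddSubmonoid (TetrahedralAlgebra K m lam) :=
    { carrier := {x | corner x ∈ (sphericalHom K m lam hm).range}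
      add_mem' := fun {a b} ha hb => by
        rw [Set.mem_ofPred_eq, corner_add]
        exact add_mem ha hb
      zero_mem' := by
        rw [Set.mem_ofPred_eq, corner_zero]
        exact zero_mem _ }
  change x ∈ M
  rw [← one_mul x, ← mul_one (1 * x), ← sum_e, Finset.sum_mul, Finset.sum_mul]
  refine sum_mem fun i _ => ?_
  rw [Finset.mul_sum]
  refine sum_mem fun j _ => ?_
  change corner _ ∈ (sphericalHom K m lam hm).range
  by_cases hi : i = .v2
  · rw [hi, mul_assoc, corner_e_v2_mul]
    exact zero_mem _
  by_cases hj : j = .v2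
  · rw [hj, corner_mul_e_v2]
    exact zero_mem _
  obtain ⟨f, hf⟩ := exists_eq_smul_pathTo hm i j x
  rw [hf]
  exact corner_smul_mem_range hm hi (e_mul_pathTo i j) (corner_pathTo_mem_range hm hi hj) f

theorem row_mem_range (u v : TetrahedralAlgebra K m lam) :
    row u v ∈ (sphericalHom K m lam hm).range := by
  have h3 : row (e K m lam .v3) 0 * corner u = row u 0 := by
    rw [row_left_mul_corner, row, row, J_mul, Category.assoc, J_e_leg3]
  have h4 : row 0 (e K m lam .v4) * corner v = row 0 v := by
    rw [row_right_mul_corner, row, row, J_mul, Category.assoc, J_e_leg4]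
  rw [show row u v = row u 0 + row 0 v by rw [← row_add, add_zero, zero_add], ← h3, ← h4]
  exact add_mem (mul_mem ⟨_, sphericalHom_arrow hm .γ⟩ (corner_mem_range hm u))
    (mul_mem ⟨_, sphericalHom_arrow hm .ν⟩ (corner_mem_range hm v))

/-- Such a map factors through the regular module, and every map from the regular module to `T` is a
corner plus a row. -/
theorem mul_corner_one_mem_range (g : End (THo K m lam)) :
    g * corner 1 ∈ (sphericalHom K m lam hm).range := by
  obtain ⟨w, u, v, h⟩ := exists_eq_of_regularHo_hom (iT K m lam ≫ g)
  have hg : g * corner 1 = corner w + row u v := by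
    rw [End.mul_def, corner, J_one, Category.id_comp, Category.assoc, h, corner, row,
      ← Preadditive.comp_add, add_assoc]
  rw [hg]
  exact add_mem (corner_mem_range hm w) (row_mem_range hm u v)

end

end TetrahedralAlgebra

end

/-! ### Solving `wγ = x`, `wν = y` in `S` -/

section

namespace SphericalAlgebra

open Polynomial
open TetrahedralAlgebra (uPoly vPoly vPoly_smul_uPoly_smul mul_mul_of_mul_eq_smul)

variable {K : Type u} [Field K] {m : ℕ} {lam : K}

local notation "sα" => arrow K m lam SArrow.α
local notation "sβ" => arrow K m lam SArrow.β
local notation "sγ" => arrow K m lam SArrow.γ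
local notation "sδ" => arrow K m lam SArrow.δ
local notation "sν" => arrow K m lam SArrow.ν
local notation "sρ" => arrow K m lam SArrow.ρ
local notation "sσ" => arrow K m lam SArrow.σ
local notation "sω" => arrow K m lam SArrow.ω


open TetrahedralAlgebra (vPoly_smul_eq_self)

theorem X_pow_dvd_of_smul_wordTo_eq_zero (hm : 2 ≤ m) (hlam : lam ≠ 0) {i j : Vertex} {f : K[X]}
    (h : f • wordTo K m lam i j = 0) : X ^ (m + 1 - coexpo i j) ∣ f :=
  X_pow_dvd_of_sphericalHom_eq_zero hm hlam (by rw [h, map_zero])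

theorem smul_wordTo_congr (hm : 2 ≤ m) (hlam : lam ≠ 0) {i j : Vertex} {f g : K[X]}
    (h : X ^ (m + 1 - coexpo i j) ∣ f - g) : f • wordTo K m lam i j = g • wordTo K m lam i j := by
  obtain ⟨p, hp⟩ := h
  rw [← sub_eq_zero, ← sub_smul, hp, mul_comm, mul_smul, X_pow_smul_wordTo hm hlam, smul_zero]

theorem dvd_sub_of_smul_wordTo_eq (hm : 2 ≤ m) (hlam : lam ≠ 0) {i j : Vertex} {f g : K[X]}
    (h : f • wordTo K m lam i j = g • wordTo K m lam i j) :
    X ^ (m + 1 - coexpo i j) ∣ f - g :=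
  X_pow_dvd_of_smul_wordTo_eq_zero hm hlam (by rw [sub_smul, h, sub_self])

theorem exists_eq_smul_wordTo (hm : 2 ≤ m) (hlam : lam ≠ 0) {i j : Vertex}
    (hij : wordTo' K m lam i j = wordTo K m lam i j) {x : SphericalAlgebra K m lam}
    (hi : e K m lam i * x = x) (hj : x * e K m lam j = x) :
    ∃ f : K[X], x = f • wordTo K m lam i j := by
  obtain ⟨f, g, h⟩ := exists_eq_smul_add_smul hm hlam i j x
  exact ⟨f + g, by rw [add_smul, ← hj, ← hi, h, hij]⟩

/-- A row `(x, y)` that satisfies the relations between `γ` and `ν` is a multiple of `(γ, ν)`. -/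
theorem exists_mul_γ_eq_and_mul_ν_eq_of_e_mul (hm : 2 ≤ m) (hlam : lam ≠ 0) {i : Vertex}
    {x y : SphericalAlgebra K m lam} (hx : e K m lam i * x = x) (hx' : x * e K m lam .v4 = x)
    (hy : e K m lam i * y = y) (hy' : y * e K m lam .v5 = y)
    (hα : y * (sδ * sα) = uPoly m lam • (x * (sσ * sα)))
    (hρ : y * (sδ * sρ) = x * (sσ * sρ)) :
    ∃ w, w * e K m lam .v3 = w ∧ w * sγ = x ∧ w * sν = y := by
  obtain ⟨f, rfl⟩ := exists_eq_smul_wordTo hm hlam (by cases i <;> rfl) hx hx'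
  obtain ⟨g, rfl⟩ := exists_eq_smul_wordTo hm hlam (by cases i <;> rfl) hy hy'
  have hX : (X ^ m : K[X]) = X ^ (m - 1) * X := by rw [← pow_succ, Nat.sub_add_cancel (by omega)]
  have hX0 : (X : K[X]) ≠ 0 := Polynomial.X_ne_zero
  simp only [smul_mul_assoc] at hα hρ
  cases i
  case v1 =>
    have h : (g * X) • wordTo K m lam .v1 .v6 = (f * X) • wordTo K m lam .v1 .v6 := by
      simp only [wordTo, mul_assoc, mul_mul_mul_of_eq ωγσ, ωνδρ_eq, mul_smul_comm, ρ_e] at hρ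
      simpa only [mul_smul, wordTo] using hρ
    have h1 := dvd_sub_of_smul_wordTo_eq hm hlam h
    rw [show m + 1 - coexpo .v1 .v6 = m from rfl, hX, ← sub_mul, mul_dvd_mul_iff_right hX0] at h1
    obtain ⟨p, hp⟩ := h1
    have hf : f = g - X ^ (m - 1) * p := by rw [← hp]; ring
    -- Both generators at `(1,3)` are needed: they agree after ν, while after γ they differ by the
    -- factor `v`. The multiple `λ⁻¹p` of `αβ` thus accounts for `g - f = X^(m-1)p`.
    refine ⟨(g - C lam⁻¹ * p) • (sρ * sω) + (C lam⁻¹ * p) • (sα * sβ), ?_, ?_, ?_⟩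
    · rw [add_mul, smul_mul_assoc, smul_mul_assoc, mul_assoc, mul_assoc, β_e, ω_e]
    · rw [add_mul, smul_mul_assoc, smul_mul_assoc, mul_assoc, mul_assoc, αβγ hm, ← mul_smul,
        ← add_smul, hf]
      refine congrArg (· • wordTo K m lam .v1 .v4) ?_
      have : (C lam⁻¹ * C lam : K[X]) = 1 := by rw [← C_mul, inv_mul_cancel₀ hlam, C_1]
      rw [vPoly]
      linear_combination (-p * X ^ (m - 1)) * this
    · rw [add_mul, smul_mul_assoc, smul_mul_assoc, mul_assoc, mul_assoc, αβν, ← add_smul,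
        sub_add_cancel, wordTo]
  case v2 =>
    -- The condition on α is used here. The one on ρ lands in `(2,6)`, where the generator is killed
    -- by `X^(m-1)` and would determine `g` only modulo `X^(m-1)`.
    have h : (g * X) • wordTo K m lam .v2 .v2 =
        ((f * (uPoly m lam * vPoly m lam)) * X) • wordTo K m lam .v2 .v2 := by
      simp only [wordTo, mul_assoc, βνδα_eq, γσα hm, mul_smul_comm] at hα
      rw [mul_smul, wordTo_self, hα]
      simp only [← mul_smul]
      congr 1
      ring
    have h1 := dvd_sub_of_smul_wordTo_eq hm hlam h
    rw [show m + 1 - coexpo .v2 .v2 = m + 1 from rfl, pow_succ, ← sub_mul,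
      mul_dvd_mul_iff_right hX0] at h1
    refine ⟨f • sβ, by rw [smul_mul_assoc, β_e], by simp only [smul_mul_assoc, wordTo], ?_⟩
    have h2 := smul_wordTo_congr (i := .v2) (j := .v5) hm hlam h1
    rw [mul_comm (uPoly m lam), mul_smul, mul_smul,
      vPoly_smul_uPoly_smul hm (X_pow_smul_wordTo hm hlam .v2 .v5)] at h2
    rw [h2, smul_mul_assoc, wordTo]
  case v3 =>
    have h : g • wordTo K m lam .v3 .v6 = f • wordTo K m lam .v3 .v6 := by
      simpa only [wordTo, γσρ] using hρ
    refine ⟨f • e K m lam .v3, by rw [smul_mul_assoc, e_mul_e], by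
      simp only [smul_mul_assoc, e_γ, wordTo], ?_⟩
    rw [smul_mul_assoc, e_ν]
    exact (smul_wordTo_congr (i := .v3) (j := .v5) hm hlam
      (dvd_sub_of_smul_wordTo_eq (i := .v3) (j := .v6) hm hlam h)).symm
  case v4 =>
    have h : (g * X) • wordTo K m lam .v4 .v6 = f • wordTo K m lam .v4 .v6 := by
      simp only [wordTo, mul_assoc, ωνδρ_eq, mul_smul_comm, ρ_e, e_mul_mul e_σ] at hρ
      rw [mul_smul, wordTo]
      exact hρ
    obtain ⟨p, hp⟩ := dvd_sub_of_smul_wordTo_eq hm hlam h.symm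
    rw [show m + 1 - coexpo .v4 .v6 = m from rfl, hX] at hp
    have hf : f = (g + X ^ (m - 1) * p) * X := by linear_combination hp
    -- The correction `X^(m-1)p` adjusts `wγ` and is invisible in `wν`, as `X^(m-1)` kills `σρων`.
    refine ⟨(g + X ^ (m - 1) * p) • (sσ * (sρ * sω)), ?_, ?_, ?_⟩
    · simp only [smul_mul_assoc, mul_assoc, ω_e]
    · simp only [smul_mul_assoc, mul_assoc, σρωγ_eq]
      rw [← mul_smul, ← hf, wordTo]
    · simp only [smul_mul_assoc, mul_assoc]
      refine smul_wordTo_congr hm hlam (i := .v4) (j := .v5) ?_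
      rw [add_sub_cancel_left]
      exact dvd_mul_right _ _
  case v5 =>
    have h : g • wordTo K m lam .v5 .v6 = (f * X) • wordTo K m lam .v5 .v6 := by
      simp only [wordTo, mul_assoc, mul_mul_mul_of_eq ωγσ, ωνδρ_eq, mul_smul_comm, ρ_e,
        e_mul_mul e_δ] at hρ
      rw [mul_smul, wordTo]
      exact hρ
    obtain ⟨p, hp⟩ := dvd_sub_of_smul_wordTo_eq hm hlam h
    rw [show m + 1 - coexpo .v5 .v6 = m from rfl, hX] at hp
    have hg : g = (f + X ^ (m - 1) * p) * X := by linear_combination hp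
    -- Here the correction adjusts `wν` and is invisible in `wγ`, as `X^(m-1)` kills `δρωγ`.
    refine ⟨(f + X ^ (m - 1) * p) • (sδ * (sρ * sω)), ?_, ?_, ?_⟩
    · simp only [smul_mul_assoc, mul_assoc, ω_e]
    · simp only [smul_mul_assoc, mul_assoc]
      refine smul_wordTo_congr hm hlam (i := .v5) (j := .v4) ?_
      rw [add_sub_cancel_left]
      exact dvd_mul_right _ _
    · simp only [smul_mul_assoc, mul_assoc, δρων_eq]
      rw [← mul_smul, ← hg, wordTo]
  case v6 =>
    have h : (g * X) • wordTo K m lam .v6 .v6 = (f * X) • wordTo K m lam .v6 .v6 := by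
      simp only [wordTo, mul_assoc, mul_mul_mul_of_eq ωγσ, ωνδρ_eq] at hρ
      simpa only [mul_smul, wordTo] using hρ
    have h1 := dvd_sub_of_smul_wordTo_eq hm hlam h
    rw [show m + 1 - coexpo .v6 .v6 = m + 1 from rfl, pow_succ, ← sub_mul,
      mul_dvd_mul_iff_right hX0] at h1
    refine ⟨f • sω, by rw [smul_mul_assoc, ω_e], by simp only [smul_mul_assoc, wordTo], ?_⟩
    rw [smul_mul_assoc]
    exact (smul_wordTo_congr (i := .v6) (j := .v5) hm hlam h1).symm

theorem exists_mul_γ_eq_and_mul_ν_eq (hm : 2 ≤ m) (hlam : lam ≠ 0)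
    {x y : SphericalAlgebra K m lam} (hx : x * e K m lam .v4 = x) (hy : y * e K m lam .v5 = y)
    (hα : y * (sδ * sα) = uPoly m lam • (x * (sσ * sα)))
    (hρ : y * (sδ * sρ) = x * (sσ * sρ)) :
    ∃ w, w * e K m lam .v3 = w ∧ w * sγ = x ∧ w * sν = y := by
  have key (i : Vertex) : ∃ w, w * e K m lam .v3 = w ∧ w * sγ = e K m lam i * x ∧
      w * sν = e K m lam i * y := by
    refine exists_mul_γ_eq_and_mul_ν_eq_of_e_mul hm hlam (i := i) ?_ ?_ ?_ ?_ ?_ ?_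
    · rw [← mul_assoc, e_mul_e]
    · rw [mul_assoc, hx]
    · rw [← mul_assoc, e_mul_e]
    · rw [mul_assoc, hy]
    · rw [mul_assoc, hα, mul_smul_comm, mul_assoc]
    · rw [mul_assoc, hρ, mul_assoc]
  choose w h1 h2 h3 using key
  refine ⟨∑ i, w i, ?_, ?_, ?_⟩
  · simp only [Finset.sum_mul, h1]
  · simp only [Finset.sum_mul, h2]
    rw [← Finset.sum_mul, sum_e, one_mul]
  · simp only [Finset.sum_mul, h3]
    rw [← Finset.sum_mul, sum_e, one_mul]

end SphericalAlgebra

end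

/-! ### Surjectivity -/

section

namespace TetrahedralAlgebra

open Polynomial (X C)
open SphericalAlgebra (mul_pow_mul)

variable {K : Type u} [Field K] {m : ℕ} {lam : K}

local notation "R" => Polynomial K
local notation "tα" => arrow K m lam TArrow.α
local notation "tβ" => arrow K m lam TArrow.β
local notation "tγ" => arrow K m lam TArrow.γ
local notation "tδ" => arrow K m lam TArrow.δ
local notation "tε" => arrow K m lam TArrow.ε
local notation "tη" => arrow K m lam TArrow.η
local notation "tμ" => arrow K m lam TArrow.μ
local notation "tν" => arrow K m lam TArrow.ν
local notation "tξ" => arrow K m lam TArrow.ξ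
local notation "tρ" => arrow K m lam TArrow.ρ
local notation "tσ" => arrow K m lam TArrow.σ
local notation "tω" => arrow K m lam TArrow.ω

section

variable (hm : 2 ≤ m)

theorem eq_zero_of_mul_endArrow_eq_zero {g : End (THo K m lam)} (h1 : g * corner 1 = 0)
    (hγ : g * endArrow K m lam hm .γ = 0) (hν : g * endArrow K m lam hm .ν = 0) :
    iT K m lam ≫ g = 0 ∧ leg3 K m lam ≫ g = 0 ∧ leg4 K m lam ≫ g = 0 := by
  have key {f : regularHo K m lam ⟶ THo K m lam} (hf : J (1 - e K m lam .v2) ≫ f = f)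
      (h : pT K m lam ≫ f ≫ g = 0) : f ≫ g = 0 := by
    rw [← hf, Category.assoc, ← iT_pT, Category.assoc, h, Limits.comp_zero]
  have hJ {i : Vertex} (hi : i ≠ .v2) :
      J (1 - e K m lam .v2) ≫ J (e K m lam i) = J (e K m lam i) := by
    rw [← J_mul, mul_sub, mul_one, e_mul_e_of_ne K m lam hi, sub_zero]
  refine ⟨key J_sub_iT ?_, key ?_ ?_, key ?_ ?_⟩
  · rwa [End.mul_def, corner, J_one, Category.id_comp, Category.assoc] at h1
  · rw [← J_e_leg3, ← Category.assoc, hJ (by decide)]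
  · rwa [End.mul_def, endArrow, row, J_zero, Limits.zero_comp, add_zero, J_e_leg3,
      Category.assoc] at hγ
  · rw [← J_e_leg4, ← Category.assoc, hJ (by decide)]
  · rwa [End.mul_def, endArrow, row, J_zero, Limits.zero_comp, zero_add, J_e_leg4,
      Category.assoc] at hν

theorem mul_endArrow_mem_range (g : End (THo K m lam)) {a : SArrow}
    (ha : endIdem K m lam a.target * corner 1 = endIdem K m lam a.target) :
    ∃ x, x * SphericalAlgebra.e K m lam a.target = x ∧
      sphericalHom K m lam hm x = g * endArrow K m lam hm a := by
  obtain ⟨x, hx⟩ := mul_corner_one_mem_range hm (g * endArrow K m lam hm a)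
  replace hx : sphericalHom K m lam hm x = g * endArrow K m lam hm a := by
    refine hx.trans ?_
    rw [← endArrow_mul_endIdem, mul_assoc, mul_assoc, ha]
  refine ⟨x * SphericalAlgebra.e K m lam a.target, ?_, ?_⟩
  · rw [mul_assoc, SphericalAlgebra.e_mul_e]
  · rw [map_mul, hx, sphericalHom_e, mul_assoc, endArrow_mul_endIdem]

/-- The products of `g` with the images of γ and ν are maps out of degree `0` summands, hence images
of `x` and `y` in `S`. The relations `νδα = uγσα` and `νδρ = γσρ`, multiplied by `g`, descend to `x`
and `y` by injectivity. So `x = wγ` and `y = wν`, and `g` differs from the image of `w` by a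
multiple of the image of `X^m e 3`. -/
theorem mem_range_of_mul_corner_one_eq_zero (hlam : lam ≠ 0) {g : End (THo K m lam)}
    (h1 : g * corner 1 = 0) : g ∈ (sphericalHom K m lam hm).range := by
  obtain ⟨x, hx, hgx⟩ := mul_endArrow_mem_range hm g (a := .γ) (corner_e_mul_corner_one (by decide))
  obtain ⟨y, hy, hgy⟩ := mul_endArrow_mem_range hm g (a := .ν) (corner_e_mul_corner_one (by decide))
  rw [← sphericalHom_arrow] at hgx hgy
  have hmul {a b : SphericalAlgebra K m lam} (z : SphericalAlgebra K m lam)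
      (h : sphericalHom K m lam hm a = g * sphericalHom K m lam hm b) :
      sphericalHom K m lam hm (a * z) = g * sphericalHom K m lam hm (b * z) := by
    rw [map_mul, h, mul_assoc, map_mul]
  have hinj := SphericalAlgebra.sphericalHom_injective (K := K) (lam := lam) hm hlam
  obtain ⟨w, hw, hwx, hwy⟩ := SphericalAlgebra.exists_mul_γ_eq_and_mul_ν_eq hm hlam hx hy
    (by
      refine hinj ?_
      rw [hmul _ hgy, SphericalAlgebra.νδα hm, ← mul_smul_comm,
        ← mul_smul_comm (uPoly m lam) x]
      exact (hmul _ hgx).symm)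
    (by
      refine hinj ?_
      rw [hmul _ hgy, hmul _ hgx, SphericalAlgebra.γσρ])
  have hw1 : sphericalHom K m lam hm w * corner 1 = 0 := by
    rw [← hw, map_mul, sphericalHom_e, endIdem, mul_assoc, sub_mul, one_mul,
      corner_one_mul_corner_one, sub_self, mul_zero]
  obtain ⟨hi, h3, h4⟩ := eq_zero_of_mul_endArrow_eq_zero hm (g := g - sphericalHom K m lam hm w)
    (by rw [sub_mul, h1, hw1, sub_zero])
    (by rw [sub_mul, ← sphericalHom_arrow, ← hgx, ← hwx, map_mul, sub_self])
    (by rw [sub_mul, ← sphericalHom_arrow, ← hgy, ← hwy, map_mul, sub_self])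
  obtain ⟨κ, hκ⟩ := exists_eq_of_THo_end hm hi h3 h4
  obtain ⟨H, hH⟩ := SphericalAlgebra.sphericalHom_X_pow_smul_e_v3 (K := K) (lam := lam) hm
  have H' : κ • (X ^ m : R) • e K m lam .v3 * tσ = 0 * tβ := by
    rw [smul_mul_assoc, H, zero_mul, smul_zero]
  have hs : g - sphericalHom K m lam hm w =
      sphericalHom K m lam hm (κ • (X ^ m : R) • SphericalAlgebra.e K m lam .v3) := by
    rw [map_smul, hH, hκ H', ← Linear.smul_comp]
    exact congrArg (· ≫ _)
      ((ofCokernel_congr rfl (smul_zero κ).symm _ _).trans (ofCokernel_smul H κ).symm)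
  rw [← sub_add_cancel g (sphericalHom K m lam hm w), hs]
  exact add_mem ⟨_, rfl⟩ ⟨_, rfl⟩

theorem sphericalHom_surjective (hlam : lam ≠ 0) :
    Function.Surjective (sphericalHom K m lam hm) := by
  intro g
  have h : g * (1 - corner 1) * corner 1 = 0 := by
    rw [mul_assoc, sub_mul, one_mul, corner_one_mul_corner_one, sub_self, mul_zero]
  have hg : g = g * (1 - corner 1) + g * corner 1 := by rw [mul_sub, mul_one, sub_add_cancel]
  rw [hg]
  exact add_mem (mem_range_of_mul_corner_one_eq_zero hm hlam h) (mul_corner_one_mem_range hm g)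

end

variable (K m lam) in
/-- The endomorphism algebra of `T` in `K^b(P_Λ)` is that of `T` in the homotopy category. -/
noncomputable def endTEquiv : End (T K m lam) ≃ₐ[K] End (THo K m lam) where
  toFun f := f.hom
  invFun f := ⟨f⟩
  left_inv _ := rfl
  right_inv _ := rfl
  map_mul' _ _ := rfl
  map_add' _ _ := rfl
  commutes' _ := rfl

end TetrahedralAlgebra

end

theorem theorem5p3 {K : Type*} [Field K] [IsAlgClosed K] (m : ℕ) (hm : 2 ≤ m)
    (lam : K) (hlam : lam ≠ 0) :
    Nonempty (End (TetrahedralAlgebra.T K m lam) ≃ₐ[K] SphericalAlgebra K m lam) :=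
  ⟨(TetrahedralAlgebra.endTEquiv K m lam).trans
    (AlgEquiv.ofBijective (TetrahedralAlgebra.sphericalHom K m lam hm)
      ⟨SphericalAlgebra.sphericalHom_injective hm hlam,
        TetrahedralAlgebra.sphericalHom_surjective hm hlam⟩).symm⟩
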